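/- Let $(\mathcal S,\mathcal A,P)$ be a probability space with expectation $E$, and let $c=\{c(t,x):t\ge 0,\ x\in\mathbb R\}$ be a real random field on it such that, for each $x\in\mathbb R$, $t\mapsto c(t,x)$ is a.s. of class $C^2$ on $\mathbb R_+=[0,\infty)$ (one-sided derivatives at $0$). Write $c'=\partial c/\partial t$, $c''=\partial^2 c/\partial t^2$, and assume the following. 1. The $\mathbb R^3$-valued random field $(c,c',c'')$ is jointly measurable in $(t,x,\omega)$, stationary (its finite-dimensional laws are invariant under $(t,x)\mapsto(t+s,x+y)$, $s\ge0$, $y\in\mathbb R$), has zero mean, and is uniformly bounded: there is a constant $K$ such that for all $t\ge 0$, $x\in\mathbb R$, a.s. $|c(t,x)|,|c'(t,x)|,|c''(t,x)|\le K$. 2. The correlation function $\Phi(t,x)=E[c(s,y)c(s+t,y+x)]$, $t,x\in\mathbb R$ (which by stationarity does not depend on $y\in\mathbb R$ and $s\ge0$ with $s+t\ge0$), belongs to $L^1(\mathbb R\times\mathbb R)$. Put $\Psi(r)=\int_{\mathbb R}\Phi(r,y)\,dy$. 3. With $\mathcal G_x=\sigma\{c(t,z):t\ge0,\ z\le x\}$,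 $\mathcal G^{y}=\sigma\{c(t,z):t\ge0,\ z\ge y\}$ and $$\phi(h)=\sup\{|P(B\mid A)-P(B)|:\ x\in\mathbb R,\ A\in\mathcal G_x,\ P(A)>0,\ B\in\mathcal G^{x+h}\},$$ one has $\int_0^\infty\phi^{1/2}(h)\,dh<\infty$. 4. For every $t\ge0$, the functions $x\mapsto E[c(t,0)c(t,x)]$, $x\mapsto E[c'(t,0)c'(t,x)]$ and $x\mapsto E[c''(t,0)c''(t,x)]$ are integrable on $\mathbb R$. For $\varepsilon>0$, $t\ge 0$, $x\in\mathbb R$ put $$W_\varepsilon(t,x)=\frac1{\sqrt\varepsilon}\int_0^x c\Big(t,\frac y\varepsilon\Big)dy,\qquad W'_\varepsilon(t,x)=\frac1{\sqrt\varepsilon}\int_0^x c'\Big(t,\frac y\varepsilon\Big)dy .$$ Then for every $\varepsilon>0$ the random field $(W_\varepsilon,W'_\varepsilon)$ has a modification which is a random element of $C(\mathbb R_+\times\mathbb R;\mathbb R^2)$, equipped with the topology of uniform convergence on compact sets. Moreover, there is a centered (jointly) Gaussian random field $(W,W')$, with paths in $C(\mathbb R_+\times\mathbb R;\mathbb R^2)$,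 such that $$E\big[W(t,x)W(t',x')\big]=\begin{cases}\Psi(t-t')\,(|x|\wedge|x'|),& xx'>0,\\ 0,& xx'\le0,\end{cases}$$ and a.s. $W'(t,x)=\dfrac{\partial W}{\partial t}(t,x)$ for all $(t,x)\in\mathbb R_+\times\mathbb R$, and such that, as $\varepsilon\to0^+$, $(W_\varepsilon,W'_\varepsilon)$ (any such modifications) converges weakly in $C(\mathbb R_+\times\mathbb R;\mathbb R^2)$ to $(W,W')$. -/

import Mathlib

open MeasureTheory ProbabilityTheory Set Filter Topology
open scoped NNReal ENNReal

noncomputable section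

/-- Right-sided-at-zero time derivative of a function of `t ∈ ℝ₊`: the derivative within `[0, ∞)`. -/
def timeDeriv (f : ℝ≥0 → ℝ) (t : ℝ≥0) : ℝ :=
  derivWithin (fun s : ℝ => f s.toNNReal) (Ici 0) (t : ℝ)

/-- `f : ℝ₊ → ℝ` is of class `C²` (one-sided derivatives at `0`). -/
def IsC2OnHalfLine (f : ℝ≥0 → ℝ) : Prop :=
  ContDiffOn ℝ 2 (fun s : ℝ => f s.toNNReal) (Ici 0)

section Field

variable {S : Type*} [MeasurableSpace S]

/-- The field `c' = ∂c/∂t`. -/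
def fieldDeriv (c : ℝ≥0 → ℝ → S → ℝ) (t : ℝ≥0) (x : ℝ) (ω : S) : ℝ :=
  timeDeriv (fun s => c s x ω) t

/-- The `ℝ³`-valued random field `(c, c', c'')`. -/
def tripleField (c : ℝ≥0 → ℝ → S → ℝ) (t : ℝ≥0) (x : ℝ) (ω : S) : ℝ × ℝ × ℝ :=
  (c t x ω, fieldDeriv c t x ω, fieldDeriv (fieldDeriv c) t x ω)

/-- Joint measurability in `(t, x, ω)` of a random field. -/
def IsMeasurableField {E : Type*} [MeasurableSpace E] (X : ℝ≥0 → ℝ → S → E) : Prop :=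
  Measurable (fun p : (ℝ≥0 × ℝ) × S => X p.1.1 p.1.2 p.2)

/-- Stationarity of a random field indexed by `ℝ₊ × ℝ`: the finite-dimensional laws are invariant
under all shifts `(t, x) ↦ (t + s, x + y)`, `s ≥ 0`, `y ∈ ℝ`. -/
def IsStationaryField {E : Type*} [MeasurableSpace E] (X : ℝ≥0 → ℝ → S → E) (P : Measure S) :
    Prop :=
  ∀ (s : ℝ≥0) (y : ℝ) (n : ℕ) (p : Fin n → ℝ≥0 × ℝ),
    IdentDistrib (fun ω i => X ((p i).1 + s) ((p i).2 + y) ω)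
      (fun ω i => X (p i).1 (p i).2 ω) P P

/-- `σ{c(t,z) : t ≥ 0, z ≤ x}`. -/
@[reducible] def pastSigma (c : ℝ≥0 → ℝ → S → ℝ) (x : ℝ) : MeasurableSpace S :=
  ⨆ (t : ℝ≥0) (z : ℝ) (_ : z ≤ x), MeasurableSpace.comap (c t z) inferInstance

/-- `σ{c(t,z) : t ≥ 0, z ≥ y}`. -/
@[reducible] def futureSigma (c : ℝ≥0 → ℝ → S → ℝ) (y : ℝ) : MeasurableSpace S :=
  ⨆ (t : ℝ≥0) (z : ℝ) (_ : y ≤ z), MeasurableSpace.comap (c t z) inferInstance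

/-- The `φ`-mixing coefficient in the `x` direction: the supremum of `|P(B|A) - P(B)|` over
`x ∈ ℝ`, `A ∈ σ{c(t,z) : z ≤ x}` with `P(A) > 0`, and `B ∈ σ{c(t,z) : z ≥ x + h}`. -/
def phiMixing (c : ℝ≥0 → ℝ → S → ℝ) (P : Measure S) (h : ℝ) : ℝ :=
  sSup {r : ℝ | ∃ (x : ℝ) (A B : Set S), MeasurableSet[pastSigma c x] A ∧
    MeasurableSet[futureSigma c (x + h)] B ∧ 0 < P A ∧
    r = |(ProbabilityTheory.cond P A).real B - P.real B|}

/-- The correlation function `Φ(t,x) = E[c(s,y) c(s+t,y+x)]`, for `t, x ∈ ℝ`. By stationarity the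
right-hand side does not depend on `y` and on `s ≥ 0` with `s + t ≥ 0`
(see `corrFun_eq`); it is evaluated at `y = 0`, `s = max(-t, 0)`. -/
def corrFun (c : ℝ≥0 → ℝ → S → ℝ) (P : Measure S) (t x : ℝ) : ℝ :=
  ∫ ω, c (-t).toNNReal 0 ω * c t.toNNReal x ω ∂P

theorem corrFun_eq {c : ℝ≥0 → ℝ → S → ℝ} {P : Measure S} (hc : IsStationaryField c P)
    (s s' : ℝ≥0) (y x : ℝ) :
    ∫ ω, c s y ω * c s' (y + x) ω ∂P = corrFun c P ((s' : ℝ) - s) x := by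
  have h := hc (min s s') y 2 ![((-((s' : ℝ) - s)).toNNReal, 0), (((s' : ℝ) - s).toNNReal, x)]
  have h2 := h.comp (u := fun v : Fin 2 → ℝ => v 0 * v 1) (by fun_prop)
  have e1 : (-((s' : ℝ) - s)).toNNReal + min s s' = s := by
    apply NNReal.coe_injective
    rcases le_total s s' with hs | hs
    · have : (s : ℝ) ≤ s' := hs
      simp [min_eq_left hs, Real.coe_toNNReal', this]
    · have : (s' : ℝ) ≤ s := hs
      simp [min_eq_right hs, Real.coe_toNNReal', this]
  have e2 : ((s' : ℝ) - s).toNNReal + min s s' = s' := by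
    apply NNReal.coe_injective
    rcases le_total s s' with hs | hs
    · have : (s : ℝ) ≤ s' := hs
      simp [min_eq_left hs, Real.coe_toNNReal', this]
    · have : (s' : ℝ) ≤ s := hs
      simp [min_eq_right hs, Real.coe_toNNReal', this]
  have h3 := h2.integral_eq
  simp only [Function.comp_def, Matrix.cons_val_zero, Matrix.cons_val_one, e1, e2, zero_add] at h3
  rw [corrFun, ← h3, add_comm x y]

/-- `Ψ(r) = ∫_ℝ Φ(r, y) dy`. -/
def corrIntegral (c : ℝ≥0 → ℝ → S → ℝ) (P : Measure S) (r : ℝ) : ℝ :=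
  ∫ y, corrFun c P r y

/-- The covariance `Ψ(t - t') (|x| ∧ |x'|)` if `x x' > 0`, and `0` otherwise. -/
def limitCov (c : ℝ≥0 → ℝ → S → ℝ) (P : Measure S) (t : ℝ≥0) (x : ℝ) (t' : ℝ≥0) (x' : ℝ) : ℝ :=
  if 0 < x * x' then corrIntegral c P ((t : ℝ) - t') * min |x| |x'| else 0

/-- `ε^{-1/2} ∫_0^x X(t, y/ε) dy`. For `X = c` this is `W_ε`, for `X = c'` it is `W'_ε`. -/
def scaledIntegral (X : ℝ≥0 → ℝ → S → ℝ) (ε : ℝ) (t : ℝ≥0) (x : ℝ) (ω : S) : ℝ :=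
  1 / √ε * ∫ y in (0 : ℝ)..x, X t (y / ε) ω

end Field

/-- The path space `C(ℝ₊ × ℝ; ℝ²)`; Mathlib's topology on it is the compact-open topology, that is,
uniform convergence on compact sets. -/
abbrev PathSpace : Type := C(ℝ≥0 × ℝ, ℝ × ℝ)

instance instMeasurableSpacePathSpace : MeasurableSpace PathSpace := borel _

instance instBorelSpacePathSpace : BorelSpace PathSpace := ⟨rfl⟩

/-- `w` is the pair `(W_ε, W'_ε)` regarded as a random element of `C(ℝ₊ × ℝ; ℝ²)`: a measurable
(up to null sets) map into the path space which is a modification of the pair. The paths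
`t ↦ c(t,x)` are only almost surely regular for each `x`, hence the modification. -/
def IsPathVersion {S : Type*} [MeasurableSpace S] (c : ℝ≥0 → ℝ → S → ℝ) (P : Measure S) (ε : ℝ)
    (w : S → PathSpace) : Prop :=
  AEMeasurable w P ∧ ∀ (t : ℝ≥0) (x : ℝ), ∀ᵐ ω ∂P,
    w ω (t, x) = (scaledIntegral c ε t x ω, scaledIntegral (fieldDeriv c) ε t x ω)

/-- `Z = (W, W')` is a (jointly) Gaussian centered field with continuous paths, the covariance of
`W` is `K`, and almost surely `W' = ∂W/∂t` everywhere on `ℝ₊ × ℝ`. -/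
structure IsLimitField {Ω : Type*} [MeasurableSpace Ω] (Q : Measure Ω)
    (K : ℝ≥0 → ℝ → ℝ≥0 → ℝ → ℝ) (Z : Ω → PathSpace) : Prop where
  measurable : Measurable Z
  gaussian : IsGaussianProcess (fun (p : ℝ≥0 × ℝ) ω => Z ω p) Q
  centered : ∀ p : ℝ≥0 × ℝ, ∫ ω, (Z ω p).1 ∂Q = 0 ∧ ∫ ω, (Z ω p).2 ∂Q = 0
  covariance : ∀ (t : ℝ≥0) (x : ℝ) (t' : ℝ≥0) (x' : ℝ),
    ∫ ω, (Z ω (t, x)).1 * (Z ω (t', x')).1 ∂Q = K t x t' x'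
  deriv : ∀ᵐ ω ∂Q, ∀ (t : ℝ≥0) (x : ℝ),
    HasDerivWithinAt (fun s : ℝ => (Z ω (s.toNNReal, x)).1) (Z ω (t, x)).2 (Ici 0) (t : ℝ)

end

/-! Write `M` for the integral of the square root of the mixing rate. The proof is tightness plus
identification of the limit, and everything quantitative rests on one fourth moment bound. For
bounded centered fields, the expectation of a product at four sorted points is controlled by the
rate at the first gap and also at the last gap, hence by the product of the square roots of the two
rates. Integrating over all pairings (`IsMixing.integral_pow_four_le`) gives `48 * K ^ 4 * M ^ 2 *
(q - p) ^ 2`. Rescaling space by `ε` turns `M` into `ε * M`, so the prefactor `1 / √ε` makes the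
bound uniform in `ε`.

Finite-dimensional laws: a linear combination of values of `W_ε` and `W'_ε` is one weighted spatial
integral of finitely many mixing fields. It is additive over intervals and asymptotically
independent over separated ones. Leaving small gaps between blocks and expanding the characteristic
function of each block to second order gives a Gaussian limit (`tendsto_integral_cexp_of_additive`,
`IsMixing.tendsto_integral_cexp`). The correlation is integrable because the rate is at most a
constant times its square root, and the convolution form of the covariance concentrates on the
diagonal as `ε` tends to `0`.

Tightness: a union bound over dyadic points controls spatial increments at time zero, together with
the time integral of the fourth power of the increments of the integrated second derivative. Dyadic
chaining in space, and interpolation of this time average against the length of the time interval,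
give a modulus of continuity for the pair (`isModulatedOn_of_dyadic`,
`IsRegularMixingField.exists_isModulatedOn`). Arzelà–Ascoli and Prokhorov then give relative
compactness.

Identification: characteristic functions of finite linear combinations of coordinates determine a
measure on the path space, so all cluster points agree. The Gaussian field is thus obtained as the
limit instead of being constructed beforehand. The relation `W' = ∂W/∂t` survives because its
integral form is a closed condition satisfied by every prelimit path.

Since the paths of `c` are regular only almost surely for each `x`, the work is done on a version
built by truncating and integrating the second derivative (`regField_ae_eq`); any two continuous
versions agree almost surely (`IsPathVersion.ae_eq`). -/

/-! ### Covariance inequalities under mixing -/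

section Mixing

variable {S : Type*} {m : MeasurableSpace S} {P : Measure S}

/-- A past filtration, a future filtration and a rate `ψ` such that events of the past of `x` and
of the future of `x + h` are decorrelated up to `ψ h`, where `√ψ` is integrable. -/
structure IsMixing (P : Measure S) (past future : ℝ → MeasurableSpace S) (ψ : ℝ → ℝ) : Prop where
  past_le : ∀ x, past x ≤ m
  future_le : ∀ x, future x ≤ m
  past_mono : Monotone past
  future_anti : Antitone future
  rate_nonneg : ∀ h, 0 ≤ ψ h
  rate_anti : Antitone ψ
  rate_integrable : IntegrableOn (fun h => √(ψ h)) (Ioi 0)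
  decorrelation : ∀ x h, 0 ≤ h → ∀ A B, MeasurableSet[past x] A → MeasurableSet[future (x + h)] B →
    |P.real (A ∩ B) - P.real A * P.real B| ≤ ψ h

theorem integral_mul_condExp_of_bound [IsProbabilityMeasure P] {m₁ : MeasurableSpace S}
    (hm : m₁ ≤ m) {F G : S → ℝ} {A : ℝ} (hF : AEStronglyMeasurable[m₁] F P)
    (hFA : ∀ᵐ ω ∂P, |F ω| ≤ A) (hG : Integrable G P) :
    ∫ ω, F ω * (P[G|m₁]) ω ∂P = ∫ ω, F ω * G ω ∂P := by
  have hF0 : AEStronglyMeasurable[m] F P := hF.mono hm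
  have hFG : Integrable (fun ω => F ω * G ω) P := hG.bdd_mul hF0 hFA
  have h := condExp_mul_of_aestronglyMeasurable_left (m := m₁) (μ := P) hF hFG hG
  rw [← integral_condExp (μ := P) (f := fun ω => F ω * G ω) hm]
  exact (integral_congr_ae h).symm

/-- The covariance of a function measurable with respect to a sub-σ-algebra is controlled by the
covariances of the indicator functions of an event and its complement. -/
theorem exists_measurableSet_abs_cov_le [IsProbabilityMeasure P] {m₁ : MeasurableSpace S}
    (hm : m₁ ≤ m) {F G : S → ℝ} {A : ℝ} (hF : AEStronglyMeasurable[m₁] F P)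
    (hFA : ∀ᵐ ω ∂P, |F ω| ≤ A) (hG : Integrable G P) :
    ∃ s, MeasurableSet[m₁] s ∧ |∫ ω, F ω * G ω ∂P - (∫ ω, F ω ∂P) * ∫ ω, G ω ∂P| ≤
      A * (|∫ ω in s, G ω ∂P - P.real s * ∫ ω, G ω ∂P| +
        |∫ ω in sᶜ, G ω ∂P - P.real sᶜ * ∫ ω, G ω ∂P|) := by
  set e := ∫ ω, G ω ∂P
  set H : S → ℝ := fun ω => (P[G|m₁]) ω - e with hHdef
  have hHm : StronglyMeasurable[m₁] H := stronglyMeasurable_condExp.sub stronglyMeasurable_const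
  have hHi : Integrable H P := integrable_condExp.sub (integrable_const _)
  have hF0 : AEStronglyMeasurable[m] F P := hF.mono hm
  have hFb : ∀ᵐ ω ∂P, ‖F ω‖ ≤ A := hFA
  have hFi : Integrable F P := Integrable.of_bound hF0 A hFb
  have hFH : Integrable (fun ω => F ω * H ω) P := hHi.bdd_mul hF0 hFb
  have hFc : Integrable (fun ω => F ω * (P[G|m₁]) ω) P := integrable_condExp.bdd_mul hF0 hFb
  have h2 : ∫ ω, F ω * G ω ∂P - (∫ ω, F ω ∂P) * e = ∫ ω, F ω * H ω ∂P := by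
    rw [← integral_mul_condExp_of_bound hm hF hFA hG, ← integral_mul_const, ← integral_sub hFc (hFi.mul_const _)]
    simp only [hHdef, mul_sub]
  -- The bound on `F` leaves the `L¹` norm of `H`, which splits exactly over the set where `H` is
  -- nonnegative and its complement.
  have hs : MeasurableSet[m₁] {ω | 0 ≤ H ω} :=
    measurableSet_le measurable_const hHm.measurable
  have hset : ∀ s, MeasurableSet[m₁] s → ∫ ω in s, H ω ∂P = ∫ ω in s, G ω ∂P - P.real s * e := by
    intro s hs
    rw [hHdef, integral_sub integrable_condExp.integrableOn (integrable_const _),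
      setIntegral_condExp hm hG hs]
    simp
  refine ⟨_, hs, ?_⟩
  rw [h2, ← hset _ hs, ← hset _ hs.compl]
  set s := {ω | 0 ≤ H ω}
  have hA : 0 ≤ A := by
    obtain ⟨ω, hω⟩ := hFA.exists
    exact (abs_nonneg _).trans hω
  have h3 : |∫ ω, F ω * H ω ∂P| ≤ A * ∫ ω, |H ω| ∂P := by
    rw [← integral_const_mul]
    refine (abs_integral_le_integral_abs).trans
      (integral_mono_ae hFH.abs (hHi.abs.const_mul A) ?_)
    filter_upwards [hFA] with ω h
    rw [abs_mul]
    gcongr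
  refine h3.trans (mul_le_mul_of_nonneg_left ?_ hA)
  rw [← integral_add_compl (hm _ hs) hHi.abs]
  refine add_le_add ?_ ?_
  · refine le_trans (le_of_eq ?_) (le_abs_self _)
    refine setIntegral_congr_fun (hm _ hs) fun ω hω => abs_of_nonneg hω
  · refine le_trans (le_of_eq ?_) (neg_le_abs _)
    rw [← integral_neg]
    refine setIntegral_congr_fun (hm _ hs).compl fun ω hω => abs_of_nonpos ?_
    exact (not_le.1 (show ¬ 0 ≤ H ω from hω)).le

variable {past future : ℝ → MeasurableSpace S} {ψ : ℝ → ℝ}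

/-- The reduction to a sign event and its complement is applied twice, first to the past variable
and then to the future one. Only covariances of pairs of events remain, and the factor `4` counts
the two choices on each side. -/
theorem IsMixing.abs_cov_le [IsProbabilityMeasure P] (hP : IsMixing P past future ψ)
    {x y : ℝ} (hxy : x ≤ y) {F G : S → ℝ} {A B : ℝ}
    (hF : AEStronglyMeasurable[past x] F P) (hG : AEStronglyMeasurable[future y] G P)
    (hFA : ∀ᵐ ω ∂P, |F ω| ≤ A) (hGB : ∀ᵐ ω ∂P, |G ω| ≤ B) :
    |∫ ω, F ω * G ω ∂P - (∫ ω, F ω ∂P) * ∫ ω, G ω ∂P| ≤ 4 * A * B * ψ (y - x) := by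
  have hA : 0 ≤ A := by
    obtain ⟨ω, hω⟩ := hFA.exists
    exact (abs_nonneg _).trans hω
  have hB : 0 ≤ B := by
    obtain ⟨ω, hω⟩ := hGB.exists
    exact (abs_nonneg _).trans hω
  have hGi : Integrable G P := Integrable.of_bound (hG.mono (hP.future_le y)) B hGB
  obtain ⟨s, hs, hle⟩ := exists_measurableSet_abs_cov_le (hP.past_le x) hF hFA hGi
  have key : ∀ s, MeasurableSet[past x] s →
      |∫ ω in s, G ω ∂P - P.real s * ∫ ω, G ω ∂P| ≤ 2 * B * ψ (y - x) := by
    intro s hs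
    have hsm := hP.past_le x s hs
    -- The roles are exchanged: `G` is now the bounded variable of the small σ-algebra, tested
    -- against the indicator of `s`.
    obtain ⟨t, ht, hle⟩ := exists_measurableSet_abs_cov_le (P := P) (hP.future_le y) hG hGB
      (G := s.indicator fun _ => (1 : ℝ)) ((integrable_const _).indicator hsm)
    have key2 : ∀ t, MeasurableSet[future y] t →
        |∫ ω in t, s.indicator (fun _ => (1 : ℝ)) ω ∂P
          - P.real t * ∫ ω, s.indicator (fun _ => (1 : ℝ)) ω ∂P| ≤ ψ (y - x) := by
      intro t ht
      have h := hP.decorrelation x (y - x) (by linarith) s t hs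
        (by rwa [add_sub_cancel])
      rw [setIntegral_indicator hsm, integral_indicator_const _ hsm]
      simpa [inter_comm s t, mul_comm] using h
    have h0 : ∫ ω, G ω * s.indicator (fun _ => (1 : ℝ)) ω ∂P = ∫ ω in s, G ω ∂P := by
      rw [← integral_indicator hsm]
      congr 1 with ω
      by_cases h : ω ∈ s <;> simp [h]
    rw [h0, integral_indicator_const _ hsm] at hle
    rw [integral_indicator_const _ hsm] at key2
    calc |∫ ω in s, G ω ∂P - P.real s * ∫ ω, G ω ∂P|
        = |∫ ω in s, G ω ∂P - (∫ ω, G ω ∂P) * P.real s • (1 : ℝ)| := by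
          rw [smul_eq_mul, mul_one, mul_comm]
      _ ≤ B * (ψ (y - x) + ψ (y - x)) := hle.trans
          (mul_le_mul_of_nonneg_left (add_le_add (key2 t ht) (key2 _ ht.compl)) hB)
      _ = 2 * B * ψ (y - x) := by ring
  calc _ ≤ A * (2 * B * ψ (y - x) + 2 * B * ψ (y - x)) := hle.trans
        (mul_le_mul_of_nonneg_left (add_le_add (key s hs) (key _ hs.compl)) hA)
    _ = _ := by ring

/-- Decorrelation of the characters of a past and a future random variable. -/
theorem IsMixing.norm_cexp_cov_le [IsProbabilityMeasure P] (hP : IsMixing P past future ψ)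
    {x y : ℝ} (hxy : x ≤ y) {F G : S → ℝ}
    (hF : AEStronglyMeasurable[past x] F P) (hG : AEStronglyMeasurable[future y] G P) :
    ‖∫ ω, Complex.exp (F ω * Complex.I) * Complex.exp (G ω * Complex.I) ∂P -
      (∫ ω, Complex.exp (F ω * Complex.I) ∂P) * ∫ ω, Complex.exp (G ω * Complex.I) ∂P‖ ≤
      16 * ψ (y - x) := by
  have hF' := hF.mono (hP.past_le x)
  have hG' := hG.mono (hP.future_le y)
  have icos : ∀ {H : S → ℝ}, AEStronglyMeasurable H P → Integrable (fun ω => Real.cos (H ω)) P :=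
    fun h => Integrable.of_bound (Real.continuous_cos.comp_aestronglyMeasurable h) 1
      (.of_forall fun ω => Real.abs_cos_le_one _)
  have isin : ∀ {H : S → ℝ}, AEStronglyMeasurable H P → Integrable (fun ω => Real.sin (H ω)) P :=
    fun h => Integrable.of_bound (Real.continuous_sin.comp_aestronglyMeasurable h) 1
      (.of_forall fun ω => Real.abs_sin_le_one _)
  have hexp : ∀ {H : S → ℝ}, AEStronglyMeasurable H P → ∫ ω, Complex.exp (H ω * Complex.I) ∂P =
      (∫ ω, Real.cos (H ω) ∂P : ℝ) + (∫ ω, Real.sin (H ω) ∂P : ℝ) * Complex.I := by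
    intro H h
    rw [← integral_complex_ofReal, ← integral_complex_ofReal, ← integral_mul_const,
      ← integral_add (icos h).ofReal ((isin h).ofReal.mul_const _)]
    congr 1 with ω
    rw [Complex.exp_mul_I, Complex.ofReal_cos, Complex.ofReal_sin]
  have hprod : ∀ (u v : ℝ → ℝ), Continuous u → Continuous v → (∀ z, |u z| ≤ 1) → (∀ z, |v z| ≤ 1) →
      Integrable (fun ω => u (F ω) * v (G ω)) P ∧
      |∫ ω, u (F ω) * v (G ω) ∂P - (∫ ω, u (F ω) ∂P) * ∫ ω, v (G ω) ∂P| ≤ 4 * ψ (y - x) := by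
    intro u v hu hv hu1 hv1
    refine ⟨(Integrable.of_bound (hv.comp_aestronglyMeasurable hG') 1
      (.of_forall fun ω => hv1 _)).bdd_mul (hu.comp_aestronglyMeasurable hF')
      (.of_forall fun ω => hu1 _), ?_⟩
    simpa using hP.abs_cov_le hxy (hu.comp_aestronglyMeasurable hF)
      (hv.comp_aestronglyMeasurable hG) (.of_forall fun ω => hu1 _) (.of_forall fun ω => hv1 _)
  obtain ⟨i1, h1⟩ := hprod _ _ Real.continuous_cos Real.continuous_cos Real.abs_cos_le_one
    Real.abs_cos_le_one
  obtain ⟨i2, h2⟩ := hprod _ _ Real.continuous_cos Real.continuous_sin Real.abs_cos_le_one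
    Real.abs_sin_le_one
  obtain ⟨i3, h3⟩ := hprod _ _ Real.continuous_sin Real.continuous_cos Real.abs_sin_le_one
    Real.abs_cos_le_one
  obtain ⟨i4, h4⟩ := hprod _ _ Real.continuous_sin Real.continuous_sin Real.abs_sin_le_one
    Real.abs_sin_le_one
  have hFG : ∫ ω, Complex.exp (F ω * Complex.I) * Complex.exp (G ω * Complex.I) ∂P =
      ((∫ ω, Real.cos (F ω) * Real.cos (G ω) ∂P - ∫ ω, Real.sin (F ω) * Real.sin (G ω) ∂P : ℝ) : ℂ)
      + ((∫ ω, Real.cos (F ω) * Real.sin (G ω) ∂P + ∫ ω, Real.sin (F ω) * Real.cos (G ω) ∂P : ℝ) : ℂ)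
        * Complex.I := by
    rw [← integral_sub i1 i4, ← integral_add i2 i3, ← integral_complex_ofReal,
      ← integral_complex_ofReal, ← integral_mul_const,
      ← integral_add (i1.sub i4).ofReal ((i2.add i3).ofReal.mul_const _)]
    congr 1 with ω
    simp only [Complex.exp_mul_I]
    push_cast
    linear_combination (-Complex.sin (F ω) * Complex.sin (G ω)) * (- Complex.I_sq)
  rw [hFG, hexp hF', hexp hG']
  set a1 := ∫ ω, Real.cos (F ω) * Real.cos (G ω) ∂P
  set a2 := ∫ ω, Real.cos (F ω) * Real.sin (G ω) ∂P
  set a3 := ∫ ω, Real.sin (F ω) * Real.cos (G ω) ∂P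
  set a4 := ∫ ω, Real.sin (F ω) * Real.sin (G ω) ∂P
  set c1 := ∫ ω, Real.cos (F ω) ∂P
  set c2 := ∫ ω, Real.cos (G ω) ∂P
  set s1 := ∫ ω, Real.sin (F ω) ∂P
  set s2 := ∫ ω, Real.sin (G ω) ∂P
  -- The real and imaginary parts are each a combination of two real covariances, and each
  -- covariance is at most `4 * ψ (y - x)`: hence the `16`.
  have e : (((a1 - a4 : ℝ) : ℂ) + ((a2 + a3 : ℝ) : ℂ) * Complex.I -
      ((c1 : ℂ) + s1 * Complex.I) * ((c2 : ℂ) + s2 * Complex.I)) =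
      (((a1 - c1 * c2) - (a4 - s1 * s2) : ℝ) : ℂ) +
        (((a2 - c1 * s2) + (a3 - s1 * c2) : ℝ) : ℂ) * Complex.I := by
    push_cast
    linear_combination (-(s1 : ℂ) * s2) * Complex.I_sq
  rw [e]
  refine (norm_add_le _ _).trans ?_
  rw [norm_mul, Complex.norm_I, mul_one, Complex.norm_real, Complex.norm_real]
  have := abs_sub (a1 - c1 * c2) (a4 - s1 * s2)
  have := abs_add_le (a2 - c1 * s2) (a3 - s1 * c2)
  simp only [Real.norm_eq_abs]
  linarith

end Mixing

/-! ### Fourth moments of integrals of a mixing field -/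

section MixingField

variable {S : Type*} {m : MeasurableSpace S} {P : Measure S}
  {past future : ℝ → MeasurableSpace S} {ψ : ℝ → ℝ} {K : ℝ} {X : ℝ → S → ℝ}

/-- A centered, jointly measurable random field on `ℝ`, bounded by `K`, whose value at `y` is, up to
null sets, measurable with respect to both the past and the future of `y`. -/
structure IsMixingField (P : Measure S) (past future : ℝ → MeasurableSpace S) (K : ℝ)
    (X : ℝ → S → ℝ) : Prop where
  measurable : Measurable (fun p : ℝ × S => X p.1 p.2)
  bound : ∀ y ω, |X y ω| ≤ K
  past : ∀ y, AEStronglyMeasurable[past y] (X y) P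
  future : ∀ y, AEStronglyMeasurable[future y] (X y) P
  centered : ∀ y, ∫ ω, X y ω ∂P = 0

theorem IsMixingField.measurable_apply (hX : IsMixingField P past future K X) (y : ℝ) :
    Measurable (X y) :=
  hX.measurable.comp measurable_prodMk_left

theorem IsMixingField.nonneg [IsProbabilityMeasure P] (hX : IsMixingField P past future K X) :
    0 ≤ K := by
  obtain ⟨ω⟩ := P.nonempty_of_neZero
  exact (abs_nonneg _).trans (hX.bound 0 ω)

/-- The minimum of two numbers is at most their geometric mean. This is what makes the square root
of the mixing rate the natural integrable quantity. -/
theorem le_mul_sqrt_mul_sqrt {a C u v : ℝ} (hC : 0 ≤ C) (hu : 0 ≤ u) (hv : 0 ≤ v) (h1 : a ≤ C * u)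
    (h2 : a ≤ C * v) : a ≤ C * (√u * √v) := by
  rcases le_total u v with h | h
  · refine h1.trans (mul_le_mul_of_nonneg_left ?_ hC)
    calc u = √u * √u := (Real.mul_self_sqrt hu).symm
      _ ≤ √u * √v := by gcongr
  · refine h2.trans (mul_le_mul_of_nonneg_left ?_ hC)
    calc v = √v * √v := (Real.mul_self_sqrt hv).symm
      _ ≤ √u * √v := by gcongr

/-- Detaching the leftmost point, or the rightmost one, leaves a product of expectations that
vanishes by centering. The two resulting bounds involve the two outer gaps, and the geometric mean
keeps half of each. -/
theorem IsMixing.integral_four_le_of_sorted [IsProbabilityMeasure P]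
    (hP : IsMixing P past future ψ) (hX : IsMixingField P past future K X)
    {y₁ y₂ y₃ y₄ : ℝ} (h12 : y₁ ≤ y₂) (h23 : y₂ ≤ y₃) (h34 : y₃ ≤ y₄) :
    |∫ ω, X y₁ ω * X y₂ ω * X y₃ ω * X y₄ ω ∂P| ≤
      4 * K ^ 4 * (√(ψ |y₁ - y₂|) * √(ψ |y₃ - y₄|)) := by
  have hb := hX.bound
  have hK : 0 ≤ K := hX.nonneg
  have b3 : ∀ x y z ω, |X x ω * X y ω * X z ω| ≤ K ^ 3 := by
    intro x y z ω
    rw [abs_mul, abs_mul, pow_succ, sq]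
    gcongr <;> apply hb
  have f := fun {x y} (h : x ≤ y) => (hX.future y).mono (hP.future_anti h)
  have g := fun {x y} (h : x ≤ y) => (hX.past x).mono (hP.past_mono h)
  have e1 := hP.abs_cov_le h12 (hX.past y₁)
    (((hX.future y₂).mul (f h23)).mul (f (h23.trans h34)))
    (.of_forall fun ω => hb _ ω) (.of_forall fun ω => b3 y₂ y₃ y₄ ω)
  have e2 := hP.abs_cov_le h34 (((g (h12.trans h23)).mul (g h23)).mul (hX.past y₃)) (hX.future y₄)
    (.of_forall fun ω => b3 y₁ y₂ y₃ ω) (.of_forall fun ω => hb _ ω)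
  rw [hX.centered, zero_mul, sub_zero] at e1
  rw [hX.centered, mul_zero, sub_zero] at e2
  rw [abs_sub_comm y₁, abs_sub_comm y₃, abs_of_nonneg (sub_nonneg.2 h12),
    abs_of_nonneg (sub_nonneg.2 h34)]
  simp only [Pi.mul_apply, ← mul_assoc] at e1 e2
  refine le_mul_sqrt_mul_sqrt (by positivity) (hP.rate_nonneg _) (hP.rate_nonneg _)
    (e1.trans_eq (by ring)) (e2.trans_eq (by ring))

/-- The fourth order correlations of a mixing field are bounded by a sum over the pairings. -/
theorem IsMixing.integral_four_le [IsProbabilityMeasure P]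
    (hP : IsMixing P past future ψ) (hX : IsMixingField P past future K X) (y₁ y₂ y₃ y₄ : ℝ) :
    |∫ ω, (X y₁ ω * X y₂ ω) * (X y₃ ω * X y₄ ω) ∂P| ≤
      4 * K ^ 4 * (√(ψ |y₁ - y₂|) * √(ψ |y₃ - y₄|) + √(ψ |y₁ - y₃|) * √(ψ |y₂ - y₄|)
        + √(ψ |y₁ - y₄|) * √(ψ |y₂ - y₃|)) := by
  have hK : 0 ≤ K := hX.nonneg
  set k : ℝ → ℝ → ℝ := fun x y => √(ψ |x - y|) with hk
  have ksymm : ∀ x y, k x y = k y x := fun x y => by simp only [hk, abs_sub_comm]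
  have kpos : ∀ x y x' y', 0 ≤ 4 * K ^ 4 * (k x y * k x' y') := fun x y x' y' => by
    simp only [hk]; positivity
  have key : ∀ a b c d, a ≤ b → b ≤ c → c ≤ d →
      |∫ ω, X a ω * X b ω * X c ω * X d ω ∂P| ≤ 4 * K ^ 4 * (k a b * k c d) :=
    fun a b c d h1 h2 h3 => hP.integral_four_le_of_sorted hX h1 h2 h3
  change _ ≤ 4 * K ^ 4 * (k y₁ y₂ * k y₃ y₄ + k y₁ y₃ * k y₂ y₄ + k y₁ y₄ * k y₂ y₃)
  set I := |∫ ω, (X y₁ ω * X y₂ ω) * (X y₃ ω * X y₄ ω) ∂P| with hI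
  have perm : ∀ a b c d, (∀ ω, X a ω * X b ω * X c ω * X d ω =
      (X y₁ ω * X y₂ ω) * (X y₃ ω * X y₄ ω)) → a ≤ b → b ≤ c → c ≤ d →
      I ≤ 4 * K ^ 4 * (k a b * k c d) := by
    intro a b c d h h1 h2 h3
    have := key a b c d h1 h2 h3
    rwa [integral_congr_ae (.of_forall h)] at this
  have p1 := kpos y₁ y₂ y₃ y₄
  have p2 := kpos y₁ y₃ y₂ y₄
  have p3 := kpos y₁ y₄ y₂ y₃
  have hpair : ∀ (a b c d : ℝ), (k a b * k c d = k y₁ y₂ * k y₃ y₄ ∨ k a b * k c d = k y₁ y₃ * k y₂ y₄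
      ∨ k a b * k c d = k y₁ y₄ * k y₂ y₃) → I ≤ 4 * K ^ 4 * (k a b * k c d) →
      I ≤ 4 * K ^ 4 * (k y₁ y₂ * k y₃ y₄ + k y₁ y₃ * k y₂ y₄ + k y₁ y₄ * k y₂ y₃) := by
    rintro a b c d (h | h | h) h' <;> rw [h] at h' <;> linarith
  have s12 := ksymm y₁ y₂
  have s13 := ksymm y₁ y₃
  have s14 := ksymm y₁ y₄
  have s23 := ksymm y₂ y₃
  have s24 := ksymm y₂ y₄
  have s34 := ksymm y₃ y₄
  have fin : ∀ a b c d, (∀ ω, X a ω * X b ω * X c ω * X d ω =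
      (X y₁ ω * X y₂ ω) * (X y₃ ω * X y₄ ω)) → a ≤ b → b ≤ c → c ≤ d →
      (k a b * k c d = k y₁ y₂ * k y₃ y₄ ∨ k a b * k c d = k y₁ y₃ * k y₂ y₄
      ∨ k a b * k c d = k y₁ y₄ * k y₂ y₃) →
      I ≤ 4 * K ^ 4 * (k y₁ y₂ * k y₃ y₄ + k y₁ y₃ * k y₂ y₄ + k y₁ y₄ * k y₂ y₃) :=
    fun a b c d h h1 h2 h3 h4 => hpair a b c d h4 (perm a b c d h h1 h2 h3)
  clear_value k I
  -- Whatever the order of the four points, pairing the two smallest and the two largest is one of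
  -- the three pairings on the right.
  rcases le_total y₁ y₂ with a | a <;> rcases le_total y₃ y₄ with b | b <;>
  rcases le_total y₁ y₃ with c | c <;> rcases le_total y₂ y₄ with d | d <;>
  rcases le_total y₁ y₄ with e | e <;> rcases le_total y₂ y₃ with f | f <;>
  first
  | exact fin y₁ y₂ y₃ y₄ (fun ω => by ring) ‹_› ‹_› ‹_› (by grind)
  | exact fin y₁ y₂ y₄ y₃ (fun ω => by ring) ‹_› ‹_› ‹_› (by grind)
  | exact fin y₂ y₁ y₃ y₄ (fun ω => by ring) ‹_› ‹_› ‹_› (by grind)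
  | exact fin y₂ y₁ y₄ y₃ (fun ω => by ring) ‹_› ‹_› ‹_› (by grind)
  | exact fin y₃ y₄ y₁ y₂ (fun ω => by ring) ‹_› ‹_› ‹_› (by grind)
  | exact fin y₃ y₄ y₂ y₁ (fun ω => by ring) ‹_› ‹_› ‹_› (by grind)
  | exact fin y₄ y₃ y₁ y₂ (fun ω => by ring) ‹_› ‹_› ‹_› (by grind)
  | exact fin y₄ y₃ y₂ y₁ (fun ω => by ring) ‹_› ‹_› ‹_› (by grind)
  | exact fin y₁ y₃ y₂ y₄ (fun ω => by ring) ‹_› ‹_› ‹_› (by grind)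
  | exact fin y₁ y₃ y₄ y₂ (fun ω => by ring) ‹_› ‹_› ‹_› (by grind)
  | exact fin y₃ y₁ y₂ y₄ (fun ω => by ring) ‹_› ‹_› ‹_› (by grind)
  | exact fin y₃ y₁ y₄ y₂ (fun ω => by ring) ‹_› ‹_› ‹_› (by grind)
  | exact fin y₂ y₄ y₁ y₃ (fun ω => by ring) ‹_› ‹_› ‹_› (by grind)
  | exact fin y₂ y₄ y₃ y₁ (fun ω => by ring) ‹_› ‹_› ‹_› (by grind)
  | exact fin y₄ y₂ y₁ y₃ (fun ω => by ring) ‹_› ‹_› ‹_› (by grind)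
  | exact fin y₄ y₂ y₃ y₁ (fun ω => by ring) ‹_› ‹_› ‹_› (by grind)
  | exact fin y₁ y₄ y₂ y₃ (fun ω => by ring) ‹_› ‹_› ‹_› (by grind)
  | exact fin y₁ y₄ y₃ y₂ (fun ω => by ring) ‹_› ‹_› ‹_› (by grind)
  | exact fin y₄ y₁ y₂ y₃ (fun ω => by ring) ‹_› ‹_› ‹_› (by grind)
  | exact fin y₄ y₁ y₃ y₂ (fun ω => by ring) ‹_› ‹_› ‹_› (by grind)
  | exact fin y₂ y₃ y₁ y₄ (fun ω => by ring) ‹_› ‹_› ‹_› (by grind)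
  | exact fin y₂ y₃ y₄ y₁ (fun ω => by ring) ‹_› ‹_› ‹_› (by grind)
  | exact fin y₃ y₂ y₁ y₄ (fun ω => by ring) ‹_› ‹_› ‹_› (by grind)
  | exact fin y₃ y₂ y₄ y₁ (fun ω => by ring) ‹_› ‹_› ‹_› (by grind)

theorem integral_comp_abs_integrable {f : ℝ → ℝ} (hf : IntegrableOn f (Ioi 0)) :
    Integrable (fun x => f |x|) := by
  have h1 : IntegrableOn (fun x => f |x|) (Ioi 0) :=
    hf.congr_fun (fun x hx => by rw [abs_of_pos hx]) measurableSet_Ioi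
  rw [← integrableOn_univ, ← Iic_union_Ioi (a := (0 : ℝ)), integrableOn_union]
  refine ⟨?_, h1⟩
  rw [← Measure.map_neg_eq_self (volume : Measure ℝ)]
  let e : MeasurableEmbedding fun x : ℝ => -x := (Homeomorph.neg ℝ).measurableEmbedding
  rw [e.integrableOn_map_iff]
  simp_rw [Function.comp_def, abs_neg, neg_preimage, neg_Iic, neg_zero]
  exact Iff.mpr integrableOn_Ici_iff_integrableOn_Ioi h1

/-- The fourth moment of the integral of a mixing field over an interval. -/
theorem IsMixing.integral_pow_four_le [IsProbabilityMeasure P]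
    (hP : IsMixing P past future ψ) (hX : IsMixingField P past future K X) {p q : ℝ} (hpq : p ≤ q) :
    ∫ ω, (∫ y in p..q, X y ω) ^ 4 ∂P ≤
      48 * K ^ 4 * (∫ h in Ioi 0, √(ψ h)) ^ 2 * (q - p) ^ 2 := by
  have hK : 0 ≤ K := hX.nonneg
  set M := ∫ h in Ioi 0, √(ψ h) with hM
  simp_rw [intervalIntegral.integral_of_le hpq]
  set ν : Measure ℝ := volume.restrict (Ioc p q) with hν
  have hνfin : IsFiniteMeasure ν := ⟨by simp [hν]⟩
  set k : ℝ → ℝ → ℝ := fun x y => √(ψ |x - y|) with hk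
  have kmeas : Measurable (fun z : ℝ × ℝ => k z.1 z.2) := by
    have := hP.rate_anti.measurable
    fun_prop
  have kbd : ∀ x y, |k x y| ≤ √(ψ 0) := by
    intro x y
    rw [abs_of_nonneg (Real.sqrt_nonneg _)]
    exact Real.sqrt_le_sqrt (hP.rate_anti (abs_nonneg _))
  have kint : Integrable (fun z : ℝ × ℝ => k z.1 z.2) (ν.prod ν) :=
    Integrable.of_bound kmeas.aestronglyMeasurable _ (.of_forall fun z => kbd z.1 z.2)
  have kint1 : ∀ x, Integrable (k x) ν := fun x =>
    Integrable.of_bound (kmeas.comp measurable_prodMk_left).aestronglyMeasurable _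
      (.of_forall fun z => kbd x z)
  set g : ℝ → ℝ := fun x => ∫ y, k x y ∂ν with hg
  have gint : Integrable g ν := kint.integral_prod_left
  -- Extending the inner integral to the whole line costs nothing since the kernel is nonnegative;
  -- the two half-lines give the `2`.
  have hgle : ∀ x, g x ≤ 2 * M := by
    intro x
    have h1 : Integrable (k x) := by
      have := (integral_comp_abs_integrable hP.rate_integrable).comp_sub_left x
      simpa [hk] using this
    calc g x ≤ ∫ y, k x y := setIntegral_le_integral h1 (.of_forall fun y => Real.sqrt_nonneg _)
      _ = ∫ y, √(ψ |y|) := integral_sub_left_eq_self (fun y => √(ψ |y|)) volume x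
      _ = 2 * M := integral_comp_abs (f := fun y => √(ψ y))
  set G := ∫ x, g x ∂ν with hG
  have hG0 : 0 ≤ G := integral_nonneg fun x => integral_nonneg fun y => Real.sqrt_nonneg _
  have hGle : G ≤ 2 * M * (q - p) := by
    calc G ≤ ∫ x, 2 * M ∂ν := integral_mono gint (integrable_const _) hgle
      _ = 2 * M * (q - p) := by simp [hν, hpq, mul_comm]
  have hGk : ∫ z, k z.1 z.2 ∂(ν.prod ν) = G := integral_prod _ kint
  set Y : ((ℝ × ℝ) × (ℝ × ℝ)) → S → ℝ :=
    fun z ω => (X z.1.1 ω * X z.1.2 ω) * (X z.2.1 ω * X z.2.2 ω) with hY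
  have Ymeas : Measurable (fun z : ((ℝ × ℝ) × (ℝ × ℝ)) × S => Y z.1 z.2) := by
    have hm := hX.measurable
    have h (f : ((ℝ × ℝ) × (ℝ × ℝ)) → ℝ) (hf : Measurable f) :
        Measurable fun z : ((ℝ × ℝ) × (ℝ × ℝ)) × S => X (f z.1) z.2 :=
      hm.comp ((hf.comp measurable_fst).prodMk measurable_snd)
    exact ((h (fun z => z.1.1) (by fun_prop)).mul (h (fun z => z.1.2) (by fun_prop))).mul
      ((h (fun z => z.2.1) (by fun_prop)).mul (h (fun z => z.2.2) (by fun_prop)))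
  have Ybd : ∀ z ω, |Y z ω| ≤ (K * K) * (K * K) := by
    intro z ω
    simp only [hY, abs_mul]
    gcongr <;> apply hX.bound
  have hpow : ∀ ω, (∫ y, X y ω ∂ν) ^ 4 = ∫ z, Y z ω ∂((ν.prod ν).prod (ν.prod ν)) := by
    intro ω
    rw [hY, integral_prod_mul (fun z : ℝ × ℝ => X z.1 ω * X z.2 ω)
      (fun z : ℝ × ℝ => X z.1 ω * X z.2 ω), integral_prod_mul (fun y => X y ω) (fun y => X y ω)]
    ring
  have Yint : Integrable (fun z : S × ((ℝ × ℝ) × (ℝ × ℝ)) => Y z.2 z.1)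
      (P.prod ((ν.prod ν).prod (ν.prod ν))) :=
    Integrable.of_bound (Ymeas.comp measurable_swap).aestronglyMeasurable _
      (.of_forall fun z => Ybd z.2 z.1)
  simp_rw [hpow]
  rw [integral_integral_swap Yint]
  have i1 : Integrable (fun z : (ℝ × ℝ) × (ℝ × ℝ) => k z.1.1 z.1.2 * k z.2.1 z.2.2)
    ((ν.prod ν).prod (ν.prod ν)) := kint.mul_prod kint
  have ib : ∀ f g : (ℝ × ℝ) × (ℝ × ℝ) → ℝ × ℝ, Measurable f → Measurable g →
      Integrable (fun z => k (f z).1 (f z).2 * k (g z).1 (g z).2)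
        ((ν.prod ν).prod (ν.prod ν)) := by
    intro f g hf hg
    refine Integrable.of_bound ((kmeas.comp hf).mul (kmeas.comp hg)).aestronglyMeasurable
      (√(ψ 0) * √(ψ 0)) (.of_forall fun z => ?_)
    rw [norm_mul]
    exact mul_le_mul (kbd _ _) (kbd _ _) (norm_nonneg _) (Real.sqrt_nonneg _)
  have i2 : Integrable (fun z : (ℝ × ℝ) × (ℝ × ℝ) => k z.1.1 z.2.1 * k z.1.2 z.2.2)
      ((ν.prod ν).prod (ν.prod ν)) := ib (fun z => (z.1.1, z.2.1)) (fun z => (z.1.2, z.2.2)) (by fun_prop) (by fun_prop)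
  have i3 : Integrable (fun z : (ℝ × ℝ) × (ℝ × ℝ) => k z.1.1 z.2.2 * k z.1.2 z.2.1)
      ((ν.prod ν).prod (ν.prod ν)) := ib (fun z => (z.1.1, z.2.2)) (fun z => (z.1.2, z.2.1)) (by fun_prop) (by fun_prop)
  have Yint' := Yint.swap.integral_prod_left
  calc ∫ z, ∫ ω, Y z ω ∂P ∂((ν.prod ν).prod (ν.prod ν))
      ≤ ∫ z : (ℝ × ℝ) × (ℝ × ℝ), 4 * K ^ 4 * (k z.1.1 z.1.2 * k z.2.1 z.2.2 +
          k z.1.1 z.2.1 * k z.1.2 z.2.2 + k z.1.1 z.2.2 * k z.1.2 z.2.1)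
          ∂((ν.prod ν).prod (ν.prod ν)) :=
        integral_mono Yint' (((i1.add i2).add i3).const_mul _) fun z =>
          (le_abs_self _).trans (hP.integral_four_le hX _ _ _ _)
    -- Each pairing factors into two copies of the same double integral.
    _ = 4 * K ^ 4 * (G * G + G * G + G * G) := by
        rw [integral_const_mul, integral_add (by exact i1.add i2) i3, integral_add i1 i2,
          integral_prod_mul (fun z : ℝ × ℝ => k z.1 z.2) (fun z : ℝ × ℝ => k z.1 z.2), hGk,
          integral_prod _ i2, integral_prod _ i3]
        have e2 : ∀ z : ℝ × ℝ, ∫ w : ℝ × ℝ, k z.1 w.1 * k z.2 w.2 ∂(ν.prod ν) = g z.1 * g z.2 :=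
          fun z => integral_prod_mul _ _
        have e3 : ∀ z : ℝ × ℝ, ∫ w : ℝ × ℝ, k z.1 w.2 * k z.2 w.1 ∂(ν.prod ν) = g z.1 * g z.2 := by
          intro z
          simp_rw [mul_comm (k z.1 _)]
          rw [integral_prod_mul (k z.2) (k z.1), mul_comm]
        simp_rw [e2, e3]
        rw [integral_prod_mul g g]
    _ = 12 * K ^ 4 * G ^ 2 := by ring
    _ ≤ 12 * K ^ 4 * (2 * M * (q - p)) ^ 2 := by gcongr
    _ = _ := by ring

/-- The integral of a field over an interval is measurable with respect to the (completed)
σ-algebra that its values generate. -/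
theorem aestronglyMeasurable_intervalIntegral_of_le {S : Type*} {m₁ m : MeasurableSpace S}
    {P : Measure S} [IsProbabilityMeasure P] {X : ℝ → S → ℝ} {K : ℝ} (hm : m₁ ≤ m) (hX : Measurable (fun p : ℝ × S => X p.1 p.2))
    (hK : ∀ y ω, |X y ω| ≤ K) {p q : ℝ} (hpq : p ≤ q)
    (hX₁ : ∀ y ∈ Ioc p q, AEStronglyMeasurable[m₁] (X y) P) :
    AEStronglyMeasurable[m₁] (fun ω => ∫ y in p..q, X y ω) P := by
  simp_rw [intervalIntegral.integral_of_le hpq]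
  set ν : Measure ℝ := volume.restrict (Ioc p q) with hν
  have hνfin : IsFiniteMeasure ν := ⟨by simp [hν]⟩
  set I : S → ℝ := fun ω => ∫ y, X y ω ∂ν with hI
  have Im : Measurable[m] I := by
    have : StronglyMeasurable (fun p : S × ℝ => X p.2 p.1) :=
      (hX.comp measurable_swap).stronglyMeasurable
    exact this.integral_prod_right.measurable
  have Ib : ∀ ω, |I ω| ≤ K * (ν.real univ) := fun ω =>
    norm_integral_le_of_norm_le_const (f := fun y => X y ω) (.of_forall fun y => hK y ω)
  have Ii : Integrable I P := Integrable.of_bound Im.aestronglyMeasurable _ (.of_forall Ib)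
  set J := P[I|m₁] with hJ
  have Jm : AEStronglyMeasurable[m₁] J P := stronglyMeasurable_condExp.aestronglyMeasurable
  have Jb : ∀ᵐ ω ∂P, |J ω| ≤ K * ν.real univ := by
    exact ae_bdd_abs_condExp_of_ae_bdd_abs (.of_forall Ib)
  have Ji : Integrable J P := integrable_condExp
  -- The null set on which `X y` departs from a measurable version depends on `y`, so integrating
  -- versions directly is not available. Instead, `I - J` is shown orthogonal to `J` and, by Fubini,
  -- to `I`; hence it vanishes almost surely.
  have h1 : ∫ ω, J ω * (I ω - J ω) ∂P = 0 := by
    have := integral_mul_condExp_of_bound hm Jm Jb Ii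
    simp_rw [mul_sub]
    rw [integral_sub (Ii.bdd_mul Ji.1 Jb) (Ji.bdd_mul Ji.1 Jb), this, sub_self]
  have h2 : ∫ ω, I ω * (I ω - J ω) ∂P = 0 := by
    have e : ∀ ω, I ω * (I ω - J ω) = ∫ y, X y ω * (I ω - J ω) ∂ν := fun ω =>
      (integral_mul_const _ _).symm
    simp_rw [e]
    rw [integral_integral_swap]
    · refine integral_eq_zero_of_ae ?_
      refine (ae_restrict_iff' measurableSet_Ioc).2 (.of_forall fun y hy => ?_)
      have := integral_mul_condExp_of_bound hm (hX₁ y hy) (.of_forall fun ω => hK y ω) Ii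
      have hXy : AEStronglyMeasurable[m] (X y) P := (hX₁ y hy).mono hm
      simp_rw [mul_sub]
      rw [integral_sub (Ii.bdd_mul hXy (.of_forall fun ω => hK y ω))
        (Ji.bdd_mul hXy (.of_forall fun ω => hK y ω)), this, sub_self]
      rfl
    · have hd : Integrable (fun z : S × ℝ => I z.1 - J z.1) (P.prod ν) := (Ii.sub Ji).comp_fst ν
      exact hd.bdd_mul (hX.comp measurable_swap).aestronglyMeasurable
        (.of_forall fun z => hK z.2 z.1)
  have a1 : Integrable (fun ω => I ω * (I ω - J ω)) P :=
    (Ii.sub Ji).bdd_mul Ii.1 (.of_forall Ib)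
  have a2 : Integrable (fun ω => J ω * (I ω - J ω)) P := (Ii.sub Ji).bdd_mul Ji.1 Jb
  have e : ∀ ω, (I ω - J ω) ^ 2 = I ω * (I ω - J ω) - J ω * (I ω - J ω) := fun ω => by ring
  have hsq : ∫ ω, (I ω - J ω) ^ 2 ∂P = 0 := by
    simp_rw [e]
    rw [integral_sub a1 a2, h1, h2, sub_zero]
  have hz : (fun ω => (I ω - J ω) ^ 2) =ᵐ[P] 0 := by
    refine (integral_eq_zero_iff_of_nonneg (fun ω => sq_nonneg _) ?_).1 hsq
    simp_rw [e]
    exact a1.sub a2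
  refine Jm.congr ?_
  filter_upwards [hz] with ω hω
  have : I ω - J ω = 0 := by simpa using hω
  linarith

end MixingField

/-! ### A central limit theorem by blocks and characteristic functions -/

section AbstractCLT

-- For small `x` this is the Taylor remainder; for `|x| > 1` every term is absorbed into `|x| ^ 3`,
-- and that crude case fixes the constant `4`.
open Complex in
theorem norm_cexp_sub_quadratic_le (x : ℝ) :
    ‖cexp (x * I) - (1 + x * I - x ^ 2 / 2)‖ ≤ 4 * |x| ^ 3 := by
  rcases le_or_gt |x| 1 with h | h
  · have hx : ‖(x * I : ℂ)‖ = |x| := by simp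
    have := Complex.exp_bound (x := x * I) (by rw [hx]; exact h) (n := 3) (by norm_num)
    rw [hx] at this
    have e : (∑ k ∈ Finset.range 3, (x * I : ℂ) ^ k / (k.factorial : ℂ)) = 1 + x * I - x ^ 2 / 2 := by
      simp only [Finset.sum_range_succ, Finset.sum_range_zero, mul_pow, I_sq]
      norm_num [Nat.factorial]
      ring
    rw [e] at this
    refine this.trans ?_
    norm_num [Nat.factorial]
    nlinarith [pow_nonneg (abs_nonneg x) 3]
  · have h1 : ‖cexp (x * I)‖ = 1 := Complex.norm_exp_ofReal_mul_I x
    have h2 : ‖(1 + x * I - x ^ 2 / 2 : ℂ)‖ ≤ 1 + |x| + |x| ^ 2 / 2 := by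
      refine (norm_sub_le _ _).trans (add_le_add ((norm_add_le _ _).trans ?_) ?_) <;> simp
    refine (norm_sub_le _ _).trans ?_
    rw [h1]
    have a2 : |x| ≤ |x| ^ 2 := by nlinarith
    have a3 : |x| ^ 2 ≤ |x| ^ 3 := by nlinarith
    linarith

theorem norm_cexp_mul_I_sub_one_le (x : ℝ) : ‖Complex.exp (x * Complex.I) - 1‖ ≤ |x| := by
  rw [mul_comm]
  exact Real.norm_exp_I_mul_ofReal_sub_one_le

variable {S : Type*} {m : MeasurableSpace S} {P : Measure S}

/-- An interpolation of moments in the style of Cauchy–Schwarz: the pointwise inequality is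
arithmetic-geometric with a free scale `r`, chosen so that the two terms on the right balance. It
serves for the first, second and third absolute moments. -/
theorem integral_le_half_add {f g h : S → ℝ} (hf : Integrable f P) (hg : Integrable g P)
    (hh : Integrable h P) {r : ℝ} (hr : 0 < r) (hfgh : ∀ ω, 2 * f ω * r ≤ g ω * r ^ 2 + h ω)
    {G H : ℝ} (hG : ∫ ω, g ω ∂P ≤ G) (hH : ∫ ω, h ω ∂P ≤ H) (hGH : H ≤ G * r ^ 2) :
    ∫ ω, f ω ∂P ≤ G * r := by
  have h1 : ∫ ω, 2 * f ω * r ∂P ≤ ∫ ω, g ω * r ^ 2 + h ω ∂P :=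
    integral_mono ((hf.const_mul 2).mul_const r) ((hg.mul_const _).add hh) hfgh
  rw [integral_mul_const, integral_const_mul, integral_add (hg.mul_const _) hh,
    integral_mul_const] at h1
  have h2 : (∫ ω, g ω ∂P) * r ^ 2 ≤ G * r ^ 2 := by gcongr
  have h3 : (∫ ω, f ω ∂P) * (2 * r) ≤ G * r * (2 * r) := by nlinarith
  exact le_of_mul_le_mul_right h3 (by positivity)

variable [IsProbabilityMeasure P]

theorem integral_sq_le_of_integral_pow_four {D : S → ℝ} (hD : Measurable D)
    {B : ℝ} (hB : ∀ ω, |D ω| ≤ B) {s : ℝ} (hs : 0 < s) (h4 : ∫ ω, D ω ^ 4 ∂P ≤ s ^ 2) :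
    ∫ ω, D ω ^ 2 ∂P ≤ s := by
  have hint : ∀ n : ℕ, Integrable (fun ω => D ω ^ n) P := fun n =>
    Integrable.of_bound (hD.pow_const n).aestronglyMeasurable (B ^ n) (.of_forall fun ω => by
      rw [norm_pow]; exact pow_le_pow_left₀ (norm_nonneg _) (hB ω) n)
  have := integral_le_half_add (P := P) (hint 2) (integrable_const 1) (hint 4) hs
    (fun ω => by nlinarith [sq_nonneg (D ω ^ 2 - s)]) (G := 1) (by simp) h4 (by simp)
  simpa using this

theorem integral_abs_le_of_integral_sq {D : S → ℝ} (hD : Measurable D)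
    {B : ℝ} (hB : ∀ ω, |D ω| ≤ B) {s : ℝ} (hs : 0 < s) (h2 : ∫ ω, D ω ^ 2 ∂P ≤ s) :
    ∫ ω, |D ω| ∂P ≤ √s := by
  have hi : Integrable (fun ω => |D ω|) P :=
    Integrable.of_bound hD.abs.aestronglyMeasurable B (.of_forall fun ω => by simpa using hB ω)
  have hi2 : Integrable (fun ω => D ω ^ 2) P :=
    Integrable.of_bound (hD.pow_const 2).aestronglyMeasurable (B ^ 2) (.of_forall fun ω => by
      rw [norm_pow]; exact pow_le_pow_left₀ (norm_nonneg _) (hB ω) 2)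
  have := integral_le_half_add (P := P) hi (integrable_const 1) hi2 (Real.sqrt_pos.2 hs)
    (fun ω => by nlinarith [sq_nonneg (|D ω| - √s), sq_abs (D ω)]) (G := 1) (by simp) h2
    (by rw [Real.sq_sqrt hs.le, one_mul])
  simpa using this

theorem integral_abs_pow_three_le {D : S → ℝ} (hD : Measurable D)
    {B : ℝ} (hB : ∀ ω, |D ω| ≤ B) {s : ℝ} (hs : 0 < s) (h2 : ∫ ω, D ω ^ 2 ∂P ≤ s)
    (h4 : ∫ ω, D ω ^ 4 ∂P ≤ s ^ 2) : ∫ ω, |D ω| ^ 3 ∂P ≤ s * √s := by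
  have hint : ∀ n : ℕ, Integrable (fun ω => D ω ^ n) P := fun n =>
    Integrable.of_bound (hD.pow_const n).aestronglyMeasurable (B ^ n) (.of_forall fun ω => by
      rw [norm_pow]; exact pow_le_pow_left₀ (norm_nonneg _) (hB ω) n)
  have hi : Integrable (fun ω => |D ω| ^ 3) P := by simpa [abs_pow] using (hint 3).abs
  refine integral_le_half_add (P := P) hi (hint 2) (hint 4) (Real.sqrt_pos.2 hs)
    (fun ω => ?_) h2 h4 (by rw [Real.sq_sqrt hs.le, sq])
  rw [← sq_abs (D ω), show D ω ^ 4 = |D ω| ^ 4 by rw [← abs_pow, abs_of_nonneg (by positivity)]]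
  nlinarith [sq_nonneg (|D ω| ^ 2 - |D ω| * √s), abs_nonneg (D ω)]

theorem integrable_cexp_mul_I {D : S → ℝ} (hD : Measurable D) :
    Integrable (fun ω => Complex.exp (D ω * Complex.I)) P :=
  Integrable.of_bound (by fun_prop) 1 (.of_forall fun ω => by simp [Complex.norm_exp_ofReal_mul_I])

theorem norm_integral_cexp_le_one (D : S → ℝ) :
    ‖∫ ω, Complex.exp (D ω * Complex.I) ∂P‖ ≤ 1 := by
  refine (norm_integral_le_of_norm_le_const (C := 1) (.of_forall fun ω => ?_)).trans (by simp)
  simp [Complex.norm_exp_ofReal_mul_I]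

/-- Changing the random variable by an amount of small second moment. -/
theorem norm_integral_cexp_sub_le {D E F : S → ℝ} (hD : Measurable D) (hE : Measurable E)
    (hF : Measurable F) (hDEF : ∀ ω, F ω = D ω + E ω) {B : ℝ} (hB : ∀ ω, |E ω| ≤ B) {s : ℝ}
    (hs : 0 < s) (h2 : ∫ ω, E ω ^ 2 ∂P ≤ s) :
    ‖∫ ω, Complex.exp (F ω * Complex.I) ∂P - ∫ ω, Complex.exp (D ω * Complex.I) ∂P‖ ≤ √s := by
  rw [← integral_sub (integrable_cexp_mul_I hF) (integrable_cexp_mul_I hD)]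
  refine le_trans ?_ (integral_abs_le_of_integral_sq hE hB hs h2)
  refine norm_integral_le_of_norm_le (Integrable.of_bound hE.abs.aestronglyMeasurable B
    (.of_forall fun ω => by simpa using hB ω)) (.of_forall fun ω => ?_)
  have e : Complex.exp (F ω * Complex.I) - Complex.exp (D ω * Complex.I) =
      Complex.exp (D ω * Complex.I) * (Complex.exp (E ω * Complex.I) - 1) := by
    rw [hDEF, mul_sub, ← Complex.exp_add]
    push_cast
    ring_nf
  rw [e, norm_mul, Complex.norm_exp_ofReal_mul_I, one_mul]
  exact norm_cexp_mul_I_sub_one_le _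

/-- Second order expansion of the characteristic function. -/
theorem norm_integral_cexp_sub_quadratic_le {D : S → ℝ} (hD : Measurable D)
    {B : ℝ} (hB : ∀ ω, |D ω| ≤ B) (h0 : ∫ ω, D ω ∂P = 0) {s : ℝ} (hs : 0 < s)
    (h4 : ∫ ω, D ω ^ 4 ∂P ≤ s ^ 2) :
    ‖∫ ω, Complex.exp (D ω * Complex.I) ∂P - ((1 - (∫ ω, D ω ^ 2 ∂P) / 2 : ℝ) : ℂ)‖ ≤
      4 * (s * √s) := by
  have hint : ∀ n : ℕ, Integrable (fun ω => D ω ^ n) P := fun n =>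
    Integrable.of_bound (hD.pow_const n).aestronglyMeasurable (B ^ n) (.of_forall fun ω => by
      rw [norm_pow]; exact pow_le_pow_left₀ (norm_nonneg _) (hB ω) n)
  have hi1 : Integrable D P := by simpa using hint 1
  have hi3 : Integrable (fun ω => |D ω| ^ 3) P := by simpa [abs_pow] using (hint 3).abs
  have hq : Integrable (fun ω => (1 + D ω * Complex.I - (D ω : ℂ) ^ 2 / 2 : ℂ)) P := by
    refine ((integrable_const _).add (hi1.ofReal.mul_const _)).sub (Integrable.div_const ?_ 2)
    simpa using (hint 2).ofReal (𝕜 := ℂ)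
  have e : ((1 - (∫ ω, D ω ^ 2 ∂P) / 2 : ℝ) : ℂ) =
      ∫ ω, (1 + D ω * Complex.I - (D ω : ℂ) ^ 2 / 2 : ℂ) ∂P := by
    have h2i : Integrable (fun ω => (D ω : ℂ) ^ 2 / 2) P := by
      simpa using ((hint 2).ofReal (𝕜 := ℂ)).div_const 2
    rw [integral_sub (by exact (integrable_const _).add (hi1.ofReal.mul_const _)) h2i,
      integral_add (integrable_const _) (hi1.ofReal.mul_const _), integral_mul_const,
      integral_complex_ofReal, h0, integral_div]
    have : ∫ ω, (D ω : ℂ) ^ 2 ∂P = ((∫ ω, D ω ^ 2 ∂P : ℝ) : ℂ) := by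
      rw [← integral_complex_ofReal]; simp
    rw [this]
    simp
  rw [e, ← integral_sub (integrable_cexp_mul_I hD) hq]
  calc _ ≤ ∫ ω, 4 * |D ω| ^ 3 ∂P :=
        norm_integral_le_of_norm_le (hi3.const_mul 4)
          (.of_forall fun ω => norm_cexp_sub_quadratic_le _)
    _ ≤ 4 * (s * √s) := by
        rw [integral_const_mul]
        gcongr
        exact integral_abs_pow_three_le hD hB hs (integral_sq_le_of_integral_pow_four hD hB hs h4) h4

theorem abs_exp_neg_half_sub_le {u : ℝ} (h0 : 0 ≤ u) (h1 : u ≤ 2) :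
    |(1 - u / 2) - Real.exp (-u / 2)| ≤ u ^ 2 := by
  have := Real.norm_exp_sub_one_sub_id_le (x := -u / 2) (by
    rw [Real.norm_eq_abs, abs_le]; constructor <;> linarith)
  rw [abs_sub_comm, show Real.exp (-u / 2) - (1 - u / 2) = Real.exp (-u / 2) - 1 - -u / 2 by ring]
  refine this.trans ?_
  rw [Real.norm_eq_abs, sq_abs]
  nlinarith

/-- A central limit theorem for additive random functions of intervals, which are asymptotically
independent over separated intervals, and whose fourth moments are suitably bounded. -/
theorem tendsto_integral_cexp_of_additive {ι : Type*} {l : Filter ι} {D : ι → ℝ → ℝ → S → ℝ}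
    {v : ℝ → ℝ} {c a b : ℝ} (hab : a ≤ b) (hc : 0 < c)
    (hmeas : ∀ i p q, Measurable (D i p q))
    (hbdd : ∀ i p q, ∃ B, ∀ ω, |D i p q ω| ≤ B)
    (hadd : ∀ i p q r, p ≤ q → q ≤ r → ∀ ω, D i p r ω = D i p q ω + D i q r ω)
    (hcent : ∀ i p q, p ≤ q → ∫ ω, D i p q ω ∂P = 0)
    (h4 : ∀ i p q, p ≤ q → ∫ ω, D i p q ω ^ 4 ∂P ≤ (c * (q - p)) ^ 2)
    (hvar : ∀ p q, p ≤ q → Tendsto (fun i => ∫ ω, D i p q ω ^ 2 ∂P) l (𝓝 (v q - v p)))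
    (hdec : ∀ p q q' r, p ≤ q → q < q' → q' ≤ r → Tendsto (fun i =>
      ∫ ω, Complex.exp (D i p q ω * Complex.I) * Complex.exp (D i q' r ω * Complex.I) ∂P -
      (∫ ω, Complex.exp (D i p q ω * Complex.I) ∂P) *
        ∫ ω, Complex.exp (D i q' r ω * Complex.I) ∂P) l (𝓝 0)) :
    Tendsto (fun i => ∫ ω, Complex.exp (D i a b ω * Complex.I) ∂P) l
      (𝓝 (Real.exp (-(v b - v a) / 2))) := by
  rcases l.eq_or_neBot with rfl | hl
  · simp
  set φ : ι → ℝ → ℝ → ℂ := fun i p q => ∫ ω, Complex.exp (D i p q ω * Complex.I) ∂P with hφ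
  have h2 : ∀ i p q, p < q → ∫ ω, D i p q ω ^ 2 ∂P ≤ c * (q - p) := fun i p q h => by
    obtain ⟨B, hB⟩ := hbdd i p q
    exact integral_sq_le_of_integral_pow_four (hmeas i p q) hB (mul_pos hc (sub_pos.2 h))
      (h4 i p q h.le)
  have hsplit : ∀ i p q r, p < q → q ≤ r → ‖φ i p r - φ i q r‖ ≤ √(c * (q - p)) := by
    intro i p q r hpq hqr
    obtain ⟨B, hB⟩ := hbdd i p q
    exact norm_integral_cexp_sub_le (hmeas i q r) (hmeas i p q) (hmeas i p r)
      (fun ω => by rw [hadd i p q r hpq.le hqr, add_comm]) hB (mul_pos hc (sub_pos.2 hpq))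
      (h2 i p q hpq)
  have hv : ∀ p q, p < q → 0 ≤ v q - v p ∧ v q - v p ≤ c * (q - p) := fun p q h =>
    ⟨ge_of_tendsto' (hvar p q h.le) fun i => integral_nonneg fun ω => sq_nonneg _,
      le_of_tendsto' (hvar p q h.le) fun i => h2 i p q h⟩
  -- Adjacent intervals need not decorrelate, so a gap `[q, q + δ]` is dropped. It changes each
  -- characteristic function by at most `√(c * δ)`, uniformly in `i`, and the remaining intervals
  -- are separated.
  have hindep : ∀ p q r, p ≤ q → q < r → ∀ η > 0, ∀ᶠ i in l, ‖φ i p r - φ i p q * φ i q r‖ ≤ η := by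
    intro p q r hpq hqr η hη
    obtain ⟨δ, hδ0, hδr, hδη⟩ : ∃ δ, 0 < δ ∧ q + δ < r ∧ √(c * δ) ≤ η / 3 := by
      have ht : Tendsto (fun δ : ℝ => √(c * δ)) (𝓝[>] 0) (𝓝 0) := by
        have : Continuous fun δ : ℝ => √(c * δ) := by fun_prop
        simpa using this.continuousWithinAt (s := Ioi 0) (x := 0) |>.tendsto
      have e1 : ∀ᶠ δ in 𝓝[>] (0 : ℝ), √(c * δ) ≤ η / 3 :=
        (ht.eventually (gt_mem_nhds (by positivity : (0 : ℝ) < η / 3))).mono fun _ h => h.le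
      have e2 : ∀ᶠ δ in 𝓝[>] (0 : ℝ), δ < r - q :=
        (gt_mem_nhds (sub_pos.2 hqr)).filter_mono nhdsWithin_le_nhds
      obtain ⟨δ, h1, h2, h3⟩ := (e1.and (e2.and self_mem_nhdsWithin)).exists
      exact ⟨δ, h3, by linarith, h1⟩
    have hd := hdec p q (q + δ) r hpq (by linarith) hδr.le
    filter_upwards [(tendsto_zero_iff_norm_tendsto_zero.1 hd).eventually
      (gt_mem_nhds (by positivity : (0 : ℝ) < η / 3))] with i hi
    obtain ⟨B, hB⟩ := hbdd i q (q + δ)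
    have t1 : ‖φ i p r - ∫ ω, Complex.exp ((D i p q ω + D i (q + δ) r ω : ℝ) * Complex.I) ∂P‖
        ≤ η / 3 := by
      refine le_trans ?_ hδη
      refine norm_integral_cexp_sub_le ((hmeas i p q).add (hmeas i (q + δ) r)) (hmeas i q (q + δ))
        (hmeas i p r) (fun ω => ?_) hB (mul_pos hc hδ0) ?_
      · rw [hadd i p q r hpq hqr.le, hadd i q (q + δ) r (by linarith) hδr.le]
        simp only [Pi.add_apply]
        ring
      · simpa using h2 i q (q + δ) (by linarith)
    have t2 : ‖φ i p q * (φ i q r - φ i (q + δ) r)‖ ≤ η / 3 := by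
      rw [norm_mul]
      have := hsplit i q (q + δ) r (by linarith) hδr.le
      rw [add_sub_cancel_left] at this
      calc _ ≤ 1 * (η / 3) := mul_le_mul (norm_integral_cexp_le_one _) (this.trans hδη)
            (norm_nonneg _) zero_le_one
        _ = _ := one_mul _
    have e : ∫ ω, Complex.exp ((D i p q ω + D i (q + δ) r ω : ℝ) * Complex.I) ∂P =
        ∫ ω, Complex.exp (D i p q ω * Complex.I) * Complex.exp (D i (q + δ) r ω * Complex.I) ∂P := by
      congr 1 with ω
      rw [← Complex.exp_add]
      push_cast
      ring_nf
    rw [e] at t1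
    have e2 : φ i p r - φ i p q * φ i q r =
        (φ i p r - ∫ ω, Complex.exp (D i p q ω * Complex.I) *
          Complex.exp (D i (q + δ) r ω * Complex.I) ∂P) +
        (∫ ω, Complex.exp (D i p q ω * Complex.I) *
          Complex.exp (D i (q + δ) r ω * Complex.I) ∂P - φ i p q * φ i (q + δ) r) -
        φ i p q * (φ i q r - φ i (q + δ) r) := by ring
    rw [e2]
    refine (norm_sub_le _ _).trans ?_
    have := norm_add_le (φ i p r - ∫ ω, Complex.exp (D i p q ω * Complex.I) *
          Complex.exp (D i (q + δ) r ω * Complex.I) ∂P)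
        (∫ ω, Complex.exp (D i p q ω * Complex.I) *
          Complex.exp (D i (q + δ) r ω * Complex.I) ∂P - φ i p q * φ i (q + δ) r)
    linarith
  have hgauss : ∀ p q, p < q → c * (q - p) ≤ 2 → ∀ η > 0, ∀ᶠ i in l,
      ‖φ i p q - Real.exp (-(v q - v p) / 2)‖ ≤
        4 * (c * (q - p) * √(c * (q - p))) + (c * (q - p)) ^ 2 + η := by
    intro p q hpq hs η hη
    have hv' := hvar p q hpq.le
    filter_upwards [hv'.eventually (Metric.ball_mem_nhds _ hη)] with i hi
    obtain ⟨B, hB⟩ := hbdd i p q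
    have t1 := norm_integral_cexp_sub_quadratic_le (hmeas i p q) hB (hcent i p q hpq.le)
      (mul_pos hc (sub_pos.2 hpq)) (h4 i p q hpq.le)
    have t2 := abs_exp_neg_half_sub_le (hv p q hpq).1 ((hv p q hpq).2.trans hs)
    have t3 : (v q - v p) ^ 2 ≤ (c * (q - p)) ^ 2 :=
      pow_le_pow_left₀ (hv p q hpq).1 (hv p q hpq).2 2
    have t4 : |∫ ω, D i p q ω ^ 2 ∂P - (v q - v p)| < η := hi
    have t5 : ‖((1 - (∫ ω, D i p q ω ^ 2 ∂P) / 2 : ℝ) : ℂ) - Real.exp (-(v q - v p) / 2)‖ ≤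
        (c * (q - p)) ^ 2 + η := by
      rw [← Complex.ofReal_sub, Complex.norm_real, Real.norm_eq_abs]
      rw [abs_le] at t2 ⊢
      rw [abs_lt] at t4
      constructor <;> linarith
    calc _ ≤ _ := norm_sub_le_norm_sub_add_norm_sub _
            ((1 - (∫ ω, D i p q ω ^ 2 ∂P) / 2 : ℝ) : ℂ) _
      _ ≤ _ := by rw [add_assoc]; exact add_le_add t1 t5
  -- Appending a block adds its own error: the other factors, a characteristic function and a
  -- Gaussian factor with nonnegative variance, have modulus at most one.
  have hrec : ∀ p q r κ, p ≤ q → q < r → c * (r - q) ≤ 2 →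
      (∀ η > 0, ∀ᶠ i in l, ‖φ i p q - Real.exp (-(v q - v p) / 2)‖ ≤ κ + η) →
      ∀ η > 0, ∀ᶠ i in l, ‖φ i p r - Real.exp (-(v r - v p) / 2)‖ ≤
        κ + (4 * (c * (r - q) * √(c * (r - q))) + (c * (r - q)) ^ 2) + η := by
    intro p q r κ hpq hqr hs hκ η hη
    filter_upwards [hindep p q r hpq hqr (η / 3) (by positivity),
      hgauss q r hqr hs (η / 3) (by positivity), hκ (η / 3) (by positivity)] with i h1 h3 h5
    have e : φ i p r - Real.exp (-(v r - v p) / 2) = (φ i p r - φ i p q * φ i q r) +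
        φ i p q * (φ i q r - Real.exp (-(v r - v q) / 2)) +
        (φ i p q - Real.exp (-(v q - v p) / 2)) * Real.exp (-(v r - v q) / 2) := by
      have : Real.exp (-(v r - v p) / 2) =
          Real.exp (-(v q - v p) / 2) * Real.exp (-(v r - v q) / 2) := by
        rw [← Real.exp_add]; ring_nf
      rw [this]
      push_cast
      ring
    rw [e]
    have a1 : ‖φ i p q * (φ i q r - Real.exp (-(v r - v q) / 2))‖ ≤
        ‖φ i q r - Real.exp (-(v r - v q) / 2)‖ := by
      rw [norm_mul]
      exact mul_le_of_le_one_left (norm_nonneg _) (norm_integral_cexp_le_one _)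
    have a2 : ‖(φ i p q - Real.exp (-(v q - v p) / 2)) * Real.exp (-(v r - v q) / 2)‖ ≤
        ‖φ i p q - Real.exp (-(v q - v p) / 2)‖ := by
      rw [norm_mul]
      refine mul_le_of_le_one_right (norm_nonneg _) ?_
      rw [Complex.norm_real, Real.norm_eq_abs, abs_of_pos (Real.exp_pos _), Real.exp_le_one_iff]
      linarith [(hv q r hqr).1]
    have a3 := norm_add_le (φ i p r - φ i p q * φ i q r +
      φ i p q * (φ i q r - Real.exp (-(v r - v q) / 2)))
      ((φ i p q - Real.exp (-(v q - v p) / 2)) * Real.exp (-(v r - v q) / 2))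
    have a4 := norm_add_le (φ i p r - φ i p q * φ i q r)
      (φ i p q * (φ i q r - Real.exp (-(v r - v q) / 2)))
    linarith
  rcases hab.eq_or_lt with rfl | hab
  -- Additivity on a degenerate interval forces the value zero.
  · have hz : ∀ i ω, D i a a ω = 0 := fun i ω => by
      have := hadd i a a a le_rfl le_rfl ω
      linarith
    simp [hz]
  have hn : ∀ n : ℕ, 0 < n → c * ((b - a) / n) ≤ 2 → ∀ k : ℕ, ∀ η > 0, ∀ᶠ i in l,
      ‖φ i a (a + k * ((b - a) / n)) - Real.exp (-(v (a + k * ((b - a) / n)) - v a) / 2)‖ ≤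
      k * (4 * (c * ((b - a) / n) * √(c * ((b - a) / n))) + (c * ((b - a) / n)) ^ 2) + η := by
    intro n hn hs k
    have hh : 0 < (b - a) / n := div_pos (sub_pos.2 hab) (by positivity)
    induction k with
    | zero =>
      intro η hη
      have hz : ∀ i ω, D i a a ω = 0 := fun i ω => by
        have := hadd i a a a le_rfl le_rfl ω
        linarith
      simp [hφ, hz, hη.le]
    | succ k ih =>
      have e : a + ((k + 1 : ℕ) : ℝ) * ((b - a) / n) - (a + k * ((b - a) / n)) = (b - a) / n := by
        push_cast; ring
      have := hrec a (a + k * ((b - a) / n)) (a + (k + 1 : ℕ) * ((b - a) / n)) _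
        (le_add_of_nonneg_right (by positivity)) (by linarith) (by rw [e]; exact hs) ih
      rw [e] at this
      intro η hη
      refine (this η hη).mono fun i hi => hi.trans (le_of_eq ?_)
      push_cast
      ring
  rw [Metric.tendsto_nhds]
  intro η hη
  have hlim : Tendsto (fun n : ℕ => c * ((b - a) / n)) atTop (𝓝 0) := by
    simpa using (tendsto_const_div_atTop_nhds_zero_nat (b - a)).const_mul c
  -- The error of one block is of order `n ^ (-3/2)`, so the sum over `n` blocks still vanishes as
  -- `n` grows.
  have hlim2 : Tendsto (fun n : ℕ => c * (b - a) * (4 * √(c * ((b - a) / n)) + c * ((b - a) / n)))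
      atTop (𝓝 0) := by
    have : Tendsto (fun x : ℝ => c * (b - a) * (4 * √x + x)) (𝓝 0) (𝓝 0) := by
      have h : Continuous fun x : ℝ => c * (b - a) * (4 * √x + x) := by fun_prop
      simpa using h.tendsto 0
    exact this.comp hlim
  obtain ⟨n, h1, h2', h3⟩ := ((hlim.eventually (gt_mem_nhds zero_lt_two)).and
    ((hlim2.eventually (gt_mem_nhds (by positivity : 0 < η / 2))).and
      (eventually_gt_atTop 0))).exists
  have hn0 : (n : ℝ) ≠ 0 := by positivity
  have e1 : a + n * ((b - a) / n) = b := by field_simp; ring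
  have e2 : n * (4 * (c * ((b - a) / n) * √(c * ((b - a) / n))) + (c * ((b - a) / n)) ^ 2) =
      c * (b - a) * (4 * √(c * ((b - a) / n)) + c * ((b - a) / n)) := by
    field_simp
  have := hn n h3 h1.le n (η / 4) (by positivity)
  rw [e1, e2] at this
  filter_upwards [this] with i hi
  rw [dist_eq_norm]
  linarith

end AbstractCLT

/-! ### The central limit theorem for weighted integrals of mixing fields -/

section MixingCLT

/-- Convergence of a rescaled bilinear convolution form. -/
theorem tendsto_integral_mul_integral_comp_add_mul {l : Filter (Ioi (0 : ℝ))}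
    [l.IsCountablyGenerated] (hl : Tendsto (fun ε : Ioi (0 : ℝ) => (ε : ℝ)) l (𝓝 0))
    {f g r : ℝ → ℝ} {B : ℝ} (hf : Integrable f) (hfm : Measurable f) (hg : Measurable g)
    (hgB : ∀ y, |g y| ≤ B) (hgc : ∀ᵐ y, ContinuousAt g y) (hr : Integrable r)
    (hrm : Measurable r) :
    Tendsto (fun ε : Ioi (0 : ℝ) => ∫ y, f y * ∫ z, g (y + ε * z) * r z) l
      (𝓝 ((∫ y, f y * g y) * ∫ z, r z)) := by
  rw [← integral_mul_const]
  simp_rw [mul_assoc]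
  have hb : ∀ (ε : Ioi (0 : ℝ)) y z, ‖g (y + ε * z) * r z‖ ≤ B * ‖r z‖ := fun ε y z => by
    rw [norm_mul]
    exact mul_le_mul_of_nonneg_right (hgB _) (norm_nonneg _)
  refine tendsto_integral_filter_of_dominated_convergence (fun y => ‖f y‖ * ∫ z, B * ‖r z‖)
    (.of_forall fun ε => ?_) (.of_forall fun ε => .of_forall fun y => ?_)
    (hf.norm.mul_const _) ?_
  · refine (hfm.mul (StronglyMeasurable.measurable ?_)).aestronglyMeasurable
    have : StronglyMeasurable (fun p : ℝ × ℝ => g (p.1 + ε * p.2) * r p.2) :=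
      Measurable.stronglyMeasurable (by fun_prop)
    exact this.integral_prod_right
  · rw [norm_mul]
    exact mul_le_mul_of_nonneg_left (norm_integral_le_of_norm_le (hr.norm.const_mul B)
      (.of_forall fun z => hb ε y z)) (norm_nonneg _)
  · filter_upwards [hgc] with y hy
    refine Tendsto.const_mul _ ?_
    rw [← integral_const_mul]
    refine tendsto_integral_filter_of_dominated_convergence (fun z => B * ‖r z‖)
      (.of_forall fun ε => Measurable.aestronglyMeasurable (by fun_prop))
      (.of_forall fun ε => .of_forall fun z => hb ε y z) (hr.norm.const_mul B)
      (.of_forall fun z => ?_)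
    refine Tendsto.mul_const _ (hy.tendsto.comp ?_)
    simpa using (hl.mul_const z).const_add y

variable {S : Type*} {m : MeasurableSpace S} {P : Measure S}
  {past future : ℝ → MeasurableSpace S} {ψ : ℝ → ℝ} {K : ℝ}

/-- The rate is decreasing, so `h * √(ψ h)` is at most the integral of `√ψ` over `(0, h]`. -/
theorem IsMixing.rate_le (hP : IsMixing P past future ψ) {h : ℝ} (hh : 0 < h) :
    ψ h ≤ ((∫ u in Ioi 0, √(ψ u)) / h) ^ 2 := by
  have h1 : h * √(ψ h) ≤ ∫ u in Ioi 0, √(ψ u) := by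
    calc h * √(ψ h) = ∫ u in Ioc 0 h, √(ψ h) := by simp [hh.le]
      _ ≤ ∫ u in Ioc 0 h, √(ψ u) :=
          setIntegral_mono_on (by simp) (hP.rate_integrable.mono_set Ioc_subset_Ioi_self)
            measurableSet_Ioc fun u hu => Real.sqrt_le_sqrt (hP.rate_anti hu.2)
      _ ≤ ∫ u in Ioi 0, √(ψ u) := setIntegral_mono_set hP.rate_integrable
            (.of_forall fun u => Real.sqrt_nonneg _) (.of_forall Ioc_subset_Ioi_self)
  rw [← Real.sqrt_le_left (by positivity), le_div_iff₀ hh, mul_comm]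
  exact h1

theorem IsMixing.tendsto_rate (hP : IsMixing P past future ψ) : Tendsto ψ atTop (𝓝 0) := by
  have h : Tendsto (fun h : ℝ => ((∫ u in Ioi 0, √(ψ u)) / h) ^ 2) atTop (𝓝 0) := by
    simpa using ((tendsto_const_nhds (x := ∫ u in Ioi 0, √(ψ u))).div_atTop tendsto_id).pow 2
  refine tendsto_of_tendsto_of_tendsto_of_le_of_le' tendsto_const_nhds h
    (.of_forall hP.rate_nonneg) ?_
  filter_upwards [eventually_gt_atTop 0] with x hx using hP.rate_le hx

theorem IsMixing.scale (hP : IsMixing P past future ψ) {ε : ℝ} (hε : 0 < ε) :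
    IsMixing P (fun x => past (x / ε)) (fun x => future (x / ε)) (fun h => ψ (h / ε)) where
  past_le x := hP.past_le _
  future_le x := hP.future_le _
  past_mono x y h := hP.past_mono (by gcongr)
  future_anti x y h := hP.future_anti (by gcongr)
  rate_nonneg h := hP.rate_nonneg _
  rate_anti x y h := hP.rate_anti (by gcongr)
  rate_integrable := by
    have := (integrableOn_Ioi_comp_mul_right_iff (fun h => √(ψ h)) 0 (inv_pos.2 hε)).2
      (by simpa using hP.rate_integrable)
    simpa [div_eq_mul_inv] using this
  decorrelation x h hh A B hA hB := hP.decorrelation (x / ε) (h / ε) (by positivity) A B hA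
    (by rwa [← add_div])

theorem integral_sqrt_rate_scale {ε : ℝ} (hε : 0 < ε) :
    ∫ h in Ioi 0, √(ψ (h / ε)) = ε * ∫ h in Ioi 0, √(ψ h) := by
  have := integral_comp_mul_right_Ioi (fun h => √(ψ h)) 0 (inv_pos.2 hε)
  simpa [div_eq_mul_inv] using this

theorem IsMixingField.scale {X : ℝ → S → ℝ} (hX : IsMixingField P past future K X) (ε : ℝ) :
    IsMixingField P (fun x => past (x / ε)) (fun x => future (x / ε)) K (fun y => X (y / ε)) where
  measurable := hX.measurable.comp ((measurable_fst.div_const ε).prodMk measurable_snd)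
  bound _ := hX.bound _
  past _ := hX.past _
  future _ := hX.future _
  centered _ := hX.centered _

theorem aestronglyMeasurable_finsetSum_of_le {S ι : Type*} {m₁ m : MeasurableSpace S}
    {P : Measure S} (s : Finset ι) {f : ι → S → ℝ} (hf : ∀ i, AEStronglyMeasurable[m₁] (f i) P) :
    AEStronglyMeasurable[m₁] (fun ω => ∑ i ∈ s, f i ω) P := by
  classical
  induction s using Finset.induction_on with
  | empty => simpa using aestronglyMeasurable_const
  | insert a s ha ih =>
    simp_rw [Finset.sum_insert ha]
    exact (hf a).add ih

/-- This is the Cramér–Wold device at the level of fields: deterministic weights preserve both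
centering and locality, so the scalar estimates cover finite families of times, points and
derivatives. -/
theorem IsMixingField.weighted_sum [IsProbabilityMeasure P]
    {ι : Type*} [Fintype ι] {X : ι → ℝ → S → ℝ}
    (hX : ∀ i, IsMixingField P past future K (X i)) {u : ι → ℝ → ℝ} {B : ℝ}
    (hu : ∀ i, Measurable (u i)) (huB : ∀ i y, |u i y| ≤ B) :
    IsMixingField P past future (∑ _i : ι, B * K) (fun y ω => ∑ i, u i y * X i y ω) where
  measurable := Finset.measurable_sum _ fun i _ =>
    ((hu i).comp measurable_fst).mul (hX i).measurable
  bound y ω := by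
    refine (Finset.abs_sum_le_sum_abs _ _).trans (Finset.sum_le_sum fun i _ => ?_)
    rw [abs_mul]
    exact mul_le_mul (huB i y) ((hX i).bound y ω) (abs_nonneg _) ((abs_nonneg _).trans (huB i y))
  past y :=
    aestronglyMeasurable_finsetSum_of_le _ fun i => ((hX i).past y).const_mul (u i y)
  future y :=
    aestronglyMeasurable_finsetSum_of_le _ fun i => ((hX i).future y).const_mul (u i y)
  centered y := by
    rw [integral_finsetSum _ fun i _ => ?_]
    · simp [integral_const_mul, (hX _).centered]
    · exact (Integrable.of_bound ((hX i).measurable_apply y).aestronglyMeasurable K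
        (.of_forall fun ω => (hX i).bound y ω)).const_mul _

theorem IsMixingField.intervalIntegrable {X : ℝ → S → ℝ} (hX : IsMixingField P past future K X)
    (p q : ℝ) (ω : S) : IntervalIntegrable (fun y => X y ω) volume p q := by
  refine (intervalIntegrable_const (c := K)).mono_fun
    (hX.measurable.comp measurable_prodMk_right).aestronglyMeasurable (.of_forall fun y => ?_)
  exact (hX.bound y ω).trans (le_abs_self K)

theorem IsMixingField.measurable_integral {X : ℝ → S → ℝ} (hX : IsMixingField P past future K X)
    (p q : ℝ) : Measurable (fun ω => ∫ y in p..q, X y ω) := by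
  have h : StronglyMeasurable (fun p : S × ℝ => X p.2 p.1) :=
    (hX.measurable.comp measurable_swap).stronglyMeasurable
  simp_rw [intervalIntegral]
  exact (h.integral_prod_right (ν := volume.restrict (Ioc p q))).measurable.sub
    (h.integral_prod_right (ν := volume.restrict (Ioc q p))).measurable

theorem IsMixingField.abs_integral_le {X : ℝ → S → ℝ} (hX : IsMixingField P past future K X)
    (p q : ℝ) (ω : S) : |∫ y in p..q, X y ω| ≤ K * |q - p| :=
  intervalIntegral.norm_integral_le_of_norm_le_const (f := fun y => X y ω)
    fun y _ => hX.bound y ω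

theorem IsMixingField.integral_integral_eq_zero [IsProbabilityMeasure P]
    {X : ℝ → S → ℝ}
    (hX : IsMixingField P past future K X) {p q : ℝ} (hpq : p ≤ q) :
    ∫ ω, (∫ y in p..q, X y ω) ∂P = 0 := by
  simp_rw [intervalIntegral.integral_of_le hpq]
  rw [integral_integral_swap]
  · simp [hX.centered]
  · exact Integrable.of_bound (hX.measurable.comp measurable_swap).aestronglyMeasurable K
      (.of_forall fun z => hX.bound z.2 z.1)

/-- Correlations of mixing fields decay. -/
theorem IsMixing.abs_integral_mul_le [IsProbabilityMeasure P]
    (hP : IsMixing P past future ψ) {X Y : ℝ → S → ℝ}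
    (hX : IsMixingField P past future K X) (hY : IsMixingField P past future K Y) (z : ℝ) :
    |∫ ω, X 0 ω * Y z ω ∂P| ≤ 4 * K * K * ψ |z| := by
  rcases le_total 0 z with hz | hz
  · have := hP.abs_cov_le hz (hX.past 0) (hY.future z) (.of_forall (hX.bound 0))
      (.of_forall (hY.bound z))
    simpa [hX.centered, abs_of_nonneg hz] using this
  · have := hP.abs_cov_le hz (hY.past z) (hX.future 0) (.of_forall (hY.bound z))
      (.of_forall (hX.bound 0))
    simpa [hX.centered, abs_of_nonpos hz, mul_comm (Y z _)] using this

theorem IsMixingField.measurable_corr [IsProbabilityMeasure P]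
    {X Y : ℝ → S → ℝ}
    (hX : IsMixingField P past future K X) (hY : IsMixingField P past future K Y) :
    Measurable (fun z => ∫ ω, X 0 ω * Y z ω ∂P) := by
  have : StronglyMeasurable (fun p : ℝ × S => X 0 p.2 * Y p.1 p.2) :=
    (((hX.measurable_apply 0).comp measurable_snd).mul hY.measurable).stronglyMeasurable
  exact this.integral_prod_right.measurable

/-- The correlation at lag `z` is bounded by the rate, and `ψ |z|` is at most `√(ψ 0) * √(ψ |z|)` by
monotonicity. -/
theorem IsMixing.integrable_corr [IsProbabilityMeasure P]
    (hP : IsMixing P past future ψ) {X Y : ℝ → S → ℝ}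
    (hX : IsMixingField P past future K X) (hY : IsMixingField P past future K Y) :
    Integrable (fun z => ∫ ω, X 0 ω * Y z ω ∂P) := by
  have h1 := (integral_comp_abs_integrable hP.rate_integrable).const_mul (4 * K * K * √(ψ 0))
  refine h1.mono' (hX.measurable_corr hY).aestronglyMeasurable (.of_forall fun z => ?_)
  refine (hP.abs_integral_mul_le hX hY z).trans ?_
  have hK := hX.nonneg
  rw [mul_assoc _ (√(ψ 0))]
  refine mul_le_mul_of_nonneg_left ?_ (by positivity)
  calc ψ |z| = √(ψ |z|) * √(ψ |z|) := (Real.mul_self_sqrt (hP.rate_nonneg _)).symm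
    _ ≤ √(ψ 0) * √(ψ |z|) := mul_le_mul_of_nonneg_right
        (Real.sqrt_le_sqrt (hP.rate_anti (abs_nonneg z))) (Real.sqrt_nonneg _)

/-- The covariance of two weighted integrals of stationarily correlated fields. -/
theorem IsMixingField.integral_mul_integral [IsProbabilityMeasure P]
    {X Y : ℝ → S → ℝ}
    (hX : IsMixingField P past future K X) (hY : IsMixingField P past future K Y)
    {r : ℝ → ℝ} (hr : ∀ y z, ∫ ω, X y ω * Y (y + z) ω ∂P = r z) {u w : ℝ → ℝ} {B : ℝ}
    (hu : Measurable u) (huB : ∀ y, |u y| ≤ B) (hw : Measurable w) (hwB : ∀ y, |w y| ≤ B)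
    {ε : ℝ} (hε : 0 < ε) {p q : ℝ} (hpq : p ≤ q) :
    ∫ ω, (∫ y in p..q, u y * X (y / ε) ω) * (∫ y in p..q, w y * Y (y / ε) ω) ∂P =
      ε * ∫ y, (Ioc p q).indicator u y * ∫ z, (Ioc p q).indicator w (y + ε * z) * r z := by
  simp_rw [intervalIntegral.integral_of_le hpq]
  set ν : Measure ℝ := volume.restrict (Ioc p q) with hν
  have hνfin : IsFiniteMeasure ν := ⟨by simp [hν]⟩
  have hB : 0 ≤ B := (abs_nonneg _).trans (huB 0)
  have hK := hX.nonneg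
  have mX := (hX.scale ε).measurable
  have mY := (hY.scale ε).measurable
  have hint : Integrable (fun z : S × (ℝ × ℝ) =>
      (u z.2.1 * X (z.2.1 / ε) z.1) * (w z.2.2 * Y (z.2.2 / ε) z.1)) (P.prod (ν.prod ν)) := by
    refine Integrable.of_bound (C := (B * K) * (B * K)) (Measurable.aestronglyMeasurable ?_)
      (.of_forall fun z => ?_)
    · have h1 : Measurable fun z : S × (ℝ × ℝ) => (z.2.1, z.1) := by fun_prop
      have h2 : Measurable fun z : S × (ℝ × ℝ) => (z.2.2, z.1) := by fun_prop
      exact ((hu.comp (by fun_prop)).mul (mX.comp h1)).mul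
        ((hw.comp (by fun_prop)).mul (mY.comp h2))
    · simp only [norm_mul]
      gcongr
      exacts [huB _, hX.bound _ _, hwB _, hY.bound _ _]
  have e1 : ∀ ω, (∫ y, u y * X (y / ε) ω ∂ν) * (∫ y, w y * Y (y / ε) ω ∂ν) =
      ∫ z : ℝ × ℝ, (u z.1 * X (z.1 / ε) ω) * (w z.2 * Y (z.2 / ε) ω) ∂(ν.prod ν) := fun ω =>
    (integral_prod_mul _ _).symm
  simp_rw [e1]
  rw [integral_integral_swap hint]
  have e2 : ∀ z : ℝ × ℝ, ∫ ω, (u z.1 * X (z.1 / ε) ω) * (w z.2 * Y (z.2 / ε) ω) ∂P =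
      u z.1 * (w z.2 * r ((z.2 - z.1) / ε)) := by
    intro z
    have : ∀ ω, (u z.1 * X (z.1 / ε) ω) * (w z.2 * Y (z.2 / ε) ω) =
        u z.1 * w z.2 * (X (z.1 / ε) ω * Y (z.1 / ε + (z.2 - z.1) / ε) ω) := by
      intro ω
      rw [← add_div, add_sub_cancel]
      ring
    simp_rw [this]
    rw [integral_const_mul, hr, mul_assoc]
  have hint2 := hint.swap.integral_prod_left
  simp only [Function.comp_def, Prod.swap_prod_mk, e2] at hint2
  simp_rw [e2]
  rw [integral_prod _ hint2, ← integral_const_mul, hν, ← integral_indicator measurableSet_Ioc]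
  congr 1 with y
  simp_rw [integral_const_mul]
  -- Substituting `y' = y + ε * z` moves the scale from the correlation to the weight and produces
  -- the factor `ε` that cancels the normalisation of the variance.
  have e3 : ∫ y', (Ioc p q).indicator (fun y' => w y' * r ((y' - y) / ε)) y' =
      ε * ∫ z, (Ioc p q).indicator w (y + ε * z) * r z := by
    have h1 := integral_sub_right_eq_self (μ := volume)
      (fun y' => (Ioc p q).indicator w (y + y') * r (y' / ε)) y
    have h2 := Measure.integral_comp_div
      (fun z => (Ioc p q).indicator w (y + ε * z) * r z) ε
    rw [abs_of_pos hε, smul_eq_mul] at h2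
    rw [← h2]
    simp_rw [mul_div_cancel₀ _ hε.ne']
    rw [← h1]
    congr 1 with y'
    rw [add_sub_cancel]
    by_cases h : y' ∈ Ioc p q <;> simp [h]
  by_cases h : y ∈ Ioc p q
  · simp only [indicator_of_mem h]
    rw [← integral_indicator measurableSet_Ioc, e3]
    ring
  · simp [indicator_of_notMem h]

theorem ae_continuousAt_indicator_Ioc {w : ℝ → ℝ} (hw : ∀ᵐ y, ContinuousAt w y) (p q : ℝ) :
    ∀ᵐ y, ContinuousAt ((Ioc p q).indicator w) y := by
  have h : ∀ᵐ y : ℝ, y ∉ ({p, q} : Set ℝ) :=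
    measure_eq_zero_iff_ae_notMem.1 ((Set.toFinite {p, q}).measure_zero volume)
  filter_upwards [hw, h] with y hy hpq
  simp only [mem_insert_iff, mem_singleton_iff, not_or] at hpq
  by_cases hI : y ∈ Ioc p q
  · have hn : Ioo p q ∈ 𝓝 y := Ioo_mem_nhds hI.1 (lt_of_le_of_ne hI.2 hpq.2)
    refine hy.congr ?_
    filter_upwards [hn] with z hz
    rw [indicator_of_mem (Ioo_subset_Ioc_self hz)]
  · have hn : (Icc p q)ᶜ ∈ 𝓝 y := isClosed_Icc.isOpen_compl.mem_nhds fun h =>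
      hI ⟨lt_of_le_of_ne h.1 (Ne.symm hpq.1), h.2⟩
    refine (continuousAt_const (y := (0 : ℝ))).congr ?_
    filter_upwards [hn] with z hz
    rw [indicator_of_notMem fun h => hz (Ioc_subset_Icc_self h)]

/-- The central limit theorem for weighted integrals of a finite family of mixing fields whose
correlations are stationary. -/
theorem IsMixing.tendsto_integral_cexp [IsProbabilityMeasure P]
    (hP : IsMixing P past future ψ) {ι : Type*} [Fintype ι]
    {X : ι → ℝ → S → ℝ} (hX : ∀ i, IsMixingField P past future K (X i))
    (hstat : ∀ i j y z, ∫ ω, X i y ω * X j (y + z) ω ∂P = ∫ ω, X i 0 ω * X j z ω ∂P)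
    {u : ι → ℝ → ℝ} {B : ℝ} (hu : ∀ i, Measurable (u i)) (huB : ∀ i y, |u i y| ≤ B)
    (huc : ∀ i, ∀ᵐ y, ContinuousAt (u i) y) {a b : ℝ} (hab : a ≤ b) :
    Tendsto (fun ε : Ioi (0 : ℝ) => ∫ ω, Complex.exp ((1 / √(ε : ℝ) *
        ∫ y in a..b, ∑ i, u i y * X i (y / ε) ω : ℝ) * Complex.I) ∂P)
      (comap (Subtype.val : Ioi (0 : ℝ) → ℝ) (𝓝 0))
      (𝓝 (Real.exp (-(∑ i, ∑ j, (∫ y in a..b, u i y * u j y) *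
        ∫ z, ∫ ω, X i 0 ω * X j z ω ∂P) / 2))) := by
  set l := comap (Subtype.val : Ioi (0 : ℝ) → ℝ) (𝓝 0)
  have hl : Tendsto (fun ε : Ioi (0 : ℝ) => (ε : ℝ)) l (𝓝 0) := tendsto_comap
  set M := ∫ h in Ioi 0, √(ψ h) with hM
  set K' : ℝ := ∑ _i : ι, B * K
  have hY : ∀ ε : Ioi (0 : ℝ), IsMixingField P (fun x => past (x / ε)) (fun x => future (x / ε)) K'
      (fun y ω => ∑ i, u i y * X i (y / ε) ω) := fun ε =>
    IsMixingField.weighted_sum (fun i => (hX i).scale ε) hu huB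
  have hPε : ∀ ε : Ioi (0 : ℝ), IsMixing P (fun x => past (x / ε)) (fun x => future (x / ε))
      (fun h => ψ (h / ε)) := fun ε => hP.scale ε.2
  set D : Ioi (0 : ℝ) → ℝ → ℝ → S → ℝ := fun ε p q ω =>
    1 / √(ε : ℝ) * ∫ y in p..q, ∑ i, u i y * X i (y / ε) ω with hD
  have hM0 : 0 ≤ M := integral_nonneg fun _ => Real.sqrt_nonneg _
  have hDm : ∀ ε p q, Measurable (D ε p q) := fun ε p q =>
    ((hY ε).measurable_integral p q).const_mul _
  set v : ℝ → ℝ := fun q => ∑ i, ∑ j, (∫ y in (0 : ℝ)..q, u i y * u j y) *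
    ∫ z, ∫ ω, X i 0 ω * X j z ω ∂P with hv
  have hii : ∀ i j p q, IntervalIntegrable (fun y => u i y * u j y) volume p q := by
    intro i j p q
    refine (intervalIntegrable_const (c := B * B)).mono_fun
      ((hu i).mul (hu j)).aestronglyMeasurable (.of_forall fun y => ?_)
    change ‖u i y * u j y‖ ≤ ‖B * B‖
    rw [norm_mul]
    exact (mul_le_mul (huB i y) (huB j y) (abs_nonneg _) ((abs_nonneg _).trans (huB i y))).trans
      (le_abs_self _)
  have hvsub : ∀ p q, v q - v p = ∑ i, ∑ j, (∫ y in p..q, u i y * u j y) *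
      ∫ z, ∫ ω, X i 0 ω * X j z ω ∂P := by
    intro p q
    simp only [hv, ← Finset.sum_sub_distrib, ← sub_mul]
    simp_rw [intervalIntegral.integral_interval_sub_left (hii _ _ _ _) (hii _ _ _ _)]
  rw [← hvsub a b]
  -- The fourth moment constant is `48 * (K' ^ 2 * M) ^ 2`, and `48 ≤ 7 ^ 2`; the added `1` keeps
  -- `c` positive when `K'` or `M` vanishes.
  refine tendsto_integral_cexp_of_additive (D := D) (c := 7 * K' ^ 2 * M + 1) hab (by positivity)
    hDm ?_ ?_ ?_ ?_ ?_ ?_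
  · intro ε p q
    refine ⟨|1 / √(ε : ℝ)| * (K' * |q - p|), fun ω => ?_⟩
    rw [hD, abs_mul]
    exact mul_le_mul_of_nonneg_left ((hY ε).abs_integral_le p q ω) (abs_nonneg _)
  · intro ε p q r _ _ ω
    simp only [hD]
    rw [← mul_add, intervalIntegral.integral_add_adjacent_intervals
      ((hY ε).intervalIntegrable p q ω) ((hY ε).intervalIntegrable q r ω)]
  · intro ε p q hpq
    simp only [hD]
    rw [integral_const_mul, (hY ε).integral_integral_eq_zero hpq, mul_zero]
  · intro ε p q hpq
    have hε : (0 : ℝ) < ε := ε.2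
    have h := (hPε ε).integral_pow_four_le (hY ε) hpq
    rw [integral_sqrt_rate_scale hε] at h
    simp only [hD, mul_pow]
    rw [integral_const_mul]
    have e : (1 / √(ε : ℝ)) ^ 4 = 1 / (ε : ℝ) ^ 2 := by
      rw [div_pow, one_pow, show √(ε : ℝ) ^ 4 = (√(ε : ℝ) ^ 2) ^ 2 by ring, Real.sq_sqrt hε.le]
    rw [e]
    calc _ ≤ 1 / (ε : ℝ) ^ 2 * (48 * K' ^ 4 * (ε * M) ^ 2 * (q - p) ^ 2) := by gcongr
      _ = 48 * (K' ^ 2 * M) ^ 2 * (q - p) ^ 2 := by field_simp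
      _ ≤ (7 * K' ^ 2 * M + 1) ^ 2 * (q - p) ^ 2 := by
        refine mul_le_mul_of_nonneg_right ?_ (sq_nonneg _)
        have : 0 ≤ K' ^ 2 * M := by positivity
        nlinarith
  · intro p q hpq
    rw [hvsub]
    have hexp : ∀ ε : Ioi (0 : ℝ), ∫ ω, D ε p q ω ^ 2 ∂P = ∑ i, ∑ j,
        ∫ y, (Ioc p q).indicator (u i) y * ∫ z, (Ioc p q).indicator (u j) (y + ε * z) *
          ∫ ω, X i 0 ω * X j z ω ∂P := by
      intro ε
      have hε : (0 : ℝ) < ε := ε.2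
      have hone : ∀ i, IsMixingField P (fun x => past (x / ε)) (fun x => future (x / ε))
          (∑ _i : Unit, B * K) (fun y ω => ∑ _k : Unit, u i y * X i (y / ε) ω) := fun i =>
        IsMixingField.weighted_sum (u := fun _ => u i) (fun _ => (hX i).scale ε) (fun _ => hu i)
          (fun _ => huB i)
      simp only [Finset.univ_unique, Finset.sum_const, Finset.card_singleton, one_smul] at hone
      have e1 : ∀ ω, D ε p q ω ^ 2 = 1 / ε * ∑ i, ∑ j, (∫ y in p..q, u i y * X i (y / ε) ω) *
          ∫ y in p..q, u j y * X j (y / ε) ω := by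
        intro ω
        simp only [hD]
        rw [intervalIntegral.integral_finsetSum
          (fun i _ => (hone i).intervalIntegrable p q ω), mul_pow, sq (∑ i, _),
          Finset.sum_mul_sum, div_pow, Real.sq_sqrt hε.le, one_pow]
      have hi : ∀ i j, Integrable (fun ω => (∫ y in p..q, u i y * X i (y / ε) ω) *
          ∫ y in p..q, u j y * X j (y / ε) ω) P := by
        intro i j
        refine Integrable.of_bound (((hone i).measurable_integral p q).mul
          ((hone j).measurable_integral p q)).aestronglyMeasurable
          ((B * K * |q - p|) * (B * K * |q - p|)) (.of_forall fun ω => ?_)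
        rw [norm_mul]
        exact mul_le_mul ((hone i).abs_integral_le p q ω) ((hone j).abs_integral_le p q ω)
          (norm_nonneg _) ((abs_nonneg _).trans ((hone i).abs_integral_le p q ω))
      simp_rw [e1]
      rw [integral_const_mul, integral_finsetSum _ fun i _ => integrable_finsetSum _ fun j _ =>
        hi i j, Finset.mul_sum]
      refine Finset.sum_congr rfl fun i _ => ?_
      rw [integral_finsetSum _ fun j _ => hi i j, Finset.mul_sum]
      refine Finset.sum_congr rfl fun j _ => ?_
      rw [(hX i).integral_mul_integral (hX j) (hstat i j) (hu i) (huB i) (hu j) (huB j) hε hpq]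
      field_simp
    simp_rw [hexp]
    refine tendsto_finsetSum _ fun i _ => tendsto_finsetSum _ fun j _ => ?_
    have hB : 0 ≤ B := (abs_nonneg _).trans (huB i 0)
    have hlim := tendsto_integral_mul_integral_comp_add_mul (l := l) hl
      (f := (Ioc p q).indicator (u i)) (g := (Ioc p q).indicator (u j)) (B := B)
      (r := fun z => ∫ ω, X i 0 ω * X j z ω ∂P) ?_ ((hu i).indicator measurableSet_Ioc)
      ((hu j).indicator measurableSet_Ioc) ?_ (ae_continuousAt_indicator_Ioc (huc j) p q)
      (hP.integrable_corr (hX i) (hX j)) ((hX i).measurable_corr (hX j))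
    · convert hlim using 3
      rw [intervalIntegral.integral_of_le hpq, ← integral_indicator measurableSet_Ioc]
      congr 1 with y
      by_cases h : y ∈ Ioc p q <;> simp [h]
    · rw [integrable_indicator_iff measurableSet_Ioc]
      have : IsFiniteMeasure (volume.restrict (Ioc p q)) := ⟨by simp⟩
      exact Integrable.of_bound (hu i).aestronglyMeasurable B (.of_forall (huB i))
    · intro y
      by_cases h : y ∈ Ioc p q
      · simpa [h] using huB j y
      · simpa [h] using hB
  · intro p q q' r hpq hqq hqr
    rw [tendsto_zero_iff_norm_tendsto_zero]
    -- In the unscaled variable the gap `q' - q` has length `(q' - q) / ε`, which tends to infinity.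
    have hlim : Tendsto (fun ε : Ioi (0 : ℝ) => 16 * ψ ((q' - q) / ε)) l (𝓝 0) := by
      have h0 : Tendsto (fun ε : Ioi (0 : ℝ) => (ε : ℝ)) l (𝓝[>] 0) :=
        tendsto_nhdsWithin_iff.2 ⟨hl, .of_forall fun ε => ε.2⟩
      have h1 : Tendsto (fun ε : Ioi (0 : ℝ) => (q' - q) / (ε : ℝ)) l atTop := by
        simpa [div_eq_mul_inv] using
          (tendsto_inv_nhdsGT_zero.comp h0).const_mul_atTop (sub_pos.2 hqq)
      simpa using (hP.tendsto_rate.comp h1).const_mul 16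
    refine squeeze_zero (fun _ => norm_nonneg _) (fun ε => ?_) hlim
    refine (hPε ε).norm_cexp_cov_le (F := D ε p q) (G := D ε q' r) hqq.le ?_ ?_
    · exact (aestronglyMeasurable_intervalIntegral_of_le ((hPε ε).past_le q) (hY ε).measurable
        (hY ε).bound hpq fun y hy => ((hY ε).past y).mono ((hPε ε).past_mono hy.2)).const_mul _
    · exact (aestronglyMeasurable_intervalIntegral_of_le ((hPε ε).future_le q') (hY ε).measurable
        (hY ε).bound hqr fun y hy => ((hY ε).future y).mono ((hPε ε).future_anti hy.1.le)).const_mul _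

end MixingCLT

/-! ### A version of the field with regular paths -/

section Regularization

theorem timeDeriv_eq_derivWithin (f : ℝ≥0 → ℝ) {s : ℝ} (hs : 0 ≤ s) :
    timeDeriv f s.toNNReal = derivWithin (fun s : ℝ => f s.toNNReal) (Ici 0) s := by
  rw [timeDeriv, Real.coe_toNNReal s hs]

theorem IsC2OnHalfLine.contDiffOn_timeDeriv {f : ℝ≥0 → ℝ} (hf : IsC2OnHalfLine f) :
    ContDiffOn ℝ 1 (fun s : ℝ => timeDeriv f s.toNNReal) (Ici 0) := by
  have h : ContDiffOn ℝ 1 (derivWithin (fun s : ℝ => f s.toNNReal) (Ici 0)) (Ici 0) :=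
    ContDiffOn.derivWithin hf (uniqueDiffOn_Ici 0) (by norm_num)
  exact h.congr fun s hs => timeDeriv_eq_derivWithin f hs

theorem IsC2OnHalfLine.contDiffOn_timeDeriv_timeDeriv {f : ℝ≥0 → ℝ} (hf : IsC2OnHalfLine f) :
    ContDiffOn ℝ 0 (fun s : ℝ => timeDeriv (timeDeriv f) s.toNNReal) (Ici 0) := by
  have h : ContDiffOn ℝ 0 (derivWithin (fun s : ℝ => timeDeriv f s.toNNReal) (Ici 0)) (Ici 0) :=
    ContDiffOn.derivWithin hf.contDiffOn_timeDeriv (uniqueDiffOn_Ici 0) (by norm_num)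
  exact h.congr fun s hs => timeDeriv_eq_derivWithin _ hs

theorem continuous_of_continuousOn_toNNReal {f : ℝ≥0 → ℝ}
    (hf : ContinuousOn (fun s : ℝ => f s.toNNReal) (Ici 0)) : Continuous f := by
  have : Continuous fun t : ℝ≥0 => (fun s : ℝ => f s.toNNReal) (t : ℝ) :=
    hf.comp_continuous NNReal.continuous_coe fun t => t.2
  simpa using this

theorem hasDerivWithinAt_timeDeriv {f : ℝ≥0 → ℝ}
    (hf : ContDiffOn ℝ 1 (fun s : ℝ => f s.toNNReal) (Ici 0)) {t : ℝ} (ht : 0 ≤ t) :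
    HasDerivWithinAt (fun s : ℝ => f s.toNNReal) (timeDeriv f t.toNNReal) (Ici 0) t := by
  rw [timeDeriv_eq_derivWithin f ht]
  exact ((hf.differentiableOn one_ne_zero) t ht).hasDerivWithinAt

theorem integral_timeDeriv {f : ℝ≥0 → ℝ}
    (hf : ContDiffOn ℝ 1 (fun s : ℝ => f s.toNNReal) (Ici 0)) {t : ℝ} (ht : 0 ≤ t) :
    ∫ s in (0 : ℝ)..t, timeDeriv f s.toNNReal = f t.toNNReal - f 0 := by
  have hsub : uIcc 0 t ⊆ Ici 0 := by
    rw [uIcc_of_le ht]; exact Icc_subset_Ici_self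
  have hc : ContinuousOn (fun s : ℝ => timeDeriv f s.toNNReal) (Ici 0) := by
    have h : ContDiffOn ℝ 0 (derivWithin (fun s : ℝ => f s.toNNReal) (Ici 0)) (Ici 0) :=
      ContDiffOn.derivWithin hf (uniqueDiffOn_Ici 0) (by norm_num)
    exact (h.congr fun s hs => timeDeriv_eq_derivWithin f hs).continuousOn
  have := intervalIntegral.integral_eq_sub_of_hasDeriv_right (a := 0) (b := t)
    (f := fun s : ℝ => f s.toNNReal) (f' := fun s : ℝ => timeDeriv f s.toNNReal)
    (hf.continuousOn.mono hsub) (fun x hx => by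
      rw [min_eq_left ht] at hx
      exact (hasDerivWithinAt_timeDeriv hf hx.1.le).mono
        fun z hz => hx.1.le.trans (le_of_lt hz))
    (hc.mono hsub).intervalIntegrable
  simpa using this

theorem measurable_intervalIntegral_param {α : Type*} [MeasurableSpace α] {F : α → ℝ → ℝ}
    (hF : Measurable (fun z : α × ℝ => F z.1 z.2)) {f g : α → ℝ} (hf : Measurable f)
    (hg : Measurable g) : Measurable (fun a => ∫ s in f a..g a, F a s) := by
  have key : ∀ {f g : α → ℝ}, Measurable f → Measurable g →
      Measurable (fun a => ∫ s in Ioc (f a) (g a), F a s) := by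
    intro f g hf hg
    have hs : MeasurableSet {z : α × ℝ | z.2 ∈ Ioc (f z.1) (g z.1)} :=
      (measurableSet_lt (hf.comp measurable_fst) measurable_snd).inter
        (measurableSet_le measurable_snd (hg.comp measurable_fst))
    have h : StronglyMeasurable
        (({z : α × ℝ | z.2 ∈ Ioc (f z.1) (g z.1)}).indicator fun z => F z.1 z.2) :=
      (hF.indicator hs).stronglyMeasurable
    have h2 := (h.integral_prod_right' (ν := (volume : Measure ℝ))).measurable
    convert h2 using 2 with a
    rw [← integral_indicator measurableSet_Ioc]
    rfl
  exact (key hf hg).sub (key hg hf)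

/-- Truncation of a real number to `[-K, K]`. -/
noncomputable def clip (K z : ℝ) : ℝ := max (-K) (min K z)

theorem measurable_clip (K : ℝ) : Measurable (clip K) := by unfold clip; fun_prop

theorem abs_clip_le {K : ℝ} (hK : 0 ≤ K) (z : ℝ) : |clip K z| ≤ K :=
  abs_le.2 ⟨le_max_left _ _, max_le (by linarith) (min_le_left _ _)⟩

theorem clip_eq_self {K z : ℝ} (hz : |z| ≤ K) : clip K z = z := by
  rw [abs_le] at hz
  rw [clip, min_eq_right hz.2, max_eq_right hz.1]

variable {S : Type*}

/-- The truncated second time derivative of the field. -/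
noncomputable def regDeriv₂ (c : ℝ≥0 → ℝ → S → ℝ) (K t y : ℝ) (ω : S) : ℝ :=
  clip K (fieldDeriv (fieldDeriv c) t.toNNReal y ω)

/-- A version of the time derivative of the field all of whose paths are Lipschitz in time. -/
noncomputable def regDeriv₁ (c : ℝ≥0 → ℝ → S → ℝ) (K t y : ℝ) (ω : S) : ℝ :=
  clip K (fieldDeriv c 0 y ω) + ∫ s in (0 : ℝ)..t, regDeriv₂ c K s y ω

/-- A version of the field all of whose paths are continuously differentiable in time. -/
noncomputable def regField (c : ℝ≥0 → ℝ → S → ℝ) (K t y : ℝ) (ω : S) : ℝ :=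
  clip K (c 0 y ω) + ∫ s in (0 : ℝ)..t, regDeriv₁ c K s y ω

theorem measurable_regDeriv₂ [MeasurableSpace S] {c : ℝ≥0 → ℝ → S → ℝ}
    (hc : IsMeasurableField (tripleField c)) (K : ℝ) :
    Measurable (fun p : (ℝ × ℝ) × S => regDeriv₂ c K p.1.1 p.1.2 p.2) := by
  have h : Measurable fun p : (ℝ × ℝ) × S => ((p.1.1.toNNReal, p.1.2), p.2) := by fun_prop
  exact (measurable_clip K).comp ((hc.comp h).snd.snd)

theorem measurable_regDeriv₁ [MeasurableSpace S] {c : ℝ≥0 → ℝ → S → ℝ}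
    (hc : IsMeasurableField (tripleField c)) (K : ℝ) :
    Measurable (fun p : (ℝ × ℝ) × S => regDeriv₁ c K p.1.1 p.1.2 p.2) := by
  have h : Measurable fun p : (ℝ × ℝ) × S => (((0 : ℝ≥0), p.1.2), p.2) := by fun_prop
  refine ((measurable_clip K).comp ((hc.comp h).snd.fst)).add
    (measurable_intervalIntegral_param ?_ measurable_const (by fun_prop))
  have h2 : Measurable fun p : ((ℝ × ℝ) × S) × ℝ => ((p.2, p.1.1.2), p.1.2) := by fun_prop
  exact (measurable_regDeriv₂ hc K).comp h2

theorem measurable_regField [MeasurableSpace S] {c : ℝ≥0 → ℝ → S → ℝ}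
    (hc : IsMeasurableField (tripleField c)) (K : ℝ) :
    Measurable (fun p : (ℝ × ℝ) × S => regField c K p.1.1 p.1.2 p.2) := by
  have h : Measurable fun p : (ℝ × ℝ) × S => (((0 : ℝ≥0), p.1.2), p.2) := by fun_prop
  refine ((measurable_clip K).comp ((hc.comp h).fst)).add
    (measurable_intervalIntegral_param ?_ measurable_const (by fun_prop))
  have h2 : Measurable fun p : ((ℝ × ℝ) × S) × ℝ => ((p.2, p.1.1.2), p.1.2) := by fun_prop
  exact (measurable_regDeriv₁ hc K).comp h2

theorem abs_regDeriv₂_le (c : ℝ≥0 → ℝ → S → ℝ) {K : ℝ} (hK : 0 ≤ K) (t y : ℝ) (ω : S) :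
    |regDeriv₂ c K t y ω| ≤ K := abs_clip_le hK _

/-- For exceptional `ω` only the truncated initial value and the truncated second derivative are
under control, so a bound valid for every `ω` must be allowed to grow with `t`. -/
theorem abs_regDeriv₁_le (c : ℝ≥0 → ℝ → S → ℝ) {K : ℝ} (hK : 0 ≤ K) (t y : ℝ) (ω : S) :
    |regDeriv₁ c K t y ω| ≤ K * (1 + |t|) := by
  have h1 : ‖∫ s in (0 : ℝ)..t, regDeriv₂ c K s y ω‖ ≤ K * |t - 0| :=
    intervalIntegral.norm_integral_le_of_norm_le_const fun s _ => abs_regDeriv₂_le c hK s y ω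
  rw [sub_zero, Real.norm_eq_abs] at h1
  have := abs_clip_le hK (fieldDeriv c 0 y ω)
  have := abs_add_le (clip K (fieldDeriv c 0 y ω)) (∫ s in (0 : ℝ)..t, regDeriv₂ c K s y ω)
  unfold regDeriv₁
  linarith

theorem abs_regField_le (c : ℝ≥0 → ℝ → S → ℝ) {K : ℝ} (hK : 0 ≤ K) (t y : ℝ) (ω : S) :
    |regField c K t y ω| ≤ K * (1 + |t|) ^ 2 := by
  have h1 : ‖∫ s in (0 : ℝ)..t, regDeriv₁ c K s y ω‖ ≤ K * (1 + |t|) * |t - 0| := by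
    refine intervalIntegral.norm_integral_le_of_norm_le_const fun s hs => ?_
    refine (abs_regDeriv₁_le c hK s y ω).trans ?_
    have : |s| ≤ |t| := by
      rcases mem_uIoc.1 hs with h | h
      · rw [abs_of_pos h.1, abs_of_pos (h.1.trans_le h.2)]; exact h.2
      · rw [abs_of_nonpos h.2, abs_of_neg (h.1.trans_le h.2)]; linarith [h.1]
    gcongr
  rw [sub_zero, Real.norm_eq_abs] at h1
  have := abs_clip_le hK (c 0 y ω)
  have := abs_add_le (clip K (c 0 y ω)) (∫ s in (0 : ℝ)..t, regDeriv₁ c K s y ω)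
  unfold regField
  nlinarith [abs_nonneg t, mul_nonneg hK (abs_nonneg t)]

/-- The regularized fields are modifications of the field and of its time derivatives. -/
theorem regField_ae_eq [MeasurableSpace S] {P : Measure S} {c : ℝ≥0 → ℝ → S → ℝ}
    (h_C2 : ∀ x : ℝ, ∀ᵐ ω ∂P, IsC2OnHalfLine (fun t => c t x ω)) {K : ℝ}
    (hK : ∀ (t : ℝ≥0) (x : ℝ), ∀ᵐ ω ∂P, |c t x ω| ≤ K ∧ |fieldDeriv c t x ω| ≤ K ∧
      |fieldDeriv (fieldDeriv c) t x ω| ≤ K) (y : ℝ) :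
    ∀ᵐ ω ∂P, IsC2OnHalfLine (fun t => c t y ω) ∧ ∀ t : ℝ, 0 ≤ t →
      regField c K t y ω = c t.toNNReal y ω ∧
      regDeriv₁ c K t y ω = fieldDeriv c t.toNNReal y ω ∧
      regDeriv₂ c K t y ω = fieldDeriv (fieldDeriv c) t.toNNReal y ω := by
  -- The bound `K` holds off a null set depending on the time; a countable dense set of times
  -- suffices, and continuity extends the bound, so that truncation is inactive.
  have hq : ∀ᵐ ω ∂P, ∀ n : ℕ, |c (TopologicalSpace.denseSeq ℝ≥0 n) y ω| ≤ K ∧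
      |fieldDeriv c (TopologicalSpace.denseSeq ℝ≥0 n) y ω| ≤ K ∧
      |fieldDeriv (fieldDeriv c) (TopologicalSpace.denseSeq ℝ≥0 n) y ω| ≤ K :=
    ae_all_iff.2 fun n => hK _ y
  filter_upwards [h_C2 y, hq] with ω hω hb
  refine ⟨hω, ?_⟩
  set f : ℝ≥0 → ℝ := fun t => c t y ω
  have ext : ∀ {g : ℝ≥0 → ℝ}, Continuous g →
      (∀ n, |g (TopologicalSpace.denseSeq ℝ≥0 n)| ≤ K) → ∀ t, |g t| ≤ K := by
    intro g hg h t
    have hcl : IsClosed {t | |g t| ≤ K} := isClosed_le hg.abs continuous_const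
    have := (TopologicalSpace.denseRange_denseSeq ℝ≥0).closure_range
    have hsub : closure (range (TopologicalSpace.denseSeq ℝ≥0)) ⊆ {t | |g t| ≤ K} :=
      closure_minimal (by rintro _ ⟨n, rfl⟩; exact h n) hcl
    rw [this] at hsub
    exact hsub (mem_univ t)
  have b0 : ∀ t, |f t| ≤ K :=
    ext (continuous_of_continuousOn_toNNReal (ContDiffOn.continuousOn hω)) fun n => (hb n).1
  have b1 : ∀ t, |timeDeriv f t| ≤ K :=
    ext (continuous_of_continuousOn_toNNReal hω.contDiffOn_timeDeriv.continuousOn)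
      fun n => (hb n).2.1
  have b2 : ∀ t, |timeDeriv (timeDeriv f) t| ≤ K :=
    ext (continuous_of_continuousOn_toNNReal hω.contDiffOn_timeDeriv_timeDeriv.continuousOn)
      fun n => (hb n).2.2
  have r2 : ∀ t : ℝ, regDeriv₂ c K t y ω = timeDeriv (timeDeriv f) t.toNNReal :=
    fun t => clip_eq_self (b2 _)
  have r1 : ∀ t : ℝ, 0 ≤ t → regDeriv₁ c K t y ω = timeDeriv f t.toNNReal := by
    intro t ht
    rw [regDeriv₁, show clip K (fieldDeriv c 0 y ω) = timeDeriv f 0 from clip_eq_self (b1 0)]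
    simp_rw [r2]
    rw [integral_timeDeriv hω.contDiffOn_timeDeriv ht]
    ring
  intro t ht
  refine ⟨?_, r1 t ht, r2 t⟩
  rw [regField, show clip K (c 0 y ω) = f 0 from clip_eq_self (b0 0)]
  rw [intervalIntegral.integral_congr (g := fun s => timeDeriv f s.toNNReal) fun s hs => ?_,
    integral_timeDeriv (hω.of_le (by norm_num)) ht]
  · ring
  · rw [uIcc_of_le ht] at hs
    exact r1 s hs.1

end Regularization

/-! ### The regularized fields as mixing fields -/

section FieldMixing

theorem stronglyMeasurable_limUnder_atTop {S : Type*} [MeasurableSpace S] {f : ℕ → S → ℝ}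
    (hf : ∀ n, StronglyMeasurable (f n)) :
    StronglyMeasurable fun ω => limUnder atTop (fun n => f n ω) :=
  StronglyMeasurable.limUnder hf

/-- The pointwise limit is taken of genuinely `m₁`-measurable representatives, with a default value
where they diverge. The measure itself lives on the larger σ-algebra, and only the exceptional sets
are judged there. -/
theorem aestronglyMeasurable_of_tendsto_of_le {S : Type*} {m₁ m : MeasurableSpace S}
    {P : Measure S} {f : ℕ → S → ℝ} {g : S → ℝ}
    (hf : ∀ n, AEStronglyMeasurable[m₁] (f n) P)
    (hfg : ∀ᵐ ω ∂P, Tendsto (fun n => f n ω) atTop (𝓝 (g ω))) : AEStronglyMeasurable[m₁] g P := by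
  choose f' hf' hff' using hf
  refine ⟨fun ω => limUnder atTop (fun n => f' n ω), 
    @stronglyMeasurable_limUnder_atTop S m₁ f' hf', ?_⟩
  filter_upwards [hfg, ae_all_iff.2 hff'] with ω h1 h2
  refine (Tendsto.limUnder_eq ?_).symm
  simpa [h2] using h1

/-- The increments `1 / (n + 1)` stay inside the half-line also at `t = 0`. The derivative thereby
becomes a sequential limit of values of the field at the same spatial point. -/
theorem tendsto_timeDeriv_of_contDiffOn {f : ℝ≥0 → ℝ}
    (hf : ContDiffOn ℝ 1 (fun s : ℝ => f s.toNNReal) (Ici 0)) (t : ℝ≥0) :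
    Tendsto (fun n : ℕ => (f (t + 1 / (n + 1)) - f t) * (n + 1)) atTop (𝓝 (timeDeriv f t)) := by
  have h := hasDerivWithinAt_timeDeriv hf t.coe_nonneg
  rw [Real.toNNReal_coe] at h
  rw [hasDerivWithinAt_iff_tendsto_slope] at h
  have hs : Tendsto (fun n : ℕ => (t : ℝ) + 1 / ((n : ℝ) + 1)) atTop (𝓝[Ici 0 \ {(t : ℝ)}] t) := by
    refine tendsto_nhdsWithin_iff.2 ⟨?_, .of_forall fun n => ⟨?_, ?_⟩⟩
    · simpa using tendsto_one_div_add_atTop_nhds_zero_nat.const_add (t : ℝ)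
    · exact add_nonneg t.2 (by positivity)
    · simp only [mem_singleton_iff, add_eq_left]
      positivity
  have := h.comp hs
  refine this.congr fun n => ?_
  have e : ((t : ℝ) + 1 / ((n : ℝ) + 1)).toNNReal = t + 1 / ((n : ℝ≥0) + 1) := by
    apply NNReal.coe_injective
    have h0 : (0 : ℝ) ≤ (t : ℝ) + 1 / ((n : ℝ) + 1) := add_nonneg t.coe_nonneg (by positivity)
    rw [Real.coe_toNNReal _ h0]
    push_cast
    rfl
  simp only [Function.comp_apply, slope_def_field, e, Real.toNNReal_coe, add_sub_cancel_left]
  field_simp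

variable {S : Type*} {c : ℝ≥0 → ℝ → S → ℝ}

theorem measurable_of_isMeasurableField_tripleField [MeasurableSpace S]
    (hc : IsMeasurableField (tripleField c))
    (t : ℝ≥0) (x : ℝ) : Measurable (c t x) := by
  have h : Measurable fun ω : S => ((t, x), ω) := measurable_prodMk_left
  exact (hc.comp h).fst

theorem pastSigma_le [MeasurableSpace S] (hc : IsMeasurableField (tripleField c)) (x : ℝ) :
    pastSigma c x ≤ ‹MeasurableSpace S› :=
  iSup_le fun t => iSup_le fun z => iSup_le fun _ =>
    (measurable_of_isMeasurableField_tripleField hc t z).comap_le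

theorem futureSigma_le [MeasurableSpace S] (hc : IsMeasurableField (tripleField c)) (x : ℝ) :
    futureSigma c x ≤ ‹MeasurableSpace S› :=
  iSup_le fun t => iSup_le fun z => iSup_le fun _ =>
    (measurable_of_isMeasurableField_tripleField hc t z).comap_le

theorem pastSigma_mono (c : ℝ≥0 → ℝ → S → ℝ) : Monotone (pastSigma c) := fun _ _ h =>
  iSup_mono fun _ => iSup_mono fun _ => iSup_mono' fun hz => ⟨hz.trans h, le_rfl⟩

theorem futureSigma_anti (c : ℝ≥0 → ℝ → S → ℝ) : Antitone (futureSigma c) := fun _ _ h =>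
  iSup_mono fun _ => iSup_mono fun _ => iSup_mono' fun hz => ⟨h.trans hz, le_rfl⟩

theorem measurable_pastSigma (c : ℝ≥0 → ℝ → S → ℝ) (t : ℝ≥0) (y : ℝ) :
    Measurable[pastSigma c y] (c t y) := by
  have h : MeasurableSpace.comap (c t y) inferInstance ≤ pastSigma c y :=
    le_iSup_of_le t (le_iSup_of_le y (le_iSup_of_le le_rfl le_rfl))
  exact (comap_measurable (c t y)).mono h le_rfl

theorem measurable_futureSigma (c : ℝ≥0 → ℝ → S → ℝ) (t : ℝ≥0) (y : ℝ) :
    Measurable[futureSigma c y] (c t y) := by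
  have h : MeasurableSpace.comap (c t y) inferInstance ≤ futureSigma c y :=
    le_iSup_of_le t (le_iSup_of_le y (le_iSup_of_le le_rfl le_rfl))
  exact (comap_measurable (c t y)).mono h le_rfl

/-- The coordinates of `ℝ³`. -/
def tripleProj : Fin 3 → ℝ × ℝ × ℝ → ℝ :=
  ![fun z => z.1, fun z => z.2.1, fun z => z.2.2]

theorem measurable_tripleProj (k : Fin 3) : Measurable (tripleProj k) := by
  fin_cases k
  · exact measurable_fst
  · exact measurable_fst.comp measurable_snd
  · exact measurable_snd.comp measurable_snd

/-- The regularized field and its first two time derivatives. -/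
noncomputable def regTriple (c : ℝ≥0 → ℝ → S → ℝ) (K : ℝ) : Fin 3 → ℝ → ℝ → S → ℝ :=
  ![regField c K, regDeriv₁ c K, regDeriv₂ c K]

theorem measurable_regTriple [MeasurableSpace S] (hc : IsMeasurableField (tripleField c)) (K : ℝ) (k : Fin 3) :
    Measurable (fun p : (ℝ × ℝ) × S => regTriple c K k p.1.1 p.1.2 p.2) := by
  fin_cases k
  exacts [measurable_regField hc K, measurable_regDeriv₁ hc K, measurable_regDeriv₂ hc K]

theorem abs_regTriple_le (c : ℝ≥0 → ℝ → S → ℝ) {K : ℝ} (hK : 0 ≤ K) (k : Fin 3) (t y : ℝ) (ω : S) :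
    |regTriple c K k t y ω| ≤ K * (1 + |t|) ^ 2 := by
  have h1 : K ≤ K * (1 + |t|) := le_mul_of_one_le_right hK (by linarith [abs_nonneg t])
  have h2 : K * (1 + |t|) ≤ K * (1 + |t|) ^ 2 := by
    rw [sq, ← mul_assoc]
    exact le_mul_of_one_le_right (by positivity) (by linarith [abs_nonneg t])
  fin_cases k
  exacts [abs_regField_le c hK t y ω, (abs_regDeriv₁_le c hK t y ω).trans h2,
    ((abs_regDeriv₂_le c hK t y ω).trans h1).trans h2]

variable [MeasurableSpace S] {P : Measure S} [IsProbabilityMeasure P]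

theorem bddAbove_phiMixing (c : ℝ≥0 → ℝ → S → ℝ) (P : Measure S) [IsProbabilityMeasure P] (h : ℝ) :
    BddAbove {r : ℝ | ∃ (x : ℝ) (A B : Set S), MeasurableSet[pastSigma c x] A ∧
      MeasurableSet[futureSigma c (x + h)] B ∧ 0 < P A ∧
      r = |(ProbabilityTheory.cond P A).real B - P.real B|} := by
  refine ⟨1, ?_⟩
  rintro r ⟨x, A, B, -, -, hA, rfl⟩
  have := cond_isProbabilityMeasure hA.ne'
  have h1 : (ProbabilityTheory.cond P A).real B ≤ 1 := measureReal_le_one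
  have h2 : P.real B ≤ 1 := measureReal_le_one
  have h3 : 0 ≤ (ProbabilityTheory.cond P A).real B := measureReal_nonneg
  have h4 : 0 ≤ P.real B := measureReal_nonneg
  rw [abs_le]
  constructor <;> linarith

/-- A `φ`-mixing field is mixing. -/
theorem isMixing_phiMixing (hc : IsMeasurableField (tripleField c))
    (h_mix : IntegrableOn (fun h : ℝ => √(phiMixing c P h)) (Ioi 0)) :
    IsMixing P (pastSigma c) (futureSigma c) (phiMixing c P) where
  past_le := pastSigma_le hc
  future_le := futureSigma_le hc
  past_mono := pastSigma_mono c
  future_anti := futureSigma_anti c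
  rate_nonneg h := Real.sSup_nonneg (by rintro r ⟨x, A, B, -, -, -, rfl⟩; exact abs_nonneg _)
  rate_anti h h' hh := by
    refine csSup_le_csSup (bddAbove_phiMixing c P h)
      ⟨_, 0, univ, univ, MeasurableSet.univ, MeasurableSet.univ, by simp, rfl⟩ ?_
    rintro r ⟨x, A, B, hA, hB, h0, rfl⟩
    exact ⟨x, A, B, hA, futureSigma_anti c (by linarith) B hB, h0, rfl⟩
  rate_integrable := h_mix
  decorrelation x h _ A B hA hB := by
    have hAm := pastSigma_le hc x A hA
    -- Null events do not enter the supremum but decorrelate trivially. Otherwise the conditional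
    -- bound is multiplied by `P A ≤ 1`.
    rcases eq_or_ne (P A) 0 with h0 | h0
    · have e1 : P.real A = 0 := by simp [Measure.real, h0]
      have e2 : P.real (A ∩ B) = 0 := by
        simp [Measure.real, measure_mono_null inter_subset_left h0]
      rw [e1, e2]
      simpa [phiMixing] using Real.sSup_nonneg (by rintro r ⟨x, A, B, -, -, -, rfl⟩; exact abs_nonneg _)
    · have hle : |(ProbabilityTheory.cond P A).real B - P.real B| ≤ phiMixing c P h :=
        le_csSup (bddAbove_phiMixing c P h) ⟨x, A, B, hA, hB, pos_iff_ne_zero.2 h0, rfl⟩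
      have e : (ProbabilityTheory.cond P A).real B * P.real A = P.real (A ∩ B) :=
        cond_mul_eq_inter' (μ := P) hAm (by simp) B |> fun h => by
          simpa [Measure.real, ENNReal.toReal_mul] using congrArg ENNReal.toReal h
      have h1 : P.real A ≤ 1 := measureReal_le_one
      have h2 : 0 ≤ P.real A := measureReal_nonneg
      have e3 : P.real (A ∩ B) - P.real A * P.real B =
          P.real A * ((ProbabilityTheory.cond P A).real B - P.real B) := by rw [← e]; ring
      rw [e3, abs_mul, abs_of_nonneg h2]
      exact (mul_le_of_le_one_left (abs_nonneg _) h1).trans hle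

/-- The standing assumptions on the field `c`, with an explicit bound. -/
structure IsRegularMixingField (c : ℝ≥0 → ℝ → S → ℝ) (P : Measure S) (K : ℝ) : Prop where
  meas : IsMeasurableField (tripleField c)
  contDiff : ∀ x : ℝ, ∀ᵐ ω ∂P, IsC2OnHalfLine (fun t => c t x ω)
  stat : IsStationaryField (tripleField c) P
  mean : ∀ (t : ℝ≥0) (x : ℝ), ∫ ω, c t x ω ∂P = 0 ∧ ∫ ω, fieldDeriv c t x ω ∂P = 0 ∧
      ∫ ω, fieldDeriv (fieldDeriv c) t x ω ∂P = 0
  bdd : ∀ (t : ℝ≥0) (x : ℝ), ∀ᵐ ω ∂P, |c t x ω| ≤ K ∧ |fieldDeriv c t x ω| ≤ K ∧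
      |fieldDeriv (fieldDeriv c) t x ω| ≤ K
  nonneg : 0 ≤ K
  mix : IntegrableOn (fun h : ℝ => √(phiMixing c P h)) (Ioi 0)

variable {K : ℝ}

theorem IsRegularMixingField.regTriple_ae_eq {P : Measure S} (hc : IsRegularMixingField c P K)
    (k : Fin 3) {t : ℝ} (ht : 0 ≤ t) (y : ℝ) :
    ∀ᵐ ω ∂P, regTriple c K k t y ω = tripleProj k (tripleField c t.toNNReal y ω) := by
  filter_upwards [regField_ae_eq hc.contDiff hc.bdd y] with ω hω
  fin_cases k
  exacts [(hω.2 t ht).1, (hω.2 t ht).2.1, (hω.2 t ht).2.2]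

/-- The past and future are generated by `c` alone. The derivatives at `y` belong to both, up to
null sets, as almost sure limits of difference quotients in time at the same `y`. -/
theorem IsRegularMixingField.isMixingField {P : Measure S} (hc : IsRegularMixingField c P K) (k : Fin 3) {t : ℝ}
    (ht : 0 ≤ t) : IsMixingField P (pastSigma c) (futureSigma c) (K * (1 + |t|) ^ 2)
      (regTriple c K k t) := by
  have hC := hc.contDiff
  have hae := fun y => (hc.regTriple_ae_eq k ht y).mono fun ω h => h.symm
  have aesm : ∀ (y : ℝ) (m₁ : MeasurableSpace S), (∀ s, Measurable[m₁] (c s y)) →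
      AEStronglyMeasurable[m₁] (regTriple c K k t y) P := by
    intro y m₁ hm₁
    have h0 : ∀ s, AEStronglyMeasurable[m₁] (c s y) P := fun s =>
      (hm₁ s).stronglyMeasurable.aestronglyMeasurable
    have h1 : ∀ s, AEStronglyMeasurable[m₁] (fieldDeriv c s y) P := fun s =>
      aestronglyMeasurable_of_tendsto_of_le (fun n => ((h0 _).sub (h0 s)).mul_const _) <| by
        filter_upwards [hC y] with ω hω
        exact tendsto_timeDeriv_of_contDiffOn (hω.of_le (by norm_num)) s
    have h2 : ∀ s, AEStronglyMeasurable[m₁] (fieldDeriv (fieldDeriv c) s y) P := fun s =>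
      aestronglyMeasurable_of_tendsto_of_le (fun n => ((h1 _).sub (h1 s)).mul_const _) <| by
        filter_upwards [hC y] with ω hω
        exact tendsto_timeDeriv_of_contDiffOn hω.contDiffOn_timeDeriv s
    have h3 : AEStronglyMeasurable[m₁] (fun ω => tripleProj k (tripleField c t.toNNReal y ω)) P := by
      fin_cases k
      exacts [h0 _, h1 _, h2 _]
    exact h3.congr (hae y)
  refine ⟨?_, abs_regTriple_le c hc.nonneg k t, fun y => aesm y _ fun s =>
    measurable_pastSigma c s y, fun y => aesm y _ fun s => measurable_futureSigma c s y,
    fun y => ?_⟩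
  · have h : Measurable fun p : ℝ × S => ((t, p.1), p.2) := by fun_prop
    exact (measurable_regTriple hc.meas K k).comp h
  · rw [integral_congr_ae (hc.regTriple_ae_eq k ht y)]
    have := hc.mean t.toNNReal y
    fin_cases k
    exacts [this.1, this.2.1, this.2.2]

theorem IsRegularMixingField.integral_regTriple_mul {P : Measure S}
    (hc : IsRegularMixingField c P K) (j k : Fin 3)
    {s t : ℝ} (hs : 0 ≤ s) (ht : 0 ≤ t) (y z : ℝ) :
    ∫ ω, regTriple c K j s y ω * regTriple c K k t (y + z) ω ∂P =
      ∫ ω, regTriple c K j s 0 ω * regTriple c K k t z ω ∂P := by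
  have h := hc.stat 0 y 2 ![(s.toNNReal, 0), (t.toNNReal, z)]
  have hm : Measurable fun v : Fin 2 → ℝ × ℝ × ℝ => tripleProj j (v 0) * tripleProj k (v 1) :=
    ((measurable_tripleProj j).comp (measurable_pi_apply 0)).mul
      ((measurable_tripleProj k).comp (measurable_pi_apply 1))
  have h3 := (h.comp hm).integral_eq
  simp only [Function.comp_def, Matrix.cons_val_zero, Matrix.cons_val_one, add_zero, zero_add] at h3
  have e : ∀ y z, ∫ ω, regTriple c K j s y ω * regTriple c K k t z ω ∂P =
      ∫ ω, tripleProj j (tripleField c s.toNNReal y ω) *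
        tripleProj k (tripleField c t.toNNReal z ω) ∂P := by
    intro y z
    refine integral_congr_ae ?_
    filter_upwards [hc.regTriple_ae_eq j hs y, hc.regTriple_ae_eq k ht z] with ω h1 h2
    rw [h1, h2]
  rw [e, e, ← h3, add_comm y z]

end FieldMixing

/-! ### Continuous random paths and uniqueness of versions -/

section Paths

theorem intervalIntegrable_of_abs_le {f : ℝ → ℝ} (hf : Measurable f) {a b B : ℝ}
    (hB : ∀ x ∈ uIoc a b, |f x| ≤ B) : IntervalIntegrable f volume a b := by
  rw [intervalIntegrable_iff]
  exact Measure.integrableOn_of_bounded (by simp) hf.aestronglyMeasurable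
    (ae_restrict_of_forall_mem measurableSet_uIoc hB)

theorem abs_le_max_of_mem_uIoc {a b x : ℝ} (hx : x ∈ uIoc a b) : |x| ≤ max |a| |b| := by
  rcases mem_uIoc.1 hx with h | h
  · exact abs_le_max_abs_abs h.1.le h.2
  · rw [max_comm]; exact abs_le_max_abs_abs h.1.le h.2

variable {S : Type*}

/-- The rescaled integrals of the regularized fields. -/
noncomputable def regPath (c : ℝ≥0 → ℝ → S → ℝ) (K ε : ℝ) (k : Fin 3) (t x : ℝ) (ω : S) : ℝ :=
  1 / √ε * ∫ y in (0 : ℝ)..x, regTriple c K k t (y / ε) ω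

theorem regPath_zero (c : ℝ≥0 → ℝ → S → ℝ) (K ε : ℝ) (k : Fin 3) (t : ℝ) (ω : S) :
    regPath c K ε k t 0 ω = 0 := by
  simp [regPath]

variable [MeasurableSpace S] {c : ℝ≥0 → ℝ → S → ℝ} {K : ℝ}

theorem measurable_regTriple_space (hc : IsMeasurableField (tripleField c)) (K : ℝ) (k : Fin 3)
    (t ε : ℝ) (ω : S) : Measurable (fun y => regTriple c K k t (y / ε) ω) := by
  have h : Measurable fun y : ℝ => ((t, y / ε), ω) := by fun_prop
  exact (measurable_regTriple hc K k).comp h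

theorem measurable_regTriple_time (hc : IsMeasurableField (tripleField c)) (K : ℝ) (k : Fin 3)
    (y : ℝ) (ω : S) : Measurable (fun t => regTriple c K k t y ω) := by
  have h : Measurable fun t : ℝ => ((t, y), ω) := by fun_prop
  exact (measurable_regTriple hc K k).comp h

theorem measurable_regPath (hc : IsMeasurableField (tripleField c)) (K ε : ℝ) (k : Fin 3) :
    Measurable (fun p : (ℝ × ℝ) × S => regPath c K ε k p.1.1 p.1.2 p.2) := by
  refine (measurable_intervalIntegral_param ?_ measurable_const (by fun_prop)).const_mul _
  have h : Measurable fun p : ((ℝ × ℝ) × S) × ℝ => ((p.1.1.1, p.2 / ε), p.1.2) := by fun_prop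
  exact (measurable_regTriple hc K k).comp h

theorem intervalIntegrable_regTriple (hc : IsMeasurableField (tripleField c)) (hK : 0 ≤ K)
    (k : Fin 3) (t ε : ℝ) (ω : S) (a b : ℝ) :
    IntervalIntegrable (fun y => regTriple c K k t (y / ε) ω) volume a b :=
  intervalIntegrable_of_abs_le (measurable_regTriple_space hc K k t ε ω)
    fun _ _ => abs_regTriple_le c hK k t _ ω

theorem regPath_sub (hc : IsMeasurableField (tripleField c)) (hK : 0 ≤ K) (ε : ℝ) (k : Fin 3)
    (t x x' : ℝ) (ω : S) : regPath c K ε k t x ω - regPath c K ε k t x' ω =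
      1 / √ε * ∫ y in x'..x, regTriple c K k t (y / ε) ω := by
  rw [regPath, regPath, ← mul_sub, intervalIntegral.integral_interval_sub_left]
  all_goals exact intervalIntegrable_regTriple hc hK k t ε ω _ _

theorem abs_regPath_sub_le (hc : IsMeasurableField (tripleField c)) (hK : 0 ≤ K) (ε : ℝ)
    (k : Fin 3) (t x x' : ℝ) (ω : S) : |regPath c K ε k t x ω - regPath c K ε k t x' ω| ≤
      1 / √ε * (K * (1 + |t|) ^ 2 * |x - x'|) := by
  rw [regPath_sub hc hK, abs_mul, abs_of_nonneg (by positivity : 0 ≤ 1 / √ε)]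
  gcongr
  exact intervalIntegral.norm_integral_le_of_norm_le_const
    (f := fun y => regTriple c K k t (y / ε) ω) fun s _ => abs_regTriple_le c hK k t _ ω

theorem abs_regPath_le (hc : IsMeasurableField (tripleField c)) (hK : 0 ≤ K) (ε : ℝ)
    (k : Fin 3) (t x : ℝ) (ω : S) : |regPath c K ε k t x ω| ≤
      1 / √ε * (K * (1 + |t|) ^ 2 * |x|) := by
  simpa [regPath_zero] using abs_regPath_sub_le hc hK ε k t x 0 ω

theorem intervalIntegrable_regTriple_time (hc : IsMeasurableField (tripleField c)) (hK : 0 ≤ K)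
    (k : Fin 3) (y : ℝ) (ω : S) (a b : ℝ) :
    IntervalIntegrable (fun t => regTriple c K k t y ω) volume a b := by
  refine intervalIntegrable_of_abs_le (measurable_regTriple_time hc K k y ω)
    (B := K * (1 + max |a| |b|) ^ 2) fun t ht => (abs_regTriple_le c hK k t _ ω).trans ?_
  gcongr
  exact abs_le_max_of_mem_uIoc ht

theorem intervalIntegrable_regPath_time (hc : IsMeasurableField (tripleField c)) (hK : 0 ≤ K)
    (ε : ℝ) (k : Fin 3) (x : ℝ) (ω : S) (a b : ℝ) :
    IntervalIntegrable (fun t => regPath c K ε k t x ω) volume a b := by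
  have h : Measurable fun t : ℝ => ((t, x), ω) := by fun_prop
  refine intervalIntegrable_of_abs_le ((measurable_regPath hc K ε k).comp h)
    (B := 1 / √ε * (K * (1 + max |a| |b|) ^ 2 * |x|)) fun t ht =>
      (abs_regPath_le hc hK ε k t x ω).trans ?_
  gcongr
  exact abs_le_max_of_mem_uIoc ht

theorem regTriple_sub_time (hc : IsMeasurableField (tripleField c)) (hK : 0 ≤ K) (k : Fin 2)
    (s t y : ℝ) (ω : S) : regTriple c K k.castSucc t y ω - regTriple c K k.castSucc s y ω =
      ∫ r in s..t, regTriple c K k.succ r y ω := by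
  have h := intervalIntegral.integral_interval_sub_left
    (intervalIntegrable_regTriple_time hc hK k.succ y ω 0 t)
    (intervalIntegrable_regTriple_time hc hK k.succ y ω 0 s)
  rw [← h]
  fin_cases k
  · simp only [regTriple]
    change regField c K t y ω - regField c K s y ω = (∫ r in (0 : ℝ)..t, regDeriv₁ c K r y ω) -
      ∫ r in (0 : ℝ)..s, regDeriv₁ c K r y ω
    rw [regField, regField]; ring
  · change regDeriv₁ c K t y ω - regDeriv₁ c K s y ω = (∫ r in (0 : ℝ)..t, regDeriv₂ c K r y ω) -
      ∫ r in (0 : ℝ)..s, regDeriv₂ c K r y ω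
    rw [regDeriv₁, regDeriv₁]; ring

/-- The identity holds under the spatial integral for every `ω` by construction of the version, and
Fubini exchanges time and space. -/
theorem regPath_sub_time (hc : IsMeasurableField (tripleField c)) (hK : 0 ≤ K) (ε : ℝ) (k : Fin 2)
    (s t x : ℝ) (ω : S) : regPath c K ε k.castSucc t x ω - regPath c K ε k.castSucc s x ω =
      ∫ r in s..t, regPath c K ε k.succ r x ω := by
  simp only [regPath]
  rw [← mul_sub, ← intervalIntegral.integral_sub
    (intervalIntegrable_regTriple hc hK _ t ε ω _ _)
    (intervalIntegrable_regTriple hc hK _ s ε ω _ _), intervalIntegral.integral_const_mul]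
  congr 1
  simp_rw [regTriple_sub_time hc hK k s t]
  refine intervalIntegral_intervalIntegral_swap ?_
  have hm : Measurable fun p : ℝ × ℝ => ((p.2, p.1 / ε), ω) := by fun_prop
  refine Measure.integrableOn_of_bounded (M := K * (1 + max |s| |t|) ^ 2) ?_
    ((measurable_regTriple hc K k.succ).comp hm).aestronglyMeasurable ?_
  · rw [Measure.volume_eq_prod, Measure.prod_prod]
    exact ENNReal.mul_ne_top (by simp) (by simp)
  · refine ae_restrict_of_forall_mem (measurableSet_uIoc.prod measurableSet_uIoc) fun p hp => ?_
    refine (abs_regTriple_le c hK k.succ p.2 _ ω).trans ?_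
    gcongr
    exact abs_le_max_of_mem_uIoc hp.2

/-- Joint continuity combines a Lipschitz bound in space, locally uniform in time, with a primitive
in time at a fixed point. A primitive is needed in time, so only the first two components are
covered. -/
theorem continuous_regPath (hc : IsMeasurableField (tripleField c)) (hK : 0 ≤ K) (ε : ℝ)
    (k : Fin 2) (ω : S) : Continuous fun p : ℝ × ℝ => regPath c K ε k.castSucc p.1 p.2 ω := by
  rw [continuous_iff_continuousAt]
  rintro ⟨t, x⟩
  rw [ContinuousAt, tendsto_iff_dist_tendsto_zero]
  have hcont : Continuous fun b => ∫ r in t..b, regPath c K ε k.succ r x ω :=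
    intervalIntegral.continuous_primitive (intervalIntegrable_regPath_time hc hK ε k.succ x ω) t
  have hb : Continuous fun p : ℝ × ℝ => 1 / √ε * (K * (1 + |p.1|) ^ 2 * |p.2 - x|) +
      |∫ r in t..p.1, regPath c K ε k.succ r x ω| := by
    have := hcont.comp continuous_fst (X := ℝ × ℝ)
    have h2 : Continuous fun p : ℝ × ℝ => |∫ r in t..p.1, regPath c K ε k.succ r x ω| := this.abs
    fun_prop
  have hb0 := hb.tendsto (t, x)
  simp only [sub_self, abs_zero, mul_zero, intervalIntegral.integral_same, add_zero] at hb0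
  refine squeeze_zero (fun _ => dist_nonneg) (fun p => ?_) hb0
  rw [Real.dist_eq, ← regPath_sub_time hc hK]
  refine (abs_sub_le _ (regPath c K ε k.castSucc p.1 x ω) _).trans ?_
  gcongr
  exact abs_regPath_sub_le hc hK ε _ p.1 p.2 x ω

/-- The pair of rescaled integrals of the regularized fields, as a random path. -/
noncomputable def regPathMap (hc : IsMeasurableField (tripleField c)) (hK : 0 ≤ K) (ε : ℝ) (ω : S) :
    PathSpace where
  toFun p := (regPath c K ε 0 p.1 p.2 ω, regPath c K ε 1 p.1 p.2 ω)
  continuous_toFun := by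
    have h : Continuous fun p : ℝ≥0 × ℝ => ((p.1 : ℝ), p.2) := by fun_prop
    exact ((continuous_regPath hc hK ε 0 ω).comp h).prodMk ((continuous_regPath hc hK ε 1 ω).comp h)

theorem regPathMap_apply (hc : IsMeasurableField (tripleField c)) (hK : 0 ≤ K) (ε : ℝ) (ω : S)
    (t : ℝ≥0) (x : ℝ) : regPathMap hc hK ε ω (t, x) =
      (regPath c K ε 0 t x ω, regPath c K ε 1 t x ω) := rfl

theorem measurable_pathSpace_eval (p : ℝ≥0 × ℝ) : Measurable fun w : PathSpace => w p :=
  (continuous_eval_const p).measurable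

/-- A map into the path space is measurable as soon as its evaluations are. -/
theorem measurable_pathSpace_of_eval {w : S → PathSpace}
    (hw : ∀ t x, Measurable fun ω => w ω (t, x)) : Measurable w := by
  set e : PathSpace → ℕ → ℝ × ℝ := fun f n => f (TopologicalSpace.denseSeq (ℝ≥0 × ℝ) n) with he
  have hec : Continuous e := continuous_pi fun n => continuous_eval_const _
  -- An injective continuous map between these Polish spaces is a measurable embedding, so countably
  -- many evaluations generate the Borel σ-algebra.
  have hei : Function.Injective e := by
    intro f g hfg
    refine DFunLike.coe_injective (Continuous.ext_on
      (TopologicalSpace.denseRange_denseSeq (ℝ≥0 × ℝ)) f.continuous g.continuous ?_)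
    rintro _ ⟨n, rfl⟩
    exact congrFun hfg n
  rw [← (hec.measurableEmbedding hei).measurable_comp_iff]
  exact measurable_pi_iff.2 fun n => hw _ _

theorem measurable_regPathMap (hc : IsMeasurableField (tripleField c)) (hK : 0 ≤ K) (ε : ℝ) :
    Measurable (regPathMap hc hK ε) := by
  refine measurable_pathSpace_of_eval fun t x => ?_
  have h : Measurable fun ω : S => (((t : ℝ), x), ω) := by fun_prop
  exact ((measurable_regPath hc K ε 0).comp h).prodMk ((measurable_regPath hc K ε 1).comp h)

theorem IsRegularMixingField.regPath_ae_eq {P : Measure S} [SFinite P]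
    (hc : IsRegularMixingField c P K) (k : Fin 3) (ε : ℝ) (t : ℝ≥0) (x : ℝ) :
    ∀ᵐ ω ∂P, regPath c K ε k t x ω =
      scaledIntegral (fun t y ω => tripleProj k (tripleField c t y ω)) ε t x ω := by
  have hm : MeasurableSet {p : ℝ × S | regTriple c K k t (p.1 / ε) p.2 =
      tripleProj k (tripleField c t (p.1 / ε) p.2)} := by
    have h1 : Measurable fun p : ℝ × S => (((t : ℝ), p.1 / ε), p.2) := by fun_prop
    have h2 : Measurable fun p : ℝ × S => ((t, p.1 / ε), p.2) := by fun_prop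
    exact measurableSet_eq_fun ((measurable_regTriple hc.meas K k).comp h1)
      ((measurable_tripleProj k).comp (hc.meas.comp h2))
  -- The null set of `ω` depends on `y`; Fubini turns this into agreement at almost every `y` for
  -- almost every `ω`, which is enough for the integrals.
  have h := (Measure.ae_ae_comm (μ := (volume : Measure ℝ)) (ν := P) hm).1 <| .of_forall fun y => by
    simpa using hc.regTriple_ae_eq k t.coe_nonneg (y / ε)
  filter_upwards [h] with ω hω
  rw [regPath, scaledIntegral]
  congr 1
  exact intervalIntegral.integral_congr_ae (hω.mono fun y hy _ => hy)

theorem IsRegularMixingField.isPathVersion {P : Measure S} [SFinite P]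
    (hc : IsRegularMixingField c P K) (ε : ℝ) :
    IsPathVersion c P ε (regPathMap hc.meas hc.nonneg ε) := by
  refine ⟨(measurable_regPathMap _ _ ε).aemeasurable, fun t x => ?_⟩
  filter_upwards [hc.regPath_ae_eq 0 ε t x, hc.regPath_ae_eq 1 ε t x] with ω h0 h1
  rw [regPathMap_apply, h0, h1]
  rfl

/-- Continuous paths are determined by their values on a countable dense set, so the exceptional
sets can be united. -/
theorem IsPathVersion.ae_eq {P : Measure S} {ε : ℝ} {w w' : S → PathSpace}
    (hw : IsPathVersion c P ε w) (hw' : IsPathVersion c P ε w') : w =ᵐ[P] w' := by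
  have h : ∀ᵐ ω ∂P, ∀ n, w ω (TopologicalSpace.denseSeq (ℝ≥0 × ℝ) n) =
      w' ω (TopologicalSpace.denseSeq (ℝ≥0 × ℝ) n) := ae_all_iff.2 fun n => by
    filter_upwards [hw.2 _ _, hw'.2 _ _] with ω h1 h2 using h1.trans h2.symm
  filter_upwards [h] with ω hω
  refine DFunLike.coe_injective (Continuous.ext_on
    (TopologicalSpace.denseRange_denseSeq (ℝ≥0 × ℝ)) (w ω).continuous (w' ω).continuous ?_)
  rintro _ ⟨n, rfl⟩
  exact hω n

end Paths

/-! ### Dyadic chaining and interpolation -/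

section Chaining

theorem tendsto_floor_mul_two_pow_div (x : ℝ) :
    Tendsto (fun m : ℕ => (⌊x * 2 ^ m⌋ : ℝ) / 2 ^ m) atTop (𝓝 x) := by
  have h0 : Tendsto (fun m : ℕ => x - (1 / 2 : ℝ) ^ m) atTop (𝓝 (x - 0)) :=
    tendsto_const_nhds.sub (tendsto_pow_atTop_nhds_zero_of_lt_one (by norm_num) (by norm_num))
  rw [sub_zero] at h0
  refine tendsto_of_tendsto_of_tendsto_of_le_of_le h0 tendsto_const_nhds (fun m => ?_) fun m => ?_
  · have := Int.sub_one_lt_floor (x * 2 ^ m)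
    have h2 : (0 : ℝ) < 2 ^ m := by positivity
    simp only [one_div, inv_pow]
    rw [le_div_iff₀ h2, sub_mul, inv_mul_cancel₀ h2.ne']
    exact this.le
  · have h2 : (0 : ℝ) < 2 ^ m := by positivity
    rw [div_le_iff₀ h2]
    exact Int.floor_le _

theorem abs_floor_mul_two_pow_le {x : ℝ} {T : ℕ} (hx : |x| ≤ T) (m : ℕ) :
    |⌊x * 2 ^ m⌋| ≤ (T : ℤ) * 2 ^ m := by
  have h2 : (0 : ℝ) < 2 ^ m := by positivity
  rw [abs_le] at hx ⊢
  constructor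
  · rw [Int.le_floor]
    push_cast
    nlinarith [hx.1]
  · have : ((⌊x * 2 ^ m⌋ : ℤ) : ℝ) ≤ ((T : ℤ) * 2 ^ m : ℤ) := by
      push_cast
      exact (Int.floor_le _).trans (by gcongr; exact hx.2)
    exact_mod_cast this

variable {f : ℝ → ℝ} {M q : ℝ} {T : ℕ}

/-- Dyadic chaining: a geometric bound on the dyadic increments of a continuous function bounds its
modulus of continuity. -/
theorem abs_sub_le_of_dyadic (hf : Continuous f) (hM : 0 ≤ M) (hq0 : 0 ≤ q) (hq1 : q < 1)
    (h : ∀ (n : ℕ) (k : ℤ), |k| ≤ (T : ℤ) * 2 ^ n →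
      |f ((k + 1) / 2 ^ n) - f (k / 2 ^ n)| ≤ M * q ^ n) {x y : ℝ} (hx : |x| ≤ T) (hy : |y| ≤ T)
    (n : ℕ) (hxy : |x - y| ≤ 1 / 2 ^ n) : |f x - f y| ≤ 3 / (1 - q) * (M * q ^ n) := by
  have h1q : 0 < 1 - q := by linarith
  -- Consecutive dyadic approximations from below coincide or differ by one step of the finer level,
  -- since the next floor is `2 * k` or `2 * k + 1`. The increments then form a geometric series.
  have chain : ∀ x : ℝ, |x| ≤ T → |f (⌊x * 2 ^ n⌋ / 2 ^ n) - f x| ≤ M * q ^ n / (1 - q) := by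
    intro x hx
    refine dist_le_of_le_geometric_of_tendsto (f := fun m : ℕ => f (⌊x * 2 ^ m⌋ / 2 ^ m)) q M hq1
      (fun m => ?_) ((hf.tendsto x).comp (tendsto_floor_mul_two_pow_div x)) n
    have hle : M * q ^ (m + 1) ≤ M * q ^ m := by
      gcongr ?_ * ?_
      exact pow_le_pow_of_le_one hq0 hq1.le (Nat.le_succ m)
    refine le_trans ?_ hle
    rw [dist_comm, Real.dist_eq]
    set k := ⌊x * 2 ^ m⌋ with hk
    have e : (k : ℝ) / 2 ^ m = (2 * k : ℤ) / 2 ^ (m + 1) := by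
      push_cast; rw [pow_succ]; field_simp
    have hk1 : 2 * k ≤ ⌊x * 2 ^ (m + 1)⌋ := by
      rw [Int.le_floor]; push_cast
      rw [pow_succ]; nlinarith [Int.floor_le (x * 2 ^ m)]
    have hk2 : ⌊x * 2 ^ (m + 1)⌋ < 2 * k + 2 := by
      rw [Int.floor_lt]; push_cast
      rw [pow_succ]; nlinarith [Int.lt_floor_add_one (x * 2 ^ m)]
    rw [e]
    rcases hk1.eq_or_lt with h3 | h3
    · rw [← h3, sub_self, abs_zero]; positivity
    · have h4 : ⌊x * 2 ^ (m + 1)⌋ = 2 * k + 1 := by lia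
      rw [h4]
      have h5 := h (m + 1) (2 * k) (by
        have := abs_floor_mul_two_pow_le hx m
        rw [abs_mul, pow_succ, abs_two]
        linarith)
      push_cast at h5 ⊢
      exact h5
  have h2 : (0 : ℝ) < 2 ^ n := by positivity
  -- Points at distance at most `1 / 2 ^ n` have level-`n` floors differing by at most one, so a
  -- single dyadic increment links them.
  have mid : ∀ x y : ℝ, |x| ≤ T → x ≤ y → |x - y| ≤ 1 / 2 ^ n →
      |f (⌊y * 2 ^ n⌋ / 2 ^ n) - f (⌊x * 2 ^ n⌋ / 2 ^ n)| ≤ M * q ^ n := by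
    intro x y hx hle hxy
    have h1 : ⌊x * 2 ^ n⌋ ≤ ⌊y * 2 ^ n⌋ := Int.floor_le_floor (by gcongr)
    have h2 : ⌊y * 2 ^ n⌋ ≤ ⌊x * 2 ^ n⌋ + 1 := by
      rw [← Int.floor_add_one]
      refine Int.floor_le_floor ?_
      rw [abs_sub_comm, abs_of_nonneg (by linarith), le_div_iff₀ h2] at hxy
      linarith
    rcases h1.eq_or_lt with h3 | h3
    · rw [h3, sub_self, abs_zero]; positivity
    · have h4 : ⌊y * 2 ^ n⌋ = ⌊x * 2 ^ n⌋ + 1 := le_antisymm h2 h3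
      rw [h4]
      push_cast
      exact h n _ (abs_floor_mul_two_pow_le hx n)
  have hmid : |f (⌊y * 2 ^ n⌋ / 2 ^ n) - f (⌊x * 2 ^ n⌋ / 2 ^ n)| ≤ M * q ^ n := by
    rcases le_total x y with hle | hle
    · exact mid x y hx hle hxy
    · rw [abs_sub_comm]; exact mid y x hy hle (by rwa [abs_sub_comm])
  have hx' := chain x hx
  have hy' := chain y hy
  have hq : M * q ^ n ≤ M * q ^ n / (1 - q) :=
    le_div_self (by positivity) h1q (by linarith)
  have e : 3 / (1 - q) * (M * q ^ n) = M * q ^ n / (1 - q) + M * q ^ n / (1 - q) +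
      M * q ^ n / (1 - q) := by ring
  rw [e]
  rw [abs_le] at *
  constructor <;> linarith [hx'.1, hx'.2, hy'.1, hy'.2, hmid.1, hmid.2]

/-- The point `0` is joined to `x` by `T` equal steps of length at most `1`, each controlled by the
modulus at level zero. -/
theorem abs_le_of_dyadic (hf : Continuous f) (hf0 : f 0 = 0) (hM : 0 ≤ M) (hq0 : 0 ≤ q)
    (hq1 : q < 1) (h : ∀ (n : ℕ) (k : ℤ), |k| ≤ (T : ℤ) * 2 ^ n →
      |f ((k + 1) / 2 ^ n) - f (k / 2 ^ n)| ≤ M * q ^ n) {x : ℝ} (hx : |x| ≤ T) :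
    |f x| ≤ T * (3 / (1 - q) * M) := by
  rcases Nat.eq_zero_or_pos T with rfl | hT
  · have : x = 0 := by simpa using hx
    simp [this, hf0]
  have hT' : (0 : ℝ) < T := by exact_mod_cast hT
  have hxT : |x / T| ≤ 1 := by rw [abs_div, abs_of_pos hT']; exact (div_le_one hT').2 hx
  have key : ∀ j : ℕ, j ≤ T → |f (j * (x / T))| ≤ j * (3 / (1 - q) * M) := by
    intro j
    induction j with
    | zero => intro _; simp [hf0]
    | succ j ih =>
      intro hj
      have hb : ∀ i : ℕ, i ≤ T → |(i : ℝ) * (x / T)| ≤ T := by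
        intro i hi
        have hi' : (i : ℝ) ≤ T := by exact_mod_cast hi
        rw [abs_mul, Nat.abs_cast]
        nlinarith [abs_nonneg (x / T)]
      have h1 := abs_sub_le_of_dyadic hf hM hq0 hq1 h (hb (j + 1) hj) (hb j (by lia)) 0 (by
        push_cast
        rw [← sub_mul]
        simpa using hxT)
      have h2 := ih (by lia)
      have h3 := abs_sub_abs_le_abs_sub (f ((j + 1 : ℕ) * (x / T))) (f (j * (x / T)))
      simp only [pow_zero, mul_one] at h1
      push_cast at h1 h3 ⊢
      linarith
  have := key T le_rfl
  rwa [mul_div_cancel₀ _ hT'.ne'] at this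

theorem abs_le_add_pow_four_div (h : ℝ) {θ : ℝ} (hθ : 0 < θ) : |h| ≤ θ + h ^ 4 / θ ^ 3 := by
  rcases le_total |h| θ with h1 | h1
  · have : 0 ≤ h ^ 4 / θ ^ 3 := by positivity
    linarith
  · have : |h| ≤ h ^ 4 / θ ^ 3 := by
      rw [le_div_iff₀ (by positivity), ← Even.pow_abs (by decide : Even 4) h]
      calc |h| * θ ^ 3 ≤ |h| * |h| ^ 3 := by gcongr
        _ = |h| ^ 4 := by ring
    linarith

/-- The integrand is bounded by the height `l * a` plus `h ^ 4 / (l * a) ^ 3`. The free parameter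
`l` turns fourth power integrability in time into smallness on short intervals: take `l` large with
`(t - s) * l` still small. -/
theorem abs_integral_le_of_integral_pow_four_le {h : ℝ → ℝ} {T a l s t : ℝ}
    (hh : IntervalIntegrable h volume 0 T)
    (hh4 : IntervalIntegrable (fun r => h r ^ 4) volume 0 T) (ha : 0 < a) (hl : 0 < l)
    (h4 : ∫ r in (0 : ℝ)..T, h r ^ 4 ≤ a ^ 4) (hs : 0 ≤ s) (hst : s ≤ t) (htT : t ≤ T) :
    |∫ r in s..t, h r| ≤ ((t - s) * l + 1 / l ^ 3) * a := by
  have hsub : uIcc s t ⊆ uIcc 0 T := by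
    rw [uIcc_of_le hst, uIcc_of_le (by linarith)]
    exact Icc_subset_Icc hs htT
  have hh' := hh.mono_set hsub
  have hh4' := hh4.mono_set hsub
  have hi : IntervalIntegrable (fun r => l * a + h r ^ 4 / (l * a) ^ 3) volume s t :=
    intervalIntegrable_const.add (hh4'.div_const _)
  have h1 : |∫ r in s..t, h r| ≤ ∫ r in s..t, (l * a + h r ^ 4 / (l * a) ^ 3) :=
    (intervalIntegral.abs_integral_le_integral_abs hst).trans
      (intervalIntegral.integral_mono_on hst hh'.abs hi
        fun r _ => abs_le_add_pow_four_div _ (by positivity))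
  have h2 : ∫ r in s..t, h r ^ 4 ≤ ∫ r in (0 : ℝ)..T, h r ^ 4 :=
    intervalIntegral.integral_mono_interval hs hst htT
      (.of_forall fun r => by positivity) hh4
  rw [intervalIntegral.integral_add intervalIntegrable_const (hh4'.div_const _),
    intervalIntegral.integral_const, intervalIntegral.integral_div, smul_eq_mul] at h1
  refine h1.trans ?_
  have h3 : (∫ r in s..t, h r ^ 4) / (l * a) ^ 3 ≤ a ^ 4 / (l * a) ^ 3 := by
    gcongr
    exact h2.trans h4
  have e : a ^ 4 / (l * a) ^ 3 = 1 / l ^ 3 * a := by field_simp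
  rw [e] at h3
  linarith

end Chaining

/-! ### Compact sets of paths from moduli of continuity -/

section Compactness

/-- The compact rectangle `[0, T] × [-T, T]`. -/
def pathBox (T : ℕ) : Set (ℝ≥0 × ℝ) := {p | p.1 ≤ T ∧ |p.2| ≤ T}

theorem exists_nat_pathBox_mem_nhds (p : ℝ≥0 × ℝ) : ∃ T : ℕ, pathBox T ∈ 𝓝 p := by
  obtain ⟨T, hT⟩ := exists_nat_gt (max (p.1 : ℝ) |p.2|)
  have h1 : ∀ᶠ z in 𝓝 p, z.1 < (T : ℝ≥0) :=
    continuous_fst.continuousAt.eventually_lt continuousAt_const (by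
      have := (le_max_left _ _).trans_lt hT
      exact_mod_cast this)
  have h2 : ∀ᶠ z in 𝓝 p, |z.2| < (T : ℝ) :=
    continuous_snd.abs.continuousAt.eventually_lt continuousAt_const
      ((le_max_right _ _).trans_lt hT)
  refine ⟨T, ?_⟩
  filter_upwards [h1, h2] with z hz1 hz2 using ⟨hz1.le, hz2.le⟩

/-- The paths are bounded by `M` on the rectangle `[0, T] × [-T, T]`, with a modulus of continuity
proportional to `M`. -/
def IsModulatedOn (T : ℕ) (M : ℝ) (w : ℝ≥0 × ℝ → ℝ × ℝ) : Prop :=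
  (∀ p ∈ pathBox T, ‖w p‖ ≤ M) ∧ ∀ n : ℕ, ∀ p ∈ pathBox T, ∀ p' ∈ pathBox T,
    dist p p' ≤ (1 / 16) ^ n → dist (w p) (w p') ≤ M * (9 / 10) ^ n

theorem isClosed_isModulatedOn (T : ℕ) (M : ℝ) : IsClosed {w | IsModulatedOn T M w} := by
  have h1 : IsClosed {w : ℝ≥0 × ℝ → ℝ × ℝ | ∀ p ∈ pathBox T, ‖w p‖ ≤ M} := by
    simp only [Set.ofPred_forall]
    exact isClosed_biInter fun p _ => isClosed_le (continuous_apply p).norm continuous_const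
  have h2 : IsClosed {w : ℝ≥0 × ℝ → ℝ × ℝ | ∀ n : ℕ, ∀ p ∈ pathBox T, ∀ p' ∈ pathBox T,
      dist p p' ≤ (1 / 16) ^ n → dist (w p) (w p') ≤ M * (9 / 10) ^ n} := by
    simp only [Set.ofPred_forall]
    exact isClosed_iInter fun n => isClosed_biInter fun p _ => isClosed_biInter fun p' _ =>
      isClosed_iInter fun _ => isClosed_le ((continuous_apply p).dist (continuous_apply p'))
        continuous_const
  exact h1.inter h2

/-- A family of paths with a common modulus of continuity on each rectangle is equicontinuous. -/
theorem equicontinuous_isModulatedOn (M : ℕ → ℝ) :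
    Equicontinuous ((↑) : {w : ℝ≥0 × ℝ → ℝ × ℝ | ∀ T, IsModulatedOn T (M T) w} →
      ℝ≥0 × ℝ → ℝ × ℝ) := by
  intro p
  obtain ⟨T, hT⟩ := exists_nat_pathBox_mem_nhds p
  rw [Metric.equicontinuousAt_iff_right]
  intro η hη
  have hlim : Tendsto (fun n : ℕ => M T * (9 / 10 : ℝ) ^ n) atTop (𝓝 (M T * 0)) :=
    (tendsto_pow_atTop_nhds_zero_of_lt_one (by norm_num) (by norm_num)).const_mul _
  rw [mul_zero] at hlim
  obtain ⟨n, hn⟩ := (hlim.eventually_lt_const hη).exists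
  filter_upwards [hT, Metric.ball_mem_nhds p (show (0 : ℝ) < (1 / 16) ^ n by positivity)]
    with z hz hzp w
  refine ((w.2 T).2 n p (mem_of_mem_nhds hT) z hz ?_).trans_lt hn
  rw [dist_comm]
  exact (Metric.mem_ball.1 hzp).le

/-- Arzelà–Ascoli: equicontinuity makes pointwise limits continuous, so the set is closed in the
product topology, where it lies in a product of compact balls. -/
theorem isCompact_isModulatedOn (M : ℕ → ℝ) :
    IsCompact {w : PathSpace | ∀ T, IsModulatedOn T (M T) w} := by
  have himg : ContinuousMap.toFun '' {w : PathSpace | ∀ T, IsModulatedOn T (M T) w} =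
      {w : ℝ≥0 × ℝ → ℝ × ℝ | ∀ T, IsModulatedOn T (M T) w} := by
    ext w
    constructor
    · rintro ⟨w, hw, rfl⟩; exact hw
    · intro hw
      exact ⟨⟨w, (equicontinuous_isModulatedOn M).continuous ⟨w, hw⟩⟩, hw, rfl⟩
  refine ArzelaAscoli.isCompact_of_equicontinuous _ ?_ ?_
  · rw [himg]
    choose T hT using exists_nat_pathBox_mem_nhds
    have hcl : IsClosed {w : ℝ≥0 × ℝ → ℝ × ℝ | ∀ T, IsModulatedOn T (M T) w} := by
      simp only [Set.ofPred_forall]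
      exact isClosed_iInter fun T => isClosed_isModulatedOn T (M T)
    refine (isCompact_univ_pi fun p => isCompact_closedBall (0 : ℝ × ℝ) (M (T p))).of_isClosed_subset
      hcl fun w hw p _ => ?_
    rw [mem_closedBall_zero_iff]
    exact (hw (T p)).1 p (mem_of_mem_nhds (hT p))
  · intro p U hU
    filter_upwards [equicontinuous_isModulatedOn M p U hU] with z hz w using hz ⟨w, w.2⟩

theorem measurableSet_isModulatedOn (T : ℕ) (M : ℝ) :
    MeasurableSet {w : PathSpace | IsModulatedOn T M w} := by
  have h : Continuous fun w : PathSpace => (w : ℝ≥0 × ℝ → ℝ × ℝ) :=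
    continuous_pi fun p => continuous_eval_const p
  exact ((isClosed_isModulatedOn T M).preimage h).measurableSet

end Compactness

/-! ### A space-time modulus from dyadic spatial increments -/

section Modulus

/-- Bounds on the dyadic increments of the space-time fields `U 0`, `U 1 = ∂ₜ (U 0)` at time zero
and of `U 2 = ∂ₜ (U 1)` in the mean give a modulus of continuity of `(U 0, U 1)`. -/
theorem isModulatedOn_of_dyadic {U : Fin 3 → ℝ → ℝ → ℝ} (hcont : ∀ k t, Continuous (U k t))
    (h0 : ∀ k t, U k t 0 = 0) (hint : ∀ (k : Fin 3) x a b,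
      IntervalIntegrable (fun r => U k r x) volume a b)
    (hint4 : ∀ x y a b, IntervalIntegrable (fun r => (U 2 r x - U 2 r y) ^ 4) volume a b)
    (hd : ∀ (k : Fin 2) s t x, U k.castSucc t x - U k.castSucc s x = ∫ r in s..t, U k.succ r x)
    {T : ℕ} {M : ℝ} (hM : 0 < M) (hdy : ∀ (n : ℕ) (k : ℤ), |k| ≤ (T : ℤ) * 2 ^ n →
      (U 0 0 ((k + 1) / 2 ^ n) - U 0 0 (k / 2 ^ n)) ^ 4 +
      (U 1 0 ((k + 1) / 2 ^ n) - U 1 0 (k / 2 ^ n)) ^ 4 +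
      ∫ r in (0 : ℝ)..T, (U 2 r ((k + 1) / 2 ^ n) - U 2 r (k / 2 ^ n)) ^ 4 ≤
        (M * (9 / 10) ^ n) ^ 4) :
    IsModulatedOn T (60 * (T + 2) ^ 3 * M) (fun p => (U 0 p.1 p.2, U 1 p.1 p.2)) := by
  have hT : (0 : ℝ) ≤ T := Nat.cast_nonneg T
  have pow4 : ∀ {a b : ℝ}, 0 ≤ b → a ^ 4 ≤ b ^ 4 → |a| ≤ b := fun {a b} hb h =>
    le_of_pow_le_pow_left₀ (n := 4) (by norm_num) hb (by rwa [Even.pow_abs (by decide : Even 4)])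
  have hI : ∀ (n : ℕ) (k : ℤ), 0 ≤ ∫ r in (0 : ℝ)..T,
      (U 2 r ((k + 1) / 2 ^ n) - U 2 r (k / 2 ^ n)) ^ 4 := fun n k =>
    intervalIntegral.integral_nonneg hT fun r _ => by positivity
  have hb : ∀ n : ℕ, 0 < M * (9 / 10) ^ n := fun n => by positivity
  have hinc2 : ∀ (n : ℕ) (k : ℤ), |k| ≤ (T : ℤ) * 2 ^ n → ∀ l s t : ℝ, 0 < l → 0 ≤ s → s ≤ t →
      t ≤ T → |∫ r in s..t, (U 2 r ((k + 1) / 2 ^ n) - U 2 r (k / 2 ^ n))| ≤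
        ((t - s) * l + 1 / l ^ 3) * (M * (9 / 10) ^ n) := by
    intro n k hk l s t hl hs hst htT
    refine abs_integral_le_of_integral_pow_four_le ((hint 2 _ 0 T).sub (hint 2 _ 0 T))
      (hint4 _ _ 0 T) (hb n) hl ?_ hs hst htT
    refine le_trans ?_ (hdy n k hk)
    have : 0 ≤ (U 0 0 ((k + 1) / 2 ^ n) - U 0 0 (k / 2 ^ n)) ^ 4 +
      (U 1 0 ((k + 1) / 2 ^ n) - U 1 0 (k / 2 ^ n)) ^ 4 := by positivity
    linarith
  have hsub : ∀ (k : Fin 2) s t x y, (U k.castSucc t x - U k.castSucc t y) =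
      (U k.castSucc s x - U k.castSucc s y) + ∫ r in s..t, (U k.succ r x - U k.succ r y) := by
    intro k s t x y
    rw [intervalIntegral.integral_sub (hint _ _ _ _) (hint _ _ _ _), ← hd, ← hd]
    ring
  -- Increments at time `t` are those at time zero plus a time integral of increments of the next
  -- derivative. With `l = 1` this costs the factor `T + 2`.
  have hinc1 : ∀ t : ℝ, 0 ≤ t → t ≤ T → ∀ (n : ℕ) (k : ℤ), |k| ≤ (T : ℤ) * 2 ^ n →
      |U 1 t ((k + 1) / 2 ^ n) - U 1 t (k / 2 ^ n)| ≤ (T + 2) * (M * (9 / 10) ^ n) := by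
    intro t ht htT n k hk
    have e := hsub 1 0 t ((k + 1) / 2 ^ n) (k / 2 ^ n)
    change U 1 t _ - U 1 t _ = (U 1 0 _ - U 1 0 _) + ∫ r in (0 : ℝ)..t, (U 2 r _ - U 2 r _) at e
    rw [e]
    have h1 : |U 1 0 ((k + 1) / 2 ^ n) - U 1 0 (k / 2 ^ n)| ≤ M * (9 / 10) ^ n := by
      refine pow4 (hb n).le (le_trans ?_ (hdy n k hk))
      have : 0 ≤ (U 0 0 ((k + 1) / 2 ^ n) - U 0 0 (k / 2 ^ n)) ^ 4 := by positivity
      linarith [hI n k]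
    have h2 := hinc2 n k hk 1 0 t one_pos le_rfl ht htT
    have h3 : (t - 0) * 1 + 1 / 1 ^ 3 ≤ (T : ℝ) + 1 := by linarith
    have h4 := mul_le_mul_of_nonneg_right h3 (hb n).le
    refine (abs_add_le _ _).trans ?_
    linarith
  have hinc0 : ∀ t : ℝ, 0 ≤ t → t ≤ T → ∀ (n : ℕ) (k : ℤ), |k| ≤ (T : ℤ) * 2 ^ n →
      |U 0 t ((k + 1) / 2 ^ n) - U 0 t (k / 2 ^ n)| ≤ (T + 2) ^ 2 * M * (9 / 10) ^ n := by
    intro t ht htT n k hk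
    have e := hsub 0 0 t ((k + 1) / 2 ^ n) (k / 2 ^ n)
    change U 0 t _ - U 0 t _ = (U 0 0 _ - U 0 0 _) + ∫ r in (0 : ℝ)..t, (U 1 r _ - U 1 r _) at e
    rw [e]
    have h1 : |U 0 0 ((k + 1) / 2 ^ n) - U 0 0 (k / 2 ^ n)| ≤ M * (9 / 10) ^ n := by
      refine pow4 (hb n).le (le_trans ?_ (hdy n k hk))
      have : 0 ≤ (U 1 0 ((k + 1) / 2 ^ n) - U 1 0 (k / 2 ^ n)) ^ 4 := by positivity
      linarith [hI n k]
    have h2 : ‖∫ r in (0 : ℝ)..t, (U 1 r ((k + 1) / 2 ^ n) - U 1 r (k / 2 ^ n))‖ ≤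
        (T + 2) * (M * (9 / 10) ^ n) * |t - 0| := by
      refine intervalIntegral.norm_integral_le_of_norm_le_const fun r hr => ?_
      rw [uIoc_of_le ht] at hr
      exact hinc1 r hr.1.le (hr.2.trans htT) n k hk
    rw [sub_zero, abs_of_nonneg ht, Real.norm_eq_abs] at h2
    have h3 : (T + 2) * (M * (9 / 10) ^ n) * t ≤ (T + 2) * (M * (9 / 10) ^ n) * T := by
      have := hb n
      gcongr
    refine (abs_add_le _ _).trans ?_
    nlinarith [hb n, mul_nonneg hT (hb n).le]
  have hinc1' : ∀ t : ℝ, 0 ≤ t → t ≤ T → ∀ (n : ℕ) (k : ℤ), |k| ≤ (T : ℤ) * 2 ^ n →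
      |U 1 t ((k + 1) / 2 ^ n) - U 1 t (k / 2 ^ n)| ≤ (T + 2) ^ 2 * M * (9 / 10) ^ n := by
    intro t ht htT n k hk
    refine (hinc1 t ht htT n k hk).trans ?_
    nlinarith [hb n, mul_nonneg hT (hb n).le, mul_nonneg hT (mul_nonneg hT (hb n).le)]
  set A : ℝ := (T + 2) ^ 2 * M with hA
  have hA0 : 0 < A := by positivity
  have hbound : ∀ t : ℝ, 0 ≤ t → t ≤ T → ∀ x : ℝ, |x| ≤ T →
      |U 0 t x| ≤ T * (30 * A) ∧ |U 1 t x| ≤ T * (30 * A) := by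
    intro t ht htT x hx
    have e : 3 / (1 - 9 / 10 : ℝ) = 30 := by norm_num
    have h1 := abs_le_of_dyadic (hcont 0 t) (h0 0 t) hA0.le (by norm_num) (by norm_num)
      (hinc0 t ht htT) hx
    have h2 := abs_le_of_dyadic (hcont 1 t) (h0 1 t) hA0.le (by norm_num) (by norm_num)
      (hinc1' t ht htT) hx
    rw [e] at h1 h2
    exact ⟨h1, h2⟩
  have hspace : ∀ t : ℝ, 0 ≤ t → t ≤ T → ∀ x y : ℝ, |x| ≤ T → |y| ≤ T → ∀ n : ℕ,
      |x - y| ≤ 1 / 2 ^ n → |U 0 t x - U 0 t y| ≤ 30 * (A * (9 / 10) ^ n) ∧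
        |U 1 t x - U 1 t y| ≤ 30 * (A * (9 / 10) ^ n) := by
    intro t ht htT x y hx hy n hxy
    have e : 3 / (1 - 9 / 10 : ℝ) = 30 := by norm_num
    have h1 := abs_sub_le_of_dyadic (hcont 0 t) hA0.le (by norm_num) (by norm_num)
      (hinc0 t ht htT) hx hy n hxy
    have h2 := abs_sub_le_of_dyadic (hcont 1 t) hA0.le (by norm_num) (by norm_num)
      (hinc1' t ht htT) hx hy n hxy
    rw [e] at h1 h2
    exact ⟨h1, h2⟩
  have htime : ∀ s t : ℝ, 0 ≤ s → s ≤ t → t ≤ T → ∀ x : ℝ, |x| ≤ T → ∀ n : ℕ,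
      t - s ≤ (1 / 16) ^ n → |U 0 t x - U 0 s x| ≤ T * (30 * A) * (9 / 10) ^ n ∧
        |U 1 t x - U 1 s x| ≤ 60 * T * M * (9 / 10) ^ n := by
    intro s t hs hst htT x hx n hn
    constructor
    · have e := hd 0 s t x
      change U 0 t x - U 0 s x = ∫ r in s..t, U 1 r x at e
      have h2 : ‖∫ r in s..t, U 1 r x‖ ≤ T * (30 * A) * |t - s| := by
        refine intervalIntegral.norm_integral_le_of_norm_le_const fun r hr => ?_
        rw [uIoc_of_le hst] at hr
        exact (hbound r (hs.trans hr.1.le) (hr.2.trans htT) x hx).2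
      rw [e]
      refine h2.trans ?_
      rw [abs_of_nonneg (by linarith)]
      gcongr
      exact hn.trans (pow_le_pow_left₀ (by norm_num) (by norm_num) n)
    -- No pointwise bound on `U 2` is available, so the time increment of `U 1` is treated as a
    -- function of `x` and chained in space. With `l = 2 ^ n` and `t - s ≤ (1 / 16) ^ n`, both
    -- interpolation terms are at most `(1 / 8) ^ n`.
    · have hdy' : ∀ (m : ℕ) (k : ℤ), |k| ≤ (T : ℤ) * 2 ^ m →
          |(U 1 t ((k + 1) / 2 ^ m) - U 1 s ((k + 1) / 2 ^ m)) -
            (U 1 t (k / 2 ^ m) - U 1 s (k / 2 ^ m))| ≤ 2 * (1 / 8) ^ n * M * (9 / 10) ^ m := by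
        intro m k hk
        have e := hsub 1 s t ((k + 1) / 2 ^ m) (k / 2 ^ m)
        change U 1 t _ - U 1 t _ = (U 1 s _ - U 1 s _) + ∫ r in s..t, (U 2 r _ - U 2 r _) at e
        have h2 := hinc2 m k hk (2 ^ n) s t (by positivity) hs hst htT
        have e2 : (U 1 t ((k + 1) / 2 ^ m) - U 1 s ((k + 1) / 2 ^ m)) -
            (U 1 t (k / 2 ^ m) - U 1 s (k / 2 ^ m)) =
            ∫ r in s..t, (U 2 r ((k + 1) / 2 ^ m) - U 2 r (k / 2 ^ m)) := by linarith
        rw [e2]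
        refine h2.trans ?_
        have e3 : (1 / 16 : ℝ) ^ n * 2 ^ n = (1 / 8) ^ n := by
          rw [← mul_pow]; norm_num
        have e4 : 1 / ((2 : ℝ) ^ n) ^ 3 = (1 / 8) ^ n := by
          rw [← pow_mul, mul_comm, pow_mul, one_div, ← inv_pow]; norm_num
        have h5 : (t - s) * 2 ^ n ≤ (1 / 8) ^ n := by
          rw [← e3]; gcongr
        rw [e4]
        have h6 : (t - s) * 2 ^ n + (1 / 8) ^ n ≤ 2 * (1 / 8) ^ n := by linarith
        have := mul_le_mul_of_nonneg_right h6 (hb m).le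
        linarith
      have h1 := abs_le_of_dyadic (f := fun x => U 1 t x - U 1 s x)
        ((hcont 1 t).sub (hcont 1 s)) (by simp [h0]) (by positivity) (by norm_num) (by norm_num)
        hdy' hx
      have e : 3 / (1 - 9 / 10 : ℝ) = 30 := by norm_num
      rw [e] at h1
      refine h1.trans ?_
      have h2 : (1 / 8 : ℝ) ^ n ≤ (9 / 10) ^ n := pow_le_pow_left₀ (by norm_num) (by norm_num) n
      have h3 : 0 ≤ 60 * T * M := by positivity
      nlinarith [mul_le_mul_of_nonneg_left h2 h3]
  -- The move is made in space at the later time and then in time at the second point. The scale `(1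
  -- / 16) ^ n` required in time is finer than the dyadic scale required in space.
  have hfin : ∀ n : ℕ, ∀ p ∈ pathBox T, ∀ p' ∈ pathBox T, p'.1 ≤ p.1 → dist p p' ≤ (1 / 16) ^ n →
      dist (U 0 p.1 p.2, U 1 p.1 p.2) (U 0 p'.1 p'.2, U 1 p'.1 p'.2) ≤
        60 * (T + 2) ^ 3 * M * (9 / 10) ^ n := by
    intro n p hp p' hp' hle hdist
    rw [Prod.dist_eq, max_le_iff, NNReal.dist_eq, Real.dist_eq] at hdist
    have hle' : (p'.1 : ℝ) ≤ p.1 := hle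
    have hpT : (p.1 : ℝ) ≤ T := by exact_mod_cast hp.1
    have h16 : (1 / 16 : ℝ) ^ n ≤ 1 / 2 ^ n := by
      rw [one_div_pow]
      gcongr
      norm_num
    have h1 := hspace p.1 p.1.2 hpT p.2 p'.2 hp.2 hp'.2 n (hdist.2.trans h16)
    have h2 := htime p'.1 p.1 p'.1.2 hle' hpT p'.2 hp'.2 n ((le_abs_self _).trans hdist.1)
    have hq : (0 : ℝ) < (9 / 10) ^ n := by positivity
    have hMq := hb n
    rw [Prod.dist_eq, Real.dist_eq, Real.dist_eq]
    refine max_le ?_ ?_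
    · refine (abs_sub_le _ (U 0 p.1 p'.2) _).trans ((add_le_add h1.1 h2.1).trans ?_)
      rw [hA]
      nlinarith [mul_nonneg hT hMq.le, mul_nonneg hT (mul_nonneg hT hMq.le),
        mul_nonneg hT (mul_nonneg hT (mul_nonneg hT hMq.le))]
    · refine (abs_sub_le _ (U 1 p.1 p'.2) _).trans ((add_le_add h1.2 h2.2).trans ?_)
      rw [hA]
      nlinarith [mul_nonneg hT hMq.le, mul_nonneg hT (mul_nonneg hT hMq.le),
        mul_nonneg hT (mul_nonneg hT (mul_nonneg hT hMq.le))]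
  refine ⟨fun p hp => ?_, fun n p hp p' hp' hdist => ?_⟩
  · have hpT : (p.1 : ℝ) ≤ T := by exact_mod_cast hp.1
    have h := hbound p.1 p.1.2 hpT p.2 hp.2
    have hle : T * (30 * A) ≤ 60 * (T + 2) ^ 3 * M := by
      rw [hA]
      nlinarith [mul_nonneg hT hM.le, mul_nonneg hT (mul_nonneg hT hM.le),
        mul_nonneg hT (mul_nonneg hT (mul_nonneg hT hM.le))]
    exact max_le (h.1.trans hle) (h.2.trans hle)
  · rcases le_total p'.1 p.1 with hle | hle
    · exact hfin n p hp p' hp' hle hdist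
    · rw [dist_comm]
      exact hfin n p' hp' p hp hle (by rwa [dist_comm])

end Modulus

/-! ### Uniform moment bounds and tightness -/

section Tightness

variable {S : Type*} [MeasurableSpace S] {P : Measure S} [IsProbabilityMeasure P]
  {c : ℝ≥0 → ℝ → S → ℝ} {K : ℝ}

/-- The constant in the fourth moment bound for the increments of the rescaled integrals up to
time `T`. -/
noncomputable def momentConst (c : ℝ≥0 → ℝ → S → ℝ) (P : Measure S) (K T : ℝ) : ℝ :=
  48 * (K * (1 + T) ^ 2) ^ 4 * (∫ h in Ioi 0, √(phiMixing c P h)) ^ 2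

theorem momentConst_nonneg (c : ℝ≥0 → ℝ → S → ℝ) (P : Measure S) (K T : ℝ) :
    0 ≤ momentConst c P K T := by
  unfold momentConst
  have : 0 ≤ (K * (1 + T) ^ 2) ^ 4 := by positivity
  positivity

theorem IsRegularMixingField.integral_regPath_sub_pow_four_le (hc : IsRegularMixingField c P K)
    (k : Fin 3) {ε t T : ℝ} (hε : 0 < ε) (ht : 0 ≤ t) (htT : t ≤ T) (x x' : ℝ) :
    ∫ ω, (regPath c K ε k t x ω - regPath c K ε k t x' ω) ^ 4 ∂P ≤
      momentConst c P K T * (x - x') ^ 2 := by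
  wlog hx : x' ≤ x generalizing x x'
  · have h := this x' x (le_of_not_ge hx)
    have e : ∀ a b : ℝ, (a - b) ^ 4 = (b - a) ^ 4 := fun a b => by ring
    have e2 : (x - x') ^ 2 = (x' - x) ^ 2 := by ring
    simp_rw [e (regPath c K ε k t x _)]
    rwa [e2]
  simp_rw [regPath_sub hc.meas hc.nonneg, mul_pow, integral_const_mul]
  have hX := (hc.isMixingField k ht).scale ε
  have hmix := (isMixing_phiMixing hc.meas hc.mix).scale hε
  have h := hmix.integral_pow_four_le hX hx
  rw [integral_sqrt_rate_scale hε] at h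
  have e1 : (1 / √ε) ^ 4 = 1 / ε ^ 2 := by
    rw [div_pow, one_pow, show (4 : ℕ) = 2 * 2 from rfl, pow_mul, Real.sq_sqrt hε.le]
  rw [e1]
  refine (mul_le_mul_of_nonneg_left h (by positivity)).trans ?_
  rw [momentConst]
  have e2 : 1 / ε ^ 2 * (48 * (K * (1 + |t|) ^ 2) ^ 4 *
      (ε * ∫ h in Ioi 0, √(phiMixing c P h)) ^ 2 * (x - x') ^ 2) =
      48 * (K * (1 + |t|) ^ 2) ^ 4 * (∫ h in Ioi 0, √(phiMixing c P h)) ^ 2 * (x - x') ^ 2 := by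
    field_simp
  rw [e2]
  have := hc.nonneg
  rw [abs_of_nonneg ht]
  gcongr

/-- The sum of the fourth powers of a spatial increment of the rescaled integrals that controls
the paths up to time `T`. -/
noncomputable def incrementSum (c : ℝ≥0 → ℝ → S → ℝ) (K ε T x x' : ℝ) (ω : S) : ℝ :=
  (regPath c K ε 0 0 x ω - regPath c K ε 0 0 x' ω) ^ 4 +
  (regPath c K ε 1 0 x ω - regPath c K ε 1 0 x' ω) ^ 4 +
  ∫ r in (0 : ℝ)..T, (regPath c K ε 2 r x ω - regPath c K ε 2 r x' ω) ^ 4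

theorem incrementSum_nonneg {S : Type*} (c : ℝ≥0 → ℝ → S → ℝ) (K ε : ℝ) {T : ℝ} (hT : 0 ≤ T) (x x' : ℝ)
    (ω : S) : 0 ≤ incrementSum c K ε T x x' ω := by
  have : 0 ≤ ∫ r in (0 : ℝ)..T, (regPath c K ε 2 r x ω - regPath c K ε 2 r x' ω) ^ 4 :=
    intervalIntegral.integral_nonneg hT fun r _ => by positivity
  unfold incrementSum
  positivity

theorem measurable_regPath_sub (hc : IsMeasurableField (tripleField c)) (K ε : ℝ) (k : Fin 3)
    (x x' : ℝ) : Measurable fun p : ℝ × S =>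
      regPath c K ε k p.1 x p.2 - regPath c K ε k p.1 x' p.2 := by
  have h1 : Measurable fun p : ℝ × S => ((p.1, x), p.2) := by fun_prop
  have h2 : Measurable fun p : ℝ × S => ((p.1, x'), p.2) := by fun_prop
  exact ((measurable_regPath hc K ε k).comp h1).sub ((measurable_regPath hc K ε k).comp h2)

theorem abs_regPath_sub_pow_four_le (hc : IsMeasurableField (tripleField c)) (hK : 0 ≤ K) (ε : ℝ)
    (k : Fin 3) (x x' : ℝ) {t T : ℝ} (ht : |t| ≤ T) (ω : S) :
    ‖(regPath c K ε k t x ω - regPath c K ε k t x' ω) ^ 4‖ ≤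
      (1 / √ε * (K * (1 + T) ^ 2 * |x - x'|)) ^ 4 := by
  rw [norm_pow, Real.norm_eq_abs]
  gcongr
  refine (abs_regPath_sub_le hc hK ε k t x x' ω).trans ?_
  gcongr

theorem intervalIntegrable_regPath_sub_pow_four (hc : IsMeasurableField (tripleField c))
    (hK : 0 ≤ K) (ε : ℝ) (k : Fin 3) (x x' : ℝ) (ω : S) (a b : ℝ) :
    IntervalIntegrable (fun r => (regPath c K ε k r x ω - regPath c K ε k r x' ω) ^ 4)
      volume a b := by
  have h : Measurable fun r : ℝ => (r, ω) := by fun_prop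
  exact intervalIntegrable_of_abs_le (((measurable_regPath_sub hc K ε k x x').comp h).pow_const 4)
    fun r hr => abs_regPath_sub_pow_four_le hc hK ε k x x' (abs_le_max_of_mem_uIoc hr) ω

theorem integrable_regPath_sub_pow_four (hc : IsMeasurableField (tripleField c)) (hK : 0 ≤ K)
    (ε : ℝ) (k : Fin 3) (t x x' : ℝ) :
    Integrable (fun ω => (regPath c K ε k t x ω - regPath c K ε k t x' ω) ^ 4) P := by
  have h : Measurable fun ω : S => (t, ω) := by fun_prop
  exact Integrable.of_bound
    (((measurable_regPath_sub hc K ε k x x').comp h).pow_const 4).aestronglyMeasurable _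
    (.of_forall fun ω => abs_regPath_sub_pow_four_le hc hK ε k x x' le_rfl ω)

theorem integrable_prod_regPath_sub_pow_four (hc : IsMeasurableField (tripleField c)) (hK : 0 ≤ K)
    (ε : ℝ) (k : Fin 3) (T x x' : ℝ) :
    Integrable (Function.uncurry fun r ω => (regPath c K ε k r x ω - regPath c K ε k r x' ω) ^ 4)
      ((volume.restrict (uIoc 0 T)).prod P) := by
  have : IsFiniteMeasure (volume.restrict (uIoc 0 T)) := ⟨by simp⟩
  refine Integrable.of_bound
    ((measurable_regPath_sub hc K ε k x x').pow_const 4).aestronglyMeasurable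
    ((1 / √ε * (K * (1 + max |0| |T|) ^ 2 * |x - x'|)) ^ 4) ?_
  have h : ∀ᵐ r ∂volume.restrict (uIoc 0 T), ∀ ω,
      ‖(regPath c K ε k r x ω - regPath c K ε k r x' ω) ^ 4‖ ≤
        (1 / √ε * (K * (1 + max |0| |T|) ^ 2 * |x - x'|)) ^ 4 :=
    ae_restrict_of_forall_mem measurableSet_uIoc fun r hr ω =>
      abs_regPath_sub_pow_four_le hc hK ε k x x' (abs_le_max_of_mem_uIoc hr) ω
  have h2 := Measure.quasiMeasurePreserving_fst.ae (μa := (volume.restrict (uIoc 0 T)).prod P) h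
  filter_upwards [h2] with p hp using hp p.2

theorem integrable_integral_regPath_sub_pow_four (hc : IsMeasurableField (tripleField c))
    (hK : 0 ≤ K) (ε : ℝ) (k : Fin 3) (T x x' : ℝ) : Integrable (fun ω => ∫ r in (0 : ℝ)..T,
      (regPath c K ε k r x ω - regPath c K ε k r x' ω) ^ 4) P := by
  have h := (integrable_prod_regPath_sub_pow_four (P := P) hc hK ε k T x x').integral_prod_right
  simp_rw [intervalIntegral.intervalIntegral_eq_integral_uIoc, smul_eq_mul]
  exact h.const_mul _

theorem integrable_incrementSum (hc : IsMeasurableField (tripleField c)) (hK : 0 ≤ K)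
    (ε T x x' : ℝ) : Integrable (incrementSum c K ε T x x') P := by
  exact ((integrable_regPath_sub_pow_four hc hK ε 0 0 x x').add
    (integrable_regPath_sub_pow_four hc hK ε 1 0 x x')).add
      (integrable_integral_regPath_sub_pow_four hc hK ε 2 T x x')

theorem IsRegularMixingField.integral_incrementSum_le (hc : IsRegularMixingField c P K)
    {ε T : ℝ} (hε : 0 < ε) (hT : 0 ≤ T) (x x' : ℝ) :
    ∫ ω, incrementSum c K ε T x x' ω ∂P ≤ (2 + T) * momentConst c P K T * (x - x') ^ 2 := by
  have hp := integrable_prod_regPath_sub_pow_four (P := P) hc.meas hc.nonneg ε 2 T x x'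
  have h4 := integrable_integral_regPath_sub_pow_four (P := P) hc.meas hc.nonneg ε 2 T x x'
  have h0 := integrable_regPath_sub_pow_four (P := P) hc.meas hc.nonneg ε 0 0 x x'
  have h1 := integrable_regPath_sub_pow_four (P := P) hc.meas hc.nonneg ε 1 0 x x'
  have h01 : Integrable (fun ω => (regPath c K ε 0 0 x ω - regPath c K ε 0 0 x' ω) ^ 4 +
      (regPath c K ε 1 0 x ω - regPath c K ε 1 0 x' ω) ^ 4) P := h0.add h1
  simp only [incrementSum]
  -- The fourth moment bound is uniform over times in `[0, T]`, so after Fubini the time integral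
  -- contributes the factor `T`, beside `1 + 1` from the two terms at time zero.
  rw [integral_add h01 h4, integral_add h0 h1, ← intervalIntegral_integral_swap hp]
  have b0 := hc.integral_regPath_sub_pow_four_le 0 hε le_rfl hT x x'
  have b1 := hc.integral_regPath_sub_pow_four_le 1 hε le_rfl hT x x'
  have b2 : ‖∫ r in (0 : ℝ)..T, ∫ ω, (regPath c K ε 2 r x ω - regPath c K ε 2 r x' ω) ^ 4 ∂P‖ ≤
      momentConst c P K T * (x - x') ^ 2 * |T - 0| := by
    refine intervalIntegral.norm_integral_le_of_norm_le_const fun r hr => ?_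
    rw [uIoc_of_le hT] at hr
    rw [Real.norm_eq_abs, abs_of_nonneg (integral_nonneg fun ω => by positivity)]
    exact hc.integral_regPath_sub_pow_four_le 2 hε hr.1.le hr.2 x x'
  rw [sub_zero, abs_of_nonneg hT] at b2
  have := (le_abs_self _).trans b2
  linarith

theorem isModulatedOn_regPathMap (hc : IsMeasurableField (tripleField c)) (hK : 0 ≤ K) (ε : ℝ)
    {T : ℕ} {M : ℝ} (hM : 0 < M) {ω : S} (hω : ∀ (n : ℕ) (k : ℤ), |k| ≤ (T : ℤ) * 2 ^ n →
      incrementSum c K ε T ((k + 1) / 2 ^ n) (k / 2 ^ n) ω ≤ (M * (9 / 10) ^ n) ^ 4) :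
    IsModulatedOn T (60 * (T + 2) ^ 3 * M) (regPathMap hc hK ε ω) := by
  refine isModulatedOn_of_dyadic (U := fun k t x => regPath c K ε k t x ω) (fun k t => ?_)
    (fun k t => regPath_zero c K ε k t ω)
    (fun k x a b => intervalIntegrable_regPath_time hc hK ε k x ω a b)
    (fun x y a b => intervalIntegrable_regPath_sub_pow_four hc hK ε 2 x y ω a b)
    (fun k s t x => regPath_sub_time hc hK ε k s t x ω) hM hω
  exact (intervalIntegral.continuous_primitive
    (fun a b => intervalIntegrable_regTriple hc hK k t ε ω a b) 0).const_mul _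

theorem IsRegularMixingField.measureReal_incrementSum_ge_le (hc : IsRegularMixingField c P K)
    {ε T a : ℝ} (hε : 0 < ε) (hT : 0 ≤ T) (ha : 0 < a) (x x' : ℝ) :
    P {ω | a ≤ incrementSum c K ε T x x' ω} ≤
      ENNReal.ofReal ((2 + T) * momentConst c P K T * (x - x') ^ 2 / a) := by
  have h := (mul_meas_ge_le_integral_of_nonneg
    (.of_forall fun ω => incrementSum_nonneg c K ε hT x x' ω)
    (integrable_incrementSum (P := P) hc.meas hc.nonneg ε T x x') a).trans
    (hc.integral_incrementSum_le hε hT x x')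
  rw [← ofReal_measureReal]
  refine ENNReal.ofReal_le_ofReal ?_
  rw [le_div_iff₀ ha]
  linarith

theorem IsRegularMixingField.exists_isModulatedOn (hc : IsRegularMixingField c P K) (T : ℕ) {η : ℝ}
    (hη : 0 < η) : ∃ M : ℝ, ∀ ε : ℝ, 0 < ε →
      P {ω | ¬ IsModulatedOn T M (regPathMap hc.meas hc.nonneg ε ω)} ≤ ENNReal.ofReal η := by
  set C : ℝ := (2 + T) * momentConst c P K T with hC
  have hC0 : 0 ≤ C := mul_nonneg (by positivity) (momentConst_nonneg c P K T)
  -- At level `n` there are at most `(2 * T + 1) * 2 ^ n` increments, each exceeding its threshold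
  -- with probability at most `C * 4 ^ (-n) / (M * (9 / 10) ^ n) ^ 4`. The resulting series has
  -- ratio `(1 / 2) / (9 / 10) ^ 4 = 5000 / 6561`, less than one because `(9 / 10) ^ 4 > 1 / 2`.
  set D : ℝ := (2 * T + 1) * C * (1 - 5000 / 6561)⁻¹ with hD
  have hD0 : 0 ≤ D := by
    have : (0 : ℝ) ≤ (1 - 5000 / 6561)⁻¹ := by norm_num
    positivity
  -- As `M ≥ 1`, the total `D / M ^ 4` is at most `D / M`, hence at most `η`.
  set M : ℝ := 1 + D / η with hM
  have hM1 : 1 ≤ M := by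
    have : 0 ≤ D / η := by positivity
    linarith
  have hM0 : 0 < M := by linarith
  refine ⟨60 * (T + 2) ^ 3 * M, fun ε hε => ?_⟩
  have hsub : {ω | ¬ IsModulatedOn T (60 * (T + 2) ^ 3 * M) (regPathMap hc.meas hc.nonneg ε ω)} ⊆
      ⋃ n : ℕ, ⋃ k ∈ Finset.Icc (-((T : ℤ) * 2 ^ n)) ((T : ℤ) * 2 ^ n),
        {ω | (M * (9 / 10) ^ n) ^ 4 ≤ incrementSum c K ε T ((k + 1) / 2 ^ n) (k / 2 ^ n) ω} := by
    intro ω hω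
    by_contra hcon
    refine hω (isModulatedOn_regPathMap hc.meas hc.nonneg ε hM0 fun n k hk => ?_)
    by_contra hlt
    exact hcon (mem_iUnion.2 ⟨n, mem_iUnion₂.2 ⟨k, Finset.mem_Icc.2 (abs_le.1 hk),
      (le_of_not_ge hlt)⟩⟩)
  have hterm : ∀ n : ℕ, P (⋃ k ∈ Finset.Icc (-((T : ℤ) * 2 ^ n)) ((T : ℤ) * 2 ^ n),
      {ω | (M * (9 / 10) ^ n) ^ 4 ≤ incrementSum c K ε T ((k + 1) / 2 ^ n) (k / 2 ^ n) ω}) ≤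
      ENNReal.ofReal ((2 * T + 1) * C / M ^ 4 * (5000 / 6561) ^ n) := by
    intro n
    refine (measure_biUnion_finset_le _ _).trans ?_
    have hb : ∀ k ∈ Finset.Icc (-((T : ℤ) * 2 ^ n)) ((T : ℤ) * 2 ^ n),
        P {ω | (M * (9 / 10) ^ n) ^ 4 ≤ incrementSum c K ε T ((k + 1) / 2 ^ n) (k / 2 ^ n) ω} ≤
        ENNReal.ofReal (C * (1 / 2 ^ n) ^ 2 / (M * (9 / 10) ^ n) ^ 4) := by
      intro k _
      have h := hc.measureReal_incrementSum_ge_le hε (Nat.cast_nonneg T)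
        (show 0 < (M * (9 / 10) ^ n) ^ 4 by positivity) ((k + 1) / 2 ^ n) (k / 2 ^ n)
      have e : ((k : ℝ) + 1) / 2 ^ n - k / 2 ^ n = 1 / 2 ^ n := by ring
      rwa [e] at h
    refine (Finset.sum_le_sum hb).trans ?_
    rw [Finset.sum_const, ← ENNReal.ofReal_nsmul, nsmul_eq_mul]
    refine ENNReal.ofReal_le_ofReal ?_
    have hcard : ((Finset.Icc (-((T : ℤ) * 2 ^ n)) ((T : ℤ) * 2 ^ n)).card : ℝ) ≤
        (2 * T + 1) * 2 ^ n := by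
      have e : ((Finset.Icc (-((T : ℤ) * 2 ^ n)) ((T : ℤ) * 2 ^ n)).card : ℤ) =
          2 * (T * 2 ^ n) + 1 := by
        rw [Int.card_Icc, Int.toNat_of_nonneg (by linarith [show (0 : ℤ) ≤ T * 2 ^ n by positivity])]
        ring
      have e2 : ((Finset.Icc (-((T : ℤ) * 2 ^ n)) ((T : ℤ) * 2 ^ n)).card : ℝ) =
          2 * (T * 2 ^ n) + 1 := by exact_mod_cast e
      rw [e2]
      have : (1 : ℝ) ≤ 2 ^ n := one_le_pow₀ (by norm_num)
      linarith
    refine (mul_le_mul_of_nonneg_right hcard (by positivity)).trans (le_of_eq ?_)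
    have e5 : (5000 / 6561 : ℝ) ^ n * ((9 / 10) ^ n) ^ 4 * 2 ^ n = 1 := by
      rw [← pow_mul, mul_comm n 4, pow_mul, ← mul_pow, ← mul_pow]; norm_num
    have hq : ((9 / 10 : ℝ) ^ n) ^ 4 ≠ 0 := by positivity
    have h2 : (2 : ℝ) ^ n ≠ 0 := by positivity
    have e6 : (5000 / 6561 : ℝ) ^ n = 1 / (((9 / 10) ^ n) ^ 4 * 2 ^ n) := by
      rw [eq_div_iff (mul_ne_zero hq h2), ← e5]; ring
    rw [e6, mul_pow]
    field_simp
  refine (measure_mono hsub).trans ((measure_iUnion_le _).trans ((ENNReal.tsum_le_tsum hterm).trans ?_))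
  have hsum : HasSum (fun n : ℕ => (2 * T + 1) * C / M ^ 4 * (5000 / 6561 : ℝ) ^ n)
      ((2 * T + 1) * C / M ^ 4 * (1 - 5000 / 6561)⁻¹) :=
    (hasSum_geometric_of_lt_one (by norm_num) (by norm_num)).mul_left _
  rw [← ENNReal.ofReal_tsum_of_nonneg (fun n => by positivity) hsum.summable, hsum.tsum_eq]
  refine ENNReal.ofReal_le_ofReal ?_
  have e : (2 * T + 1) * C / M ^ 4 * (1 - 5000 / 6561)⁻¹ = D / M ^ 4 := by rw [hD]; ring
  rw [e, div_le_iff₀ (by positivity)]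
  have h1 : M ≤ M ^ 4 := le_self_pow₀ hM1 (by norm_num)
  have h2 : D ≤ η * M := by
    rw [hM, mul_add, mul_div_cancel₀ _ hη.ne']; linarith
  exact h2.trans (by gcongr)

/-- The laws of the rescaled paths are uniformly tight. -/
theorem IsRegularMixingField.isTightMeasureSet (hc : IsRegularMixingField c P K) :
    IsTightMeasureSet (range fun ε : Ioi (0 : ℝ) =>
      P.map (regPathMap hc.meas hc.nonneg (ε : ℝ))) := by
  rw [isTightMeasureSet_iff_exists_isCompact_measure_compl_le]
  intro η hη
  -- One rectangle is handled for each `T`, with failure probabilities summing to less than `η`.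
  obtain ⟨δ, hδ, hδη⟩ := ENNReal.exists_pos_sum_of_countable hη.ne' ℕ
  choose M hM using fun T => hc.exists_isModulatedOn T (NNReal.coe_pos.2 (hδ T))
  refine ⟨_, isCompact_isModulatedOn M, ?_⟩
  rintro _ ⟨ε, rfl⟩
  have e : {w : PathSpace | ∀ T, IsModulatedOn T (M T) w}ᶜ =
      ⋃ T, {w : PathSpace | IsModulatedOn T (M T) w}ᶜ := by
    rw [← compl_iInter, ← Set.ofPred_forall]
  rw [e]
  refine (measure_iUnion_le _).trans (le_trans (ENNReal.tsum_le_tsum fun T => ?_) hδη.le)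
  rw [Measure.map_apply (measurable_regPathMap _ _ _) (measurableSet_isModulatedOn T (M T)).compl]
  have h := hM T ε ε.2
  rwa [ENNReal.ofReal_coe_nnreal] at h

end Tightness

/-! ### Oriented intervals as weights -/

section StepWeight

/-- The signed indicator of the interval between `0` and `x`: the weight of `∫ y in 0..x`. -/
noncomputable def stepWeight (x : ℝ) (y : ℝ) : ℝ :=
  (Ioc 0 x).indicator 1 y - (Ioc x 0).indicator 1 y

theorem stepWeight_of_nonneg {x : ℝ} (hx : 0 ≤ x) : stepWeight x = (Ioc 0 x).indicator 1 := by
  ext y; simp [stepWeight, Ioc_eq_empty_of_le hx]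

theorem stepWeight_of_nonpos {x : ℝ} (hx : x ≤ 0) :
    stepWeight x = fun y => -(Ioc x 0).indicator 1 y := by
  ext y; simp [stepWeight, Ioc_eq_empty_of_le hx]

theorem measurable_stepWeight (x : ℝ) : Measurable (stepWeight x) :=
  (measurable_one.indicator measurableSet_Ioc).sub (measurable_one.indicator measurableSet_Ioc)

theorem abs_stepWeight_le (x y : ℝ) : |stepWeight x y| ≤ 1 := by
  rcases le_total 0 x with hx | hx
  · rw [stepWeight_of_nonneg hx]
    by_cases h : y ∈ Ioc 0 x <;> simp [h]
  · rw [stepWeight_of_nonpos hx, abs_neg]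
    by_cases h : y ∈ Ioc x 0 <;> simp [h]

theorem ae_continuousAt_stepWeight (x : ℝ) : ∀ᵐ y, ContinuousAt (stepWeight x) y := by
  have h : ∀ᵐ y : ℝ, ContinuousAt (1 : ℝ → ℝ) y := .of_forall fun y => continuousAt_const
  filter_upwards [ae_continuousAt_indicator_Ioc h 0 x, ae_continuousAt_indicator_Ioc h x 0]
    with y h1 h2 using h1.sub h2

theorem integral_indicator_Ioc_mul {p q a b : ℝ} (ha : a ≤ p) (hpq : p ≤ q) (hb : q ≤ b)
    (g : ℝ → ℝ) :
    ∫ y in a..b, (Ioc p q).indicator 1 y * g y = ∫ y in p..q, g y := by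
  have e : (fun y => (Ioc p q).indicator 1 y * g y) = (Ioc p q).indicator g := by
    ext y; by_cases h : y ∈ Ioc p q <;> simp [h]
  rw [e, intervalIntegral.integral_of_le (by linarith), intervalIntegral.integral_of_le hpq,
    setIntegral_indicator measurableSet_Ioc,
    inter_eq_self_of_subset_right (Ioc_subset_Ioc ha hb)]

theorem integral_stepWeight_mul {x N : ℝ} (hx : |x| ≤ N) (g : ℝ → ℝ) :
    ∫ y in -N..N, stepWeight x y * g y = ∫ y in (0 : ℝ)..x, g y := by
  have hN : 0 ≤ N := (abs_nonneg x).trans hx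
  rw [abs_le] at hx
  rcases le_total 0 x with h | h
  · rw [stepWeight_of_nonneg h, integral_indicator_Ioc_mul (by linarith) h hx.2]
  · simp_rw [stepWeight_of_nonpos h, neg_mul, intervalIntegral.integral_neg]
    rw [integral_indicator_Ioc_mul hx.1 h hN, intervalIntegral.integral_symm, neg_neg]

/-- This is the spatial factor of the limiting covariance: the oriented intervals overlap only when
`x` and `x'` lie on the same side of `0`, and then their signs cancel. -/
theorem integral_stepWeight_mul_stepWeight {x x' N : ℝ} (hx : |x| ≤ N) :
    ∫ y in -N..N, stepWeight x y * stepWeight x' y =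
      if 0 < x * x' then min |x| |x'| else 0 := by
  rw [integral_stepWeight_mul hx]
  rcases lt_trichotomy x 0 with h | rfl | h
  · rcases lt_or_ge x' 0 with h' | h'
    · rw [if_pos (mul_pos_of_neg_of_neg h h'), abs_of_neg h, abs_of_neg h', stepWeight_of_nonpos h'.le,
        intervalIntegral.integral_symm, intervalIntegral.integral_neg, neg_neg]
      rcases le_total x x' with hle | hle
      · have := integral_indicator_Ioc_mul hle h'.le le_rfl (fun _ => 1)
        simp only [mul_one, intervalIntegral.integral_const, smul_eq_mul] at this
        rw [this, min_eq_right (by linarith)]; ring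
      · rw [intervalIntegral.integral_congr_ae (g := fun _ => (1 : ℝ))]
        · rw [min_eq_left (by linarith)]; simp
        · refine .of_forall fun y hy => ?_
          rw [uIoc_of_le h.le] at hy
          rw [indicator_of_mem (show y ∈ Ioc x' 0 from ⟨hle.trans_lt hy.1, hy.2⟩)]; rfl
    · rw [if_neg (by nlinarith), stepWeight_of_nonneg h',
        intervalIntegral.integral_congr_ae (g := fun _ => (0 : ℝ))]
      · simp
      · refine .of_forall fun y hy => ?_
        rw [uIoc_of_ge h.le] at hy
        rw [indicator_of_notMem fun hy' => by linarith [hy'.1, hy.2]]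
  · simp
  · rcases lt_or_ge 0 x' with h' | h'
    · rw [if_pos (mul_pos h h'), abs_of_pos h, abs_of_pos h', stepWeight_of_nonneg h'.le]
      rcases le_total x' x with hle | hle
      · have := integral_indicator_Ioc_mul le_rfl h'.le hle (fun _ => 1)
        simp only [mul_one, intervalIntegral.integral_const, smul_eq_mul] at this
        rw [this, min_eq_right hle]; ring
      · rw [intervalIntegral.integral_congr_ae (g := fun _ => (1 : ℝ))]
        · rw [min_eq_left hle]; simp
        · refine .of_forall fun y hy => ?_
          rw [uIoc_of_le h.le] at hy
          rw [indicator_of_mem (show y ∈ Ioc 0 x' from ⟨hy.1, hy.2.trans hle⟩)]; rfl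
    · rw [if_neg (by nlinarith), stepWeight_of_nonpos h',
        intervalIntegral.integral_congr_ae (g := fun _ => (0 : ℝ))]
      · simp
      · refine .of_forall fun y hy => ?_
        rw [uIoc_of_le h.le] at hy
        rw [indicator_of_notMem fun hy' => by linarith [hy'.2, hy.1], neg_zero]

end StepWeight

/-! ### Finite-dimensional convergence -/

section FiniteDimensional

/-- The coordinates `w ↦ (w (t, x)).1` and `w ↦ (w (t, x)).2` of the path space. -/
def pathCoord (p : (ℝ≥0 × ℝ) × Fin 2) (w : PathSpace) : ℝ :=
  if p.2 = 0 then (w p.1).1 else (w p.1).2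

theorem continuous_pathCoord (p : (ℝ≥0 × ℝ) × Fin 2) : Continuous (pathCoord p) := by
  unfold pathCoord
  split_ifs
  · exact (continuous_eval_const p.1).fst
  · exact (continuous_eval_const p.1).snd

/-- Finite linear combinations of the coordinates of the path space. -/
noncomputable def pathFunctional : PathSpace →ₗ[ℝ] ((ℝ≥0 × ℝ) × Fin 2 →₀ ℝ) →ₗ[ℝ] ℝ :=
  LinearMap.mk₂ ℝ (fun w a => Finsupp.linearCombination ℝ (fun p => pathCoord p w) a)
    (fun w w' a => by
      have : (fun p => pathCoord p (w + w')) = fun p => pathCoord p w + pathCoord p w' := by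
        ext p; unfold pathCoord; split_ifs <;> simp
      simp [Finsupp.linearCombination_apply, Finsupp.sum, this, mul_add, Finset.sum_add_distrib])
    (fun r w a => by
      have : (fun p => pathCoord p (r • w)) = fun p => r * pathCoord p w := by
        ext p; unfold pathCoord; split_ifs <;> simp
      simp [Finsupp.linearCombination_apply, Finsupp.sum, this, Finset.mul_sum, mul_left_comm])
    (fun w a a' => map_add _ _ _) (fun r w a => map_smul _ _ _)

theorem pathFunctional_apply (w : PathSpace) (a : (ℝ≥0 × ℝ) × Fin 2 →₀ ℝ) :
    pathFunctional w a = ∑ p ∈ a.support, a p * pathCoord p w := by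
  simp [pathFunctional, Finsupp.linearCombination_apply, Finsupp.sum]

theorem continuous_pathFunctional (a : (ℝ≥0 × ℝ) × Fin 2 →₀ ℝ) :
    Continuous fun w => pathFunctional w a := by
  simp_rw [pathFunctional_apply]
  exact continuous_finsetSum _ fun p _ => (continuous_pathCoord p).const_mul _

variable {S : Type*} [MeasurableSpace S]

/-- The limiting covariance of two coordinates of the rescaled paths. -/
noncomputable def pathCov (c : ℝ≥0 → ℝ → S → ℝ) (P : Measure S) (K : ℝ)
    (p q : (ℝ≥0 × ℝ) × Fin 2) : ℝ :=
  (if 0 < p.1.2 * q.1.2 then min |p.1.2| |q.1.2| else 0) *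
    ∫ z, ∫ ω, regTriple c K p.2.castSucc p.1.1 0 ω * regTriple c K q.2.castSucc q.1.1 z ω ∂P

/-- The limiting covariance form of finite linear combinations of coordinates. -/
noncomputable def pathForm (c : ℝ≥0 → ℝ → S → ℝ) (P : Measure S) (K : ℝ) :
    ((ℝ≥0 × ℝ) × Fin 2 →₀ ℝ) →ₗ[ℝ] ((ℝ≥0 × ℝ) × Fin 2 →₀ ℝ) →ₗ[ℝ] ℝ :=
  Finsupp.linearCombination ℝ fun p => Finsupp.linearCombination ℝ fun q => pathCov c P K p q

theorem pathForm_single (c : ℝ≥0 → ℝ → S → ℝ) (P : Measure S) (K : ℝ)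
    (p q : (ℝ≥0 × ℝ) × Fin 2) :
    pathForm c P K (Finsupp.single p 1) (Finsupp.single q 1) = pathCov c P K p q := by
  simp [pathForm]

theorem pathForm_apply (c : ℝ≥0 → ℝ → S → ℝ) (P : Measure S) (K : ℝ)
    (a b : (ℝ≥0 × ℝ) × Fin 2 →₀ ℝ) : pathForm c P K a b =
      ∑ p ∈ a.support, ∑ q ∈ b.support, a p * b q * pathCov c P K p q := by
  simp [pathForm, Finsupp.linearCombination_apply, Finsupp.sum, LinearMap.sum_apply,
    Finset.mul_sum, mul_assoc]

variable {P : Measure S} {c : ℝ≥0 → ℝ → S → ℝ} {K : ℝ}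

theorem pathCoord_regPathMap (hc : IsMeasurableField (tripleField c)) (hK : 0 ≤ K) (ε : ℝ) (ω : S)
    (p : (ℝ≥0 × ℝ) × Fin 2) :
    pathCoord p (regPathMap hc hK ε ω) = regPath c K ε p.2.castSucc p.1.1 p.1.2 ω := by
  obtain ⟨⟨t, x⟩, k⟩ := p
  fin_cases k <;> rfl

theorem IsMixingField.mono {past future : ℝ → MeasurableSpace S} {L : ℝ} {X : ℝ → S → ℝ}
    (hX : IsMixingField P past future K X) (hKL : K ≤ L) : IsMixingField P past future L X :=
  ⟨hX.measurable, fun y ω => (hX.bound y ω).trans hKL, hX.past, hX.future, hX.centered⟩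

/-- Convergence of the finite-dimensional laws of the rescaled paths, in terms of the
characteristic functions of finite linear combinations of coordinates. -/
theorem IsRegularMixingField.tendsto_integral_cexp_pathFunctional [IsProbabilityMeasure P]
    (hc : IsRegularMixingField c P K) (a : (ℝ≥0 × ℝ) × Fin 2 →₀ ℝ) :
    Tendsto (fun ε : Ioi (0 : ℝ) => ∫ ω, Complex.exp
        ((pathFunctional (regPathMap hc.meas hc.nonneg (ε : ℝ) ω) a : ℝ) * Complex.I) ∂P)
      (comap (Subtype.val : Ioi (0 : ℝ) → ℝ) (𝓝 0))
      (𝓝 (Real.exp (-pathForm c P K a a / 2))) := by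
  -- Sums serve as common upper bounds for the finitely many times, positions and coefficients, with
  -- no separate case for empty support. All coordinates then become integrals over the single
  -- interval `[-N, N]`.
  set T : ℝ := ∑ p ∈ a.support, (p.1.1 : ℝ) with hT
  set N : ℝ := ∑ p ∈ a.support, |p.1.2| with hN
  set B : ℝ := ∑ p ∈ a.support, |a p| with hB
  have hTp : ∀ p : a.support, (p.1.1.1 : ℝ) ≤ T := fun p =>
    Finset.single_le_sum (f := fun p : (ℝ≥0 × ℝ) × Fin 2 => (p.1.1 : ℝ))
      (fun q _ => q.1.1.coe_nonneg) p.2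
  have hNp : ∀ p : a.support, |p.1.1.2| ≤ N := fun p =>
    Finset.single_le_sum (f := fun p : (ℝ≥0 × ℝ) × Fin 2 => |p.1.2|) (fun q _ => abs_nonneg _) p.2
  have hBp : ∀ p : a.support, |a p.1| ≤ B := fun p =>
    Finset.single_le_sum (f := fun p => |a p|) (fun q _ => abs_nonneg _) p.2
  have hN0 : 0 ≤ N := Finset.sum_nonneg fun q _ => abs_nonneg _
  have hX : ∀ p : a.support, IsMixingField P (pastSigma c) (futureSigma c) (K * (1 + T) ^ 2)
      (regTriple c K p.1.2.castSucc p.1.1.1) := fun p => by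
    refine (hc.isMixingField p.1.2.castSucc p.1.1.1.coe_nonneg).mono ?_
    have := hc.nonneg
    rw [abs_of_nonneg p.1.1.1.coe_nonneg]
    gcongr
    exact hTp p
  have h := (isMixing_phiMixing hc.meas hc.mix).tendsto_integral_cexp hX
    (fun i j y z => hc.integral_regTriple_mul _ _ i.1.1.1.coe_nonneg j.1.1.1.coe_nonneg y z)
    (u := fun p y => a p.1 * stepWeight p.1.1.2 y) (B := B)
    (fun p => (measurable_stepWeight _).const_mul _)
    (fun p y => by
      rw [abs_mul]
      exact (mul_le_of_le_one_right (abs_nonneg _) (abs_stepWeight_le _ _)).trans (hBp p))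
    (fun p => (ae_continuousAt_stepWeight p.1.1.2).mono fun y hy => hy.const_mul _)
    (show -N ≤ N by linarith)
  have e1 : ∑ i : a.support, ∑ j : a.support,
      (∫ y in -N..N, (a i.1 * stepWeight i.1.1.2 y) * (a j.1 * stepWeight j.1.1.2 y)) *
        ∫ z, ∫ ω, regTriple c K i.1.2.castSucc i.1.1.1 0 ω *
          regTriple c K j.1.2.castSucc j.1.1.1 z ω ∂P = pathForm c P K a a := by
    rw [pathForm_apply, ← Finset.sum_coe_sort a.support]
    refine Finset.sum_congr rfl fun i _ => ?_
    rw [← Finset.sum_coe_sort a.support]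
    refine Finset.sum_congr rfl fun j _ => ?_
    have : ∀ y, (a i.1 * stepWeight i.1.1.2 y) * (a j.1 * stepWeight j.1.1.2 y) =
        (a i.1 * a j.1) * (stepWeight i.1.1.2 y * stepWeight j.1.1.2 y) := fun y => by ring
    simp_rw [this]
    rw [intervalIntegral.integral_const_mul, integral_stepWeight_mul_stepWeight (hNp i), pathCov]
    ring
  rw [e1] at h
  rw [neg_div] at h ⊢
  refine h.congr fun ε => ?_
  refine integral_congr_ae (.of_forall fun ω => ?_)
  have e2 : 1 / √(ε : ℝ) * ∫ y in -N..N, ∑ i : a.support, a i.1 * stepWeight i.1.1.2 y *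
      regTriple c K i.1.2.castSucc i.1.1.1 (y / ε) ω =
      pathFunctional (regPathMap hc.meas hc.nonneg (ε : ℝ) ω) a := by
    have hi : ∀ i ∈ (Finset.univ : Finset a.support), IntervalIntegrable (fun y => a i.1 *
        stepWeight i.1.1.2 y * regTriple c K i.1.2.castSucc i.1.1.1 (y / ε) ω) volume (-N) N := by
      intro i _
      refine intervalIntegrable_of_abs_le (B := B * (K * (1 + |(i.1.1.1 : ℝ)|) ^ 2))
        (((measurable_stepWeight _).const_mul _).mul
          (measurable_regTriple_space hc.meas K _ _ _ ω)) fun y _ => ?_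
      change |a i.1 * stepWeight i.1.1.2 y * _| ≤ _
      rw [abs_mul, abs_mul]
      refine mul_le_mul ?_ (abs_regTriple_le c hc.nonneg _ _ _ _) (abs_nonneg _)
        ((abs_nonneg _).trans (hBp i))
      exact (mul_le_of_le_one_right (abs_nonneg _) (abs_stepWeight_le _ _)).trans (hBp i)
    rw [intervalIntegral.integral_finsetSum hi, pathFunctional_apply, ← Finset.sum_coe_sort a.support,
      Finset.mul_sum]
    refine Finset.sum_congr rfl fun i _ => ?_
    simp_rw [mul_assoc]
    rw [intervalIntegral.integral_const_mul, integral_stepWeight_mul (hNp i),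
      pathCoord_regPathMap, regPath]
    ring
  simp only [e2]

end FiniteDimensional

/-! ### Identification of the limit law -/

section LimitLaw

theorem norm_cexp_ofReal_mul_I_le (r : ℝ) : ‖Complex.exp (r * Complex.I)‖ ≤ 1 :=
  (Complex.norm_exp_ofReal_mul_I r).le

/-- The characteristic function `w ↦ exp (i ⟨w, a⟩)` as a bounded continuous function on the
path space. -/
noncomputable def pathChar (a : (ℝ≥0 × ℝ) × Fin 2 →₀ ℝ) :
    BoundedContinuousFunction PathSpace ℂ :=
  BoundedContinuousFunction.ofNormedAddCommGroup
    (fun w => Complex.exp ((pathFunctional w a : ℝ) * Complex.I))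
    (((Complex.continuous_ofReal.comp (continuous_pathFunctional a)).mul continuous_const).cexp) 1
    fun _ => norm_cexp_ofReal_mul_I_le _

theorem pathChar_apply (a : (ℝ≥0 × ℝ) × Fin 2 →₀ ℝ) (w : PathSpace) :
    pathChar a w = Complex.exp ((pathFunctional w a : ℝ) * Complex.I) := rfl

theorem pathFunctional_single (w : PathSpace) (p : (ℝ≥0 × ℝ) × Fin 2) (r : ℝ) :
    pathFunctional w (Finsupp.single p r) = r * pathCoord p w := by
  simp [pathFunctional]

theorem pathFunctional_ne_zero {w : PathSpace} (hw : w ≠ 0) : pathFunctional w ≠ 0 := by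
  intro h
  refine hw (ContinuousMap.ext fun p => ?_)
  have h0 := pathFunctional_single w (p, 0) 1
  have h1 := pathFunctional_single w (p, 1) 1
  rw [h] at h0 h1
  simp only [LinearMap.zero_apply, one_mul] at h0 h1
  exact Prod.ext h0.symm h1.symm

/-- A finite measure on the path space is determined by the characteristic functions of the finite
linear combinations of coordinates. -/
theorem pathSpace_measure_ext {Q Q' : Measure PathSpace} [IsFiniteMeasure Q] [IsFiniteMeasure Q']
    (h : ∀ a, ∫ w, pathChar a w ∂Q = ∫ w, pathChar a w ∂Q') : Q = Q' := by
  let _ := TopologicalSpace.upgradeIsCompletelyMetrizable PathSpace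
  -- The coefficient space serves only as an index set of characters; in the discrete topology,
  -- joint continuity of the pairing reduces to continuity in the path.
  let _ : TopologicalSpace ((ℝ≥0 × ℝ) × Fin 2 →₀ ℝ) := ⊥
  have : DiscreteTopology ((ℝ≥0 × ℝ) × Fin 2 →₀ ℝ) := ⟨rfl⟩
  have hL : Continuous fun p : PathSpace × ((ℝ≥0 × ℝ) × Fin 2 →₀ ℝ) => pathFunctional p.1 p.2 :=
    continuous_prod_of_discrete_right.2 continuous_pathFunctional
  refine ext_of_integral_char_eq Real.continuous_probChar Real.probChar_ne_one
    (fun w hw => pathFunctional_ne_zero hw) hL fun a => ?_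
  simpa only [BoundedContinuousFunction.char_apply, Real.probChar_apply, pathChar_apply] using h a

variable {S : Type*} [MeasurableSpace S] {P : Measure S} [IsProbabilityMeasure P]
  {c : ℝ≥0 → ℝ → S → ℝ} {K : ℝ}

/-- The law of the rescaled path. -/
noncomputable def regPathLaw (P : Measure S) [IsProbabilityMeasure P]
    (hc : IsMeasurableField (tripleField c)) (hK : 0 ≤ K) (ε : ℝ) : ProbabilityMeasure PathSpace :=
  ⟨P.map (regPathMap hc hK ε),
    Measure.isProbabilityMeasure_map (measurable_regPathMap hc hK ε).aemeasurable⟩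

theorem coe_regPathLaw (hc : IsMeasurableField (tripleField c)) (hK : 0 ≤ K) (ε : ℝ) :
    (regPathLaw P hc hK ε : Measure PathSpace) = P.map (regPathMap hc hK ε) := rfl

theorem neBot_comap_val_Ioi_zero : (comap (Subtype.val : Ioi (0 : ℝ) → ℝ) (𝓝 0)).NeBot := by
  rw [← mem_closure_iff_comap_neBot, closure_Ioi]
  exact self_mem_Ici

/-- The laws of the rescaled paths converge weakly. -/
theorem IsRegularMixingField.exists_tendsto_regPathLaw (hc : IsRegularMixingField c P K) :
    ∃ Q : ProbabilityMeasure PathSpace,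
      Tendsto (fun ε : Ioi (0 : ℝ) => regPathLaw P hc.meas hc.nonneg (ε : ℝ))
        (comap (Subtype.val : Ioi (0 : ℝ) → ℝ) (𝓝 0)) (𝓝 Q) ∧
      ∀ a, ∫ w, pathChar a w ∂(Q : Measure PathSpace) = Real.exp (-pathForm c P K a a / 2) := by
  set l := comap (Subtype.val : Ioi (0 : ℝ) → ℝ) (𝓝 0) with hl
  set μ := fun ε : Ioi (0 : ℝ) => regPathLaw P hc.meas hc.nonneg (ε : ℝ) with hμ
  have hcpt : IsCompact (closure (range μ)) := by
    refine isCompact_closure_of_isTightMeasureSet ?_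
    convert hc.isTightMeasureSet using 1
    ext ν
    simp [hμ, coe_regPathLaw]
  -- By Prokhorov every finer ultrafilter converges, and its limit has the prescribed characteristic
  -- functions. These determine the law, so all the limits coincide and the whole filter converges.
  have hcluster : ∀ U : Ultrafilter (Ioi (0 : ℝ)), (U : Filter (Ioi (0 : ℝ))) ≤ l →
      ∃ Q : ProbabilityMeasure PathSpace, Tendsto μ U (𝓝 Q) ∧
        ∀ a, ∫ w, pathChar a w ∂(Q : Measure PathSpace) =
          Real.exp (-pathForm c P K a a / 2) := by
    intro U hU
    obtain ⟨Q, -, hQ⟩ := hcpt.ultrafilter_le_nhds (U.map μ)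
      (le_principal_iff.2 (mem_of_superset (range_mem_map) subset_closure))
    have hQ' : Tendsto μ U (𝓝 Q) := hQ
    refine ⟨Q, hQ', fun a => ?_⟩
    have h1 := (ProbabilityMeasure.tendsto_iff_forall_integral_rclike_tendsto ℂ).1 hQ' (pathChar a)
    have h2 := (hc.tendsto_integral_cexp_pathFunctional a).mono_left hU
    refine tendsto_nhds_unique h1 (h2.congr fun ε => ?_)
    rw [hμ, coe_regPathLaw, integral_map (measurable_regPathMap _ _ _).aemeasurable
      (pathChar a).continuous.aestronglyMeasurable]
    rfl
  have := neBot_comap_val_Ioi_zero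
  obtain ⟨Q, hQ, hQc⟩ := hcluster (Ultrafilter.of l) (Ultrafilter.of_le l)
  refine ⟨Q, (tendsto_iff_ultrafilter _ _ _).2 fun U hU => ?_, hQc⟩
  obtain ⟨Q', hQ', hQc'⟩ := hcluster U hU
  have e : Q' = Q := Subtype.ext (pathSpace_measure_ext
    (Q := (Q' : Measure PathSpace)) (Q' := (Q : Measure PathSpace))
    fun a => (hQc' a).trans (hQc a).symm)
  rwa [e] at hQ'

end LimitLaw

/-! ### Gaussianity and covariance of the limit -/

section Gaussian

variable {S : Type*} [MeasurableSpace S] {P : Measure S}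
  {c : ℝ≥0 → ℝ → S → ℝ} {K : ℝ} {Q : Measure PathSpace} [IsProbabilityMeasure Q]

/-- A characteristic function has modulus at most one, so positivity of the limiting form needs no
separate argument. -/
theorem pathForm_self_nonneg
    (hQ : ∀ a, ∫ w, pathChar a w ∂Q = Real.exp (-pathForm c P K a a / 2))
    (a : (ℝ≥0 × ℝ) × Fin 2 →₀ ℝ) : 0 ≤ pathForm c P K a a := by
  have h : ‖∫ w, pathChar a w ∂Q‖ ≤ 1 := by
    refine (norm_integral_le_of_norm_le_const (C := 1) (.of_forall fun w => ?_)).trans (by simp)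
    exact norm_cexp_ofReal_mul_I_le _
  rw [hQ a, Complex.norm_real, Real.norm_eq_abs, abs_of_pos (Real.exp_pos _),
    Real.exp_le_one_iff] at h
  linarith

theorem map_pathFunctional_eq_gaussianReal
    (hQ : ∀ a, ∫ w, pathChar a w ∂Q = Real.exp (-pathForm c P K a a / 2))
    (a : (ℝ≥0 × ℝ) × Fin 2 →₀ ℝ) : Q.map (fun w => pathFunctional w a) =
      gaussianReal 0 (pathForm c P K a a).toNNReal := by
  have hm : Measurable fun w => pathFunctional w a := (continuous_pathFunctional a).measurable
  have := Measure.isProbabilityMeasure_map (μ := Q) hm.aemeasurable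
  refine Measure.ext_of_charFun (funext fun s => ?_)
  rw [charFun_gaussianReal, charFun_apply_real, integral_map hm.aemeasurable
    (by fun_prop), Real.coe_toNNReal _ (pathForm_self_nonneg hQ a)]
  -- Replacing `a` by `s • a` recovers the whole one-dimensional characteristic function, since the
  -- form is quadratic.
  have h := hQ (s • a)
  simp only [pathChar_apply, map_smul, LinearMap.smul_apply, smul_eq_mul] at h
  push_cast at h ⊢
  rw [h]
  congr 1
  ring

theorem integral_pathFunctional_eq_zero
    (hQ : ∀ a, ∫ w, pathChar a w ∂Q = Real.exp (-pathForm c P K a a / 2))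
    (a : (ℝ≥0 × ℝ) × Fin 2 →₀ ℝ) : ∫ w, pathFunctional w a ∂Q = 0 := by
  have hm : Measurable fun w => pathFunctional w a := (continuous_pathFunctional a).measurable
  have h := integral_map (μ := Q) hm.aemeasurable (f := fun x : ℝ => x) (by fun_prop)
  rw [map_pathFunctional_eq_gaussianReal hQ, integral_id_gaussianReal] at h
  exact h.symm

theorem memLp_pathFunctional
    (hQ : ∀ a, ∫ w, pathChar a w ∂Q = Real.exp (-pathForm c P K a a / 2))
    (a : (ℝ≥0 × ℝ) × Fin 2 →₀ ℝ) : MemLp (fun w => pathFunctional w a) 2 Q := by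
  have hm : Measurable fun w => pathFunctional w a := (continuous_pathFunctional a).measurable
  have h : MemLp id 2 (Q.map fun w => pathFunctional w a) := by
    rw [map_pathFunctional_eq_gaussianReal hQ]
    exact memLp_id_gaussianReal 2
  exact h.comp_of_map hm.aemeasurable

theorem integral_pathFunctional_sq
    (hQ : ∀ a, ∫ w, pathChar a w ∂Q = Real.exp (-pathForm c P K a a / 2))
    (a : (ℝ≥0 × ℝ) × Fin 2 →₀ ℝ) : ∫ w, pathFunctional w a ^ 2 ∂Q = pathForm c P K a a := by
  have hm : Measurable fun w => pathFunctional w a := (continuous_pathFunctional a).measurable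
  have h := variance_id_gaussianReal (μ := 0) (v := (pathForm c P K a a).toNNReal)
  rw [← map_pathFunctional_eq_gaussianReal hQ, variance_map aemeasurable_id hm.aemeasurable,
    Function.id_comp,
    variance_of_integral_eq_zero hm.aemeasurable (integral_pathFunctional_eq_zero hQ a),
    Real.coe_toNNReal _ (pathForm_self_nonneg hQ a)] at h
  exact h

/-- Polarization of the second moments. Characteristic functions see only the symmetric part of the
form, which explains the average of the two orders. -/
theorem integral_pathCoord_mul
    (hQ : ∀ a, ∫ w, pathChar a w ∂Q = Real.exp (-pathForm c P K a a / 2))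
    (p q : (ℝ≥0 × ℝ) × Fin 2) : ∫ w, pathCoord p w * pathCoord q w ∂Q =
      (pathCov c P K p q + pathCov c P K q p) / 2 := by
  set a : (ℝ≥0 × ℝ) × Fin 2 →₀ ℝ := Finsupp.single p 1
  set b : (ℝ≥0 × ℝ) × Fin 2 →₀ ℝ := Finsupp.single q 1
  have ha : ∀ w, pathCoord p w = pathFunctional w a := fun w => by
    rw [pathFunctional_single, one_mul]
  have hb : ∀ w, pathCoord q w = pathFunctional w b := fun w => by
    rw [pathFunctional_single, one_mul]
  have e : ∀ w, pathCoord p w * pathCoord q w = (pathFunctional w (a + b) ^ 2 -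
      pathFunctional w a ^ 2 - pathFunctional w b ^ 2) / 2 := fun w => by
    rw [ha, hb, map_add]; ring
  have i1 := (memLp_pathFunctional hQ (a + b)).integrable_sq
  have i2 := (memLp_pathFunctional hQ a).integrable_sq
  have i3 := (memLp_pathFunctional hQ b).integrable_sq
  have i12 : Integrable (fun w => pathFunctional w (a + b) ^ 2 - pathFunctional w a ^ 2) Q :=
    i1.sub i2
  simp_rw [e]
  rw [integral_div, integral_sub i12 i3, integral_sub i1 i2,
    integral_pathFunctional_sq hQ, integral_pathFunctional_sq hQ, integral_pathFunctional_sq hQ]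
  simp only [map_add, LinearMap.add_apply]
  rw [← pathForm_single c P K p q, ← pathForm_single c P K q p]
  ring

theorem isGaussianProcess_pathSpace
    (hQ : ∀ a, ∫ w, pathChar a w ∂Q = Real.exp (-pathForm c P K a a / 2)) :
    IsGaussianProcess (fun (p : ℝ≥0 × ℝ) (w : PathSpace) => w p) Q where
  hasGaussianLaw I := by
    classical
    have hm : Measurable fun w : PathSpace => I.restrict fun p => w p :=
      measurable_pi_iff.2 fun p => measurable_pathSpace_eval p.1
    refine ⟨isGaussian_of_map_eq_gaussianReal fun L => ?_⟩
    -- A continuous linear functional on finitely many values in `ℝ × ℝ` is a combination of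
    -- coordinates; its coefficients are its values on the standard basis.
    set a : (ℝ≥0 × ℝ) × Fin 2 →₀ ℝ := ∑ p : I,
      (Finsupp.single (p.1, 0) (L (Pi.single p (1, 0))) +
        Finsupp.single (p.1, 1) (L (Pi.single p (0, 1)))) with ha
    refine ⟨0, (pathForm c P K a a).toNNReal, ?_⟩
    rw [Measure.map_map L.continuous.measurable hm, ← map_pathFunctional_eq_gaussianReal hQ]
    congr 1
    ext w
    have e : (I.restrict fun p => w p) = ∑ p : I, ((w p.1).1 • (Pi.single p (1, 0) : I → ℝ × ℝ) +
        (w p.1).2 • (Pi.single p (0, 1) : I → ℝ × ℝ)) := by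
      funext q
      rw [Finset.sum_apply, Finset.sum_eq_single q]
      · simp only [Finset.restrict, Pi.add_apply, Pi.smul_apply, Pi.single_eq_same]
        exact Prod.ext (by simp) (by simp)
      · intro p _ hp
        simp only [Pi.add_apply, Pi.smul_apply, Pi.single_eq_of_ne (Ne.symm hp), smul_zero,
          add_zero]
      · exact fun h => absurd (Finset.mem_univ q) h
    rw [Function.comp_apply, e, ha, map_sum, map_sum]
    refine Finset.sum_congr rfl fun p _ => ?_
    rw [map_add, map_add, map_smul, map_smul, pathFunctional_single, pathFunctional_single,
      smul_eq_mul, smul_eq_mul]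
    simp only [pathCoord]
    simp [mul_comm]

end Gaussian

/-! ### The limit field and its time derivative -/

section LimitField

variable {S : Type*} [MeasurableSpace S] {P : Measure S} {c : ℝ≥0 → ℝ → S → ℝ} {K : ℝ}

/-- Stationarity makes the correlation function invariant under reversing both arguments, and the
reflection in space disappears after integration. -/
theorem corrIntegral_neg (hc : IsStationaryField c P) (r : ℝ) :
    corrIntegral c P (-r) = corrIntegral c P r := by
  rw [corrIntegral, corrIntegral, ← integral_neg_eq_self]
  congr 1
  ext x
  have h1 := corrFun_eq hc r.toNNReal (-r).toNNReal x (-x)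
  have h2 := corrFun_eq hc (-r).toNNReal r.toNNReal 0 x
  have e : ((r.toNNReal : ℝ)) - (-r).toNNReal = r := by
    rw [Real.coe_toNNReal', Real.coe_toNNReal']
    rcases le_total 0 r with h | h
    · rw [max_eq_left h, max_eq_right (by linarith)]; ring
    · rw [max_eq_right h, max_eq_left (by linarith)]; ring
  have e' : (((-r).toNNReal : ℝ)) - r.toNNReal = -r := by linarith
  rw [e'] at h1
  rw [e] at h2
  rw [← h1, ← h2, add_neg_cancel, zero_add]
  simp_rw [mul_comm]

theorem IsRegularMixingField.isStationaryField (hc : IsRegularMixingField c P K) :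
    IsStationaryField c P := by
  intro s y n p
  have hm : Measurable fun (v : Fin n → ℝ × ℝ × ℝ) i => (v i).1 := by fun_prop
  exact (hc.stat s y n p).comp hm

/-- The correlation produced by the limit theorem has time lag `t' - t`; evenness of the integrated
correlation reverses it. -/
theorem IsRegularMixingField.pathCov_zero (hc : IsRegularMixingField c P K) (t t' : ℝ≥0)
    (x x' : ℝ) : pathCov c P K ((t, x), 0) ((t', x'), 0) = limitCov c P t x t' x' := by
  have h : ∫ z, ∫ ω, regTriple c K 0 t 0 ω * regTriple c K 0 t' z ω ∂P =
      corrIntegral c P ((t : ℝ) - t') := by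
    rw [← corrIntegral_neg hc.isStationaryField, neg_sub, corrIntegral]
    congr 1
    ext z
    rw [← corrFun_eq hc.isStationaryField t t' 0 z, zero_add]
    refine integral_congr_ae ?_
    filter_upwards [hc.regTriple_ae_eq 0 t.coe_nonneg 0, hc.regTriple_ae_eq 0 t'.coe_nonneg z]
      with ω h1 h2
    rw [h1, h2, Real.toNNReal_coe, Real.toNNReal_coe]
    rfl
  simp only [pathCov, Fin.castSucc_zero, h, limitCov]
  split_ifs <;> ring

theorem limitCov_comm (hc : IsStationaryField c P) (t t' : ℝ≥0) (x x' : ℝ) :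
    limitCov c P t' x' t x = limitCov c P t x t' x' := by
  rw [limitCov, limitCov, ← corrIntegral_neg hc, neg_sub, min_comm, mul_comm x']

/-- The paths whose second coordinate is the time derivative of the first one, in integral form. -/
def primitivePaths : Set PathSpace :=
  {w | ∀ (t : ℝ≥0) (x : ℝ),
    (w (t, x)).1 - (w (0, x)).1 = ∫ s in (0 : ℝ)..t, (w (s.toNNReal, x)).2}

theorem isClosed_primitivePaths : IsClosed primitivePaths := by
  simp only [primitivePaths, Set.ofPred_forall]
  refine isClosed_iInter fun t => isClosed_iInter fun x => isClosed_eq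
    ((continuous_eval_const _).fst.sub (continuous_eval_const _).fst) ?_
  refine intervalIntegral.continuous_parametric_intervalIntegral_of_continuous' ?_ _ _
  have h : Continuous fun z : PathSpace × ℝ => z.1 (z.2.toNNReal, x) :=
    continuous_eval.comp (continuous_fst.prodMk
      ((continuous_real_toNNReal.comp continuous_snd).prodMk continuous_const))
  exact h.snd

theorem regPathMap_mem_primitivePaths (hc : IsMeasurableField (tripleField c)) (hK : 0 ≤ K)
    (ε : ℝ) (ω : S) : regPathMap hc hK ε ω ∈ primitivePaths := by
  intro t x
  have h := regPath_sub_time hc hK ε 0 0 t x ω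
  simp only [regPathMap_apply, NNReal.coe_zero]
  refine h.trans (intervalIntegral.integral_congr fun s hs => ?_)
  rw [uIcc_of_le t.coe_nonneg] at hs
  simp only [Real.coe_toNNReal _ hs.1]
  rfl

/-- The fundamental theorem of calculus applies because the second coordinate is continuous. The
conclusion holds at all `(t, x)` at once, so one null set suffices for the limit field. -/
theorem hasDerivWithinAt_of_mem_primitivePaths {w : PathSpace} (hw : w ∈ primitivePaths)
    (t : ℝ≥0) (x : ℝ) :
    HasDerivWithinAt (fun s : ℝ => (w (s.toNNReal, x)).1) (w (t, x)).2 (Ici 0) (t : ℝ) := by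
  have hcont : Continuous fun s : ℝ => (w (s.toNNReal, x)).2 :=
    (w.continuous.comp (continuous_real_toNNReal.prodMk continuous_const)).snd
  have h := ((hcont.integral_hasStrictDerivAt 0 t).hasDerivAt.const_add
    (w (0, x)).1).hasDerivWithinAt (s := Ici 0)
  rw [Real.toNNReal_coe] at h
  have e : ∀ s ∈ Ici (0 : ℝ), (w (s.toNNReal, x)).1 =
      (w (0, x)).1 + ∫ r in (0 : ℝ)..s, (w (r.toNNReal, x)).2 := by
    intro s hs
    have := hw s.toNNReal x
    rw [Real.coe_toNNReal s hs] at this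
    linarith
  exact h.congr e (e t t.coe_nonneg)

theorem IsRegularMixingField.exists_isLimitField [IsProbabilityMeasure P]
    (hc : IsRegularMixingField c P K) : ∃ Q : ProbabilityMeasure PathSpace,
      IsLimitField (Q : Measure PathSpace) (limitCov c P) id ∧
      Tendsto (fun ε : Ioi (0 : ℝ) => regPathLaw P hc.meas hc.nonneg (ε : ℝ))
        (comap (Subtype.val : Ioi (0 : ℝ) → ℝ) (𝓝 0)) (𝓝 Q) := by
  obtain ⟨Q, hQ, hchar⟩ := hc.exists_tendsto_regPathLaw
  refine ⟨Q, ⟨measurable_id, isGaussianProcess_pathSpace hchar, fun p => ?_, fun t x t' x' => ?_, ?_⟩,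
    hQ⟩
  · have h0 := integral_pathFunctional_eq_zero hchar (Finsupp.single (p, 0) 1)
    have h1 := integral_pathFunctional_eq_zero hchar (Finsupp.single (p, 1) 1)
    simp only [pathFunctional_single, one_mul] at h0 h1
    exact ⟨h0, h1⟩
  · have h := integral_pathCoord_mul hchar ((t, x), 0) ((t', x'), 0)
    rw [hc.pathCov_zero, hc.pathCov_zero, limitCov_comm hc.isStationaryField t t' x x',
      add_self_div_two] at h
    exact h
  · have := neBot_comap_val_Ioi_zero
    -- Differentiation is not continuous on the path space, but its integral form is a closed
    -- condition. It has probability one under every prelimit law, so the portmanteau theorem gives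
    -- probability one in the limit.
    have h := ProbabilityMeasure.limsup_measure_closed_le_of_tendsto hQ isClosed_primitivePaths
    have e : ∀ ε : Ioi (0 : ℝ), (regPathLaw P hc.meas hc.nonneg (ε : ℝ) : Measure PathSpace)
        primitivePaths = 1 := by
      intro ε
      rw [coe_regPathLaw, Measure.map_apply (measurable_regPathMap _ _ _)
        isClosed_primitivePaths.measurableSet]
      have : regPathMap hc.meas hc.nonneg (ε : ℝ) ⁻¹' primitivePaths = univ :=
        eq_univ_of_forall fun ω => regPathMap_mem_primitivePaths hc.meas hc.nonneg ε ω
      rw [this, measure_univ]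
    simp only [e, limsup_const] at h
    have h1 : (Q : Measure PathSpace) primitivePaths = 1 := le_antisymm prob_le_one h
    have h2 : ∀ᵐ w ∂(Q : Measure PathSpace), w ∈ primitivePaths :=
      (prob_compl_eq_zero_iff isClosed_primitivePaths.measurableSet).2 h1
    filter_upwards [h2] with w hw t x using hasDerivWithinAt_of_mem_primitivePaths hw t x

end LimitField

/-! ### The invariance principle -/

theorem mainTheorem8 {S : Type*} [MeasurableSpace S] (P : Measure S) [IsProbabilityMeasure P]
    (c : ℝ≥0 → ℝ → S → ℝ)
    -- `(c, c', c'')` is a measurable, stationary, centered, uniformly bounded random field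
    -- and `c` is of class `C²` in time
    (h_meas : IsMeasurableField (tripleField c))
    (h_C2 : ∀ x : ℝ, ∀ᵐ ω ∂P, IsC2OnHalfLine (fun t => c t x ω))
    (h_stat : IsStationaryField (tripleField c) P)
    (h_mean : ∀ (t : ℝ≥0) (x : ℝ), ∫ ω, c t x ω ∂P = 0 ∧ ∫ ω, fieldDeriv c t x ω ∂P = 0 ∧
      ∫ ω, fieldDeriv (fieldDeriv c) t x ω ∂P = 0)
    (h_bdd : ∃ K : ℝ, ∀ (t : ℝ≥0) (x : ℝ), ∀ᵐ ω ∂P, |c t x ω| ≤ K ∧ |fieldDeriv c t x ω| ≤ K ∧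
      |fieldDeriv (fieldDeriv c) t x ω| ≤ K)
    -- the correlation function belongs to `L¹(ℝ × ℝ)`
    (h_corr : Integrable (fun p : ℝ × ℝ => corrFun c P p.1 p.2))
    -- mixing in the `x` direction
    (h_mix : IntegrableOn (fun h : ℝ => √(phiMixing c P h)) (Ioi 0))
    -- integrability in `x` of the correlations of `c`, `c'`, `c''`
    (h_int0 : ∀ t : ℝ≥0, Integrable (fun x : ℝ => ∫ ω, c t 0 ω * c t x ω ∂P))
    (h_int1 : ∀ t : ℝ≥0, Integrable (fun x : ℝ => ∫ ω, fieldDeriv c t 0 ω * fieldDeriv c t x ω ∂P))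
    (h_int2 : ∀ t : ℝ≥0, Integrable (fun x : ℝ =>
      ∫ ω, fieldDeriv (fieldDeriv c) t 0 ω * fieldDeriv (fieldDeriv c) t x ω ∂P)) :
    (∀ ε : ℝ, 0 < ε → ∃ w : S → PathSpace, IsPathVersion c P ε w) ∧
    ∃ (Ω : Type) (_ : MeasurableSpace Ω) (Q : Measure Ω) (_ : IsProbabilityMeasure Q)
      (Z : Ω → PathSpace),
      IsLimitField Q (limitCov c P) Z ∧
      ∀ w : Ioi (0 : ℝ) → S → PathSpace, (∀ ε : Ioi (0 : ℝ), IsPathVersion c P (ε : ℝ) (w ε)) →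
        TendstoInDistribution w (comap (Subtype.val : Ioi (0 : ℝ) → ℝ) (𝓝 0)) Z (fun _ => P) Q := by
  obtain ⟨K, hK⟩ := h_bdd
  have hK0 : 0 ≤ K := by
    obtain ⟨ω, hω⟩ := (hK 0 0).exists
    exact (abs_nonneg _).trans hω.1
  have hc : IsRegularMixingField c P K := ⟨h_meas, h_C2, h_stat, h_mean, hK, hK0, h_mix⟩
  refine ⟨fun ε _ => ⟨_, hc.isPathVersion ε⟩, ?_⟩
  obtain ⟨Q, hQ, hlim⟩ := hc.exists_isLimitField
  -- The limit is realized canonically, as the identity on the path space under the limit law.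
  -- Convergence is known for the regularized paths and passes to any other version by almost sure
  -- equality.
  refine ⟨PathSpace, inferInstance, Q, inferInstance, id, hQ, fun w hw => ?_⟩
  have h : TendstoInDistribution (fun ε : Ioi (0 : ℝ) => regPathMap hc.meas hc.nonneg (ε : ℝ))
      (comap (Subtype.val : Ioi (0 : ℝ) → ℝ) (𝓝 0)) id (fun _ => P) (Q : Measure PathSpace) :=
    { forall_aemeasurable := fun ε => (measurable_regPathMap _ _ _).aemeasurable
      aemeasurable_limit := aemeasurable_id
      tendsto := by
        have e : (⟨(Q : Measure PathSpace).map id, Measure.isProbabilityMeasure_map aemeasurable_id⟩ :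
            ProbabilityMeasure PathSpace) = Q := Subtype.ext Measure.map_id
        rw [e]
        exact hlim }
  exact h.congr (fun ε => (hc.isPathVersion ε).ae_eq (hw ε)) (ae_eq_refl id)
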